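/- **Setting.** Let $G$ be a countable discrete group with a sofic approximation $\Sigma=(\sigma_n)_{n}$: maps $\sigma_n:G\to\mathrm{Sym}(V_n)$, with $V_n$ finite and non-empty, such that for all $g,h\in G$ the proportion of $v\in V_n$ with $\sigma_n^g(\sigma_n^h(v))=\sigma_n^{gh}(v)$ tends to $1$, and for all $g\ne e$ the proportion of $v$ with $\sigma_n^g(v)\neq v$ tends to $1$. A $G$-system $(X,\mu,T)$ is a measurable $\mu$-preserving action $T$ of $G$ on a standard Borel probability space. A metric $G$-process is a right-shift-invariant probability measure $P$ on $K^G$, where $(K,d)$ is a compact metric space with its Borel $\sigma$-algebra. For $\mathbf x\in K^{V_n}$ and $v\in V_n$ put $\Pi_v^{\sigma_n}(\mathbf x)=(x_{\sigma_n^g(v)})_{g\in G}\in K^G$ and $P_{\mathbf x}^{\sigma_n}=\frac1{|V_n|}\sum_{v\in V_n}\delta_{\Pi_v^{\sigma_n}(\mathbf x)}$. Probability measures $m_n$ on $K^{V_n}$ *quenched converge* to $P$ over $\Sigma$ ($m_n\stackrel{q}{\to}P$) if for every weak$^*$ neighbourhood $O$ of $P$ one has $\frac1{|V_n|}\big|\{v\in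 V_n:(\Pi_v^{\sigma_n})_*m_n\in O\}\big|\to1$ and $m_n\{\mathbf x:P_{\mathbf x}^{\sigma_n}\in O\}\to1$. They *doubly-quenched converge* ($m_n\stackrel{dq}{\to}P$) if $m_n\times m_n\stackrel{q}{\to}P\times P$, as measures on $(K\times K)^{V_n}$ and $(K\times K)^G$. For $\varepsilon,\delta>0$ let $\mathrm{cov}_{\varepsilon,\delta}(m_n)$ be the least $|F|$ over $F\subseteq K^{V_n}$ whose $\delta$-neighbourhood in the metric $\frac1{|V_n|}\sum_v d(x_v,y_v)$ has $m_n$-measure $>1-\varepsilon$. For $\ast\in\{q,dq\}$ define, in $[-\infty,+\infty]$ with $\sup\emptyset=-\infty$, $$h^{\ast}_\Sigma(P)=\sup\Big\{\sup_{\delta,\varepsilon>0}\limsup_{i\to\infty}\tfrac1{|V_{n_i}|}\log\mathrm{cov}_{\varepsilon,\delta}(m_i)\ :\ n_1<n_2<\cdots,\ m_i\stackrel{\ast}{\to}P\text{ over }(\sigma_{n_i})_i\Big\},$$ $$\underline h^{\ast}_\Sigma(P)=\sup\Big\{\sup_{\delta,\varepsilon>0}\liminf_{n\to\infty}\tfrac1{|V_{n}|}\log\mathrm{cov}_{\varepsilon,\delta}(m_n)\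 :\ m_n\stackrel{\ast}{\to}P\text{ over }\Sigma\Big\}.$$ For a $G$-system $(X,\mu,T)$, the values $h^\ast_\Sigma(\mu,T)$ and $\underline h^\ast_\Sigma(\mu,T)$ are those of any metric $G$-process isomorphic to it, i.e. of the image of $\mu$ under $x\mapsto(\varphi(T^gx))_{g\in G}\in K^G$, where $K$ is a compact metric space and $\varphi:X\to K$ is measurable and such that this map is injective on a $\mu$-conull measurable set. The statement below holds for every choice of such processes for the systems involved. **Theorem C.** Let $(X,\mu,T)$ and $(Y,\nu,S)$ be $G$-systems. In sums, $-\infty+(+\infty)=-\infty$. 1. For every joining $\lambda$ of the two systems (a $(T\times S)$-invariant probability measure on $X\times Y$ with marginals $\mu$ and $\nu$), and in particular for $\lambda=\mu\times\nu$, $$h^{dq}_\Sigma(\lambda,T\times S)\le h^{dq}_\Sigma(\mu,T)+h^{dq}_\Sigma(\nu,S),\qquad h^{q}_\Sigma(\lambda,T\times S)\le h^{q}_\Sigma(\mu,T)+h^{q}_\Sigma(\nu,S).$$ 2. If $h^{dq}_\Sigma(\nu,S)=\underline h^{dq}_\Sigma(\nu,S)$, then $h^{dq}_\Sigma(\mu\times\nu,T\times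 S)=h^{dq}_\Sigma(\mu,T)+h^{dq}_\Sigma(\nu,S)$. 3. If $\mu\times\nu$ is ergodic and $h^{q}_\Sigma(\nu,S)=\underline h^{q}_\Sigma(\nu,S)$, then $h^{q}_\Sigma(\mu\times\nu,T\times S)=h^{q}_\Sigma(\mu,T)+h^{q}_\Sigma(\nu,S)$. In particular, $\mu\times\nu$ is ergodic, and so this applies, if $\mu$ and $\nu$ are both ergodic and one of them is weakly mixing (its Cartesian square is ergodic). -/

import Mathlib

open MeasureTheory Filter Topology
open scoped ENNReal

noncomputable section

/-- Given finite non-empty sets `V n`, the property `p n v` holds with high probability in the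
uniformly random vertex `v` of `V n` as `n → ∞`. -/
def WithHighProb (V : ℕ → Type) (p : ∀ n, V n → Prop) : Prop :=
  Tendsto (fun n => (Nat.card {v : V n // p n v} : ℝ) / (Nat.card (V n) : ℝ)) atTop (𝓝 1)

/-- A sofic approximation to `G`: maps `σ n` from `G` to the permutations of finite non-empty
sets `V n` which are asymptotically multiplicative and asymptotically free. -/
structure SoficApproximation (G : Type*) [Group G] where
  V : ℕ → Type
  fintypeV : ∀ n, Fintype (V n)
  nonemptyV : ∀ n, Nonempty (V n)
  σ : ∀ n, G → Equiv.Perm (V n)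
  asymp_mul : ∀ g h : G, WithHighProb V (fun n v => σ n g (σ n h v) = σ n (g * h) v)
  asymp_free : ∀ g : G, g ≠ 1 → WithHighProb V (fun n v => σ n g v ≠ v)

attribute [instance] SoficApproximation.fintypeV SoficApproximation.nonemptyV

/-- The sofic sub-approximation along a subsequence `n 0 < n 1 < ⋯`. -/
def SoficApproximation.sub {G : Type*} [Group G] (S : SoficApproximation G) (n : ℕ → ℕ)
    (hn : StrictMono n) : SoficApproximation G where
  V := fun i => S.V (n i)
  fintypeV := fun i => S.fintypeV (n i)
  nonemptyV := fun i => S.nonemptyV (n i)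
  σ := fun i => S.σ (n i)
  asymp_mul := fun g h => (S.asymp_mul g h).comp hn.tendsto_atTop
  asymp_free := fun g hg => (S.asymp_free g hg).comp hn.tendsto_atTop

section Models

variable {G : Type*} {V : Type*} {K : Type*}

/-- The pullback name of `x : V → K` at the vertex `v`. -/
def pullbackName (σ : G → Equiv.Perm V) (v : V) (x : V → K) : G → K :=
  fun g => x (σ g v)

theorem measurable_pullbackName [MeasurableSpace K] (σ : G → Equiv.Perm V) (v : V) :
    Measurable (pullbackName (K := K) σ v) :=
  measurable_pi_lambda _ fun g => measurable_pi_apply (σ g v)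

/-- The law of the pullback name at `v` of a random model with law `m`. -/
def localLaw [MeasurableSpace K] (σ : G → Equiv.Perm V) (m : ProbabilityMeasure (V → K))
    (v : V) : ProbabilityMeasure (G → K) :=
  m.map (measurable_pullbackName σ v).aemeasurable

/-- The empirical distribution of `x : V → K`: the average of the point masses at its
pullback names. -/
def empirical [Fintype V] [Nonempty V] [MeasurableSpace K] (σ : G → Equiv.Perm V)
    (x : V → K) : ProbabilityMeasure (G → K) :=
  ⟨(Fintype.card V : ℝ≥0∞)⁻¹ • ∑ v : V, Measure.dirac (pullbackName σ v x), ⟨by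
    simp [ENNReal.inv_mul_cancel]⟩⟩

/-- The models whose empirical distribution lies in `O`. -/
def goodModels [Fintype V] [Nonempty V] [MeasurableSpace K] (σ : G → Equiv.Perm V)
    (O : Set (ProbabilityMeasure (G → K))) : Set (V → K) :=
  {x | empirical σ x ∈ O}

/-- The Hamming average on `V → K` of the metric of `K`. -/
def hammingAvg [Fintype V] [MetricSpace K] (x y : V → K) : ℝ :=
  (Fintype.card V : ℝ)⁻¹ * ∑ v : V, dist (x v) (y v)

/-- The covering number `cov_{ε,δ}(m)`: the least cardinality of a set of models whose
`δ`-neighbourhood in the Hamming average metric has `m`-measure greater than `1 - ε`. -/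
def covNumber [Fintype V] [MetricSpace K] [MeasurableSpace K]
    (m : ProbabilityMeasure (V → K)) (ε δ : ℝ) : ℕ∞ :=
  ⨅ (F : Finset (V → K))
    (_ : 1 - ε < (m : Measure (V → K)).real {y | ∃ x ∈ F, hammingAvg y x < δ}), (F.card : ℕ∞)

/-- The normalized logarithm of a covering number. -/
def covRate [Fintype V] [MetricSpace K] [MeasurableSpace K]
    (m : ProbabilityMeasure (V → K)) (ε δ : ℝ) : EReal :=
  ENNReal.log ((covNumber m ε δ : ℕ∞) : ℝ≥0∞) / ((Fintype.card V : ℕ) : EReal)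

/-- The product of laws on `V → K` and `V → L`, as a law on `V → K × L`. -/
def prodLaw {L : Type*} [MeasurableSpace K] [MeasurableSpace L]
    (m : ProbabilityMeasure (V → K)) (m' : ProbabilityMeasure (V → L)) :
    ProbabilityMeasure (V → K × L) :=
  (m.prod m').map (f := fun p v => (p.1 v, p.2 v))
    (measurable_pi_lambda _ fun v =>
      ((measurable_pi_apply v).comp measurable_fst).prodMk
        ((measurable_pi_apply v).comp measurable_snd)).aemeasurable

end Models

namespace SoficApproximation

variable {G : Type*} [Group G] [Countable G]
  {K : Type*} [MetricSpace K] [CompactSpace K] [MeasurableSpace K] [BorelSpace K]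

/-- Local weak-* convergence over `S` of measures on models to the law `P` of a process. -/
def LocalWeakConv (S : SoficApproximation G) (m : ∀ n, ProbabilityMeasure (S.V n → K))
    (P : ProbabilityMeasure (G → K)) : Prop :=
  ∀ O ∈ 𝓝 P, WithHighProb S.V (fun n v => localLaw (S.σ n) (m n) v ∈ O)

/-- Quenched convergence over `S`. -/
def QuenchedConv (S : SoficApproximation G) (m : ∀ n, ProbabilityMeasure (S.V n → K))
    (P : ProbabilityMeasure (G → K)) : Prop :=
  S.LocalWeakConv m P ∧
    ∀ O ∈ 𝓝 P, Tendsto (fun n => (m n : Measure (S.V n → K)) (goodModels (S.σ n) O))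
      atTop (𝓝 1)

/-- Doubly-quenched convergence over `S`. -/
def DoublyQuenchedConv (S : SoficApproximation G) (m : ∀ n, ProbabilityMeasure (S.V n → K))
    (P : ProbabilityMeasure (G → K)) : Prop :=
  S.QuenchedConv (fun n => prodLaw (m n) (m n)) (prodLaw P P)

/-- Quenched model-measure sofic entropy of a metric process with law `P`. -/
def hq (S : SoficApproximation G) (P : ProbabilityMeasure (G → K)) : EReal :=
  ⨆ (n : ℕ → ℕ) (hn : StrictMono n)
    (m : ∀ i, ProbabilityMeasure ((S.sub n hn).V i → K)) (_ : (S.sub n hn).QuenchedConv m P)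
    (ε : ℝ) (_ : 0 < ε) (δ : ℝ) (_ : 0 < δ), limsup (fun i => covRate (m i) ε δ) atTop

/-- Doubly-quenched model-measure sofic entropy of a metric process with law `P`. -/
def hdq (S : SoficApproximation G) (P : ProbabilityMeasure (G → K)) : EReal :=
  ⨆ (n : ℕ → ℕ) (hn : StrictMono n)
    (m : ∀ i, ProbabilityMeasure ((S.sub n hn).V i → K))
    (_ : (S.sub n hn).DoublyQuenchedConv m P)
    (ε : ℝ) (_ : 0 < ε) (δ : ℝ) (_ : 0 < δ), limsup (fun i => covRate (m i) ε δ) atTop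

/-- Lower quenched model-measure sofic entropy: convergence over the whole of `S`, and a limit
infimum. -/
def lowerHq (S : SoficApproximation G) (P : ProbabilityMeasure (G → K)) : EReal :=
  ⨆ (m : ∀ n, ProbabilityMeasure (S.V n → K)) (_ : S.QuenchedConv m P)
    (ε : ℝ) (_ : 0 < ε) (δ : ℝ) (_ : 0 < δ), liminf (fun n => covRate (m n) ε δ) atTop

/-- Lower doubly-quenched model-measure sofic entropy. -/
def lowerHdq (S : SoficApproximation G) (P : ProbabilityMeasure (G → K)) : EReal :=
  ⨆ (m : ∀ n, ProbabilityMeasure (S.V n → K)) (_ : S.DoublyQuenchedConv m P)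
    (ε : ℝ) (_ : 0 < ε) (δ : ℝ) (_ : 0 < δ), liminf (fun n => covRate (m n) ε δ) atTop

end SoficApproximation

section Systems

variable (G : Type*) [Group G] {X Y : Type*} [MeasurableSpace X] [MeasurableSpace Y]
  [MulAction G X] [MulAction G Y]

/-- A process model with values in `K` of the `G`-system `(X, μ)`: a measurable observable
`φ : X → K` whose equivariant map `x ↦ (φ (g • x))_g` into `G → K` is injective on a conull
set, hence is an isomorphism (for standard Borel spaces) from the system to the process which
is given by the right shift and the image measure. -/
structure ProcessModel (μ : ProbabilityMeasure X) (K : Type*) [MeasurableSpace K] where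
  φ : X → K
  measurable_φ : Measurable φ
  injOn_conull : ∃ A : Set X, MeasurableSet A ∧ (μ : Measure X) Aᶜ = 0 ∧
    Set.InjOn (fun (x : X) (g : G) => φ (g • x)) A

variable {G}

/-- The law on `G → K` of the process model. -/
def ProcessModel.law [MeasurableConstSMul G X] {μ : ProbabilityMeasure X} {K : Type*}
    [MeasurableSpace K] (M : ProcessModel G μ K) : ProbabilityMeasure (G → K) :=
  μ.map (f := fun (x : X) (g : G) => M.φ (g • x))
    (measurable_pi_lambda _ fun g => M.measurable_φ.comp (measurable_const_smul g)).aemeasurable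

variable (G)

instance instMeasurableConstSMulProd [MeasurableConstSMul G X] [MeasurableConstSMul G Y] :
    MeasurableConstSMul G (X × Y) where
  measurable_const_smul g :=
    ((measurable_const_smul g).comp measurable_fst).prodMk
      ((measurable_const_smul g).comp measurable_snd)

/-- `l` is a joining of the `G`-systems `(X, μ)` and `(Y, ν)`. -/
structure IsJoining (μ : ProbabilityMeasure X) (ν : ProbabilityMeasure Y)
    (l : ProbabilityMeasure (X × Y)) : Prop where
  invariant : SMulInvariantMeasure G (X × Y) (l : Measure (X × Y))
  map_fst : (l : Measure (X × Y)).map Prod.fst = (μ : Measure X)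
  map_snd : (l : Measure (X × Y)).map Prod.snd = (ν : Measure Y)

/-- A `G`-system is ergodic. -/
def IsErgodic (μ : ProbabilityMeasure X) : Prop :=
  ErgodicSMul G X (μ : Measure X)

/-- A `G`-system is weakly mixing: its Cartesian square is ergodic. -/
def IsWeaklyMixing (μ : ProbabilityMeasure X) : Prop :=
  IsErgodic G (μ.prod μ)

end Systems

end

/-!
# Additivity of model-measure sofic entropy

A weak-* condition on a sequence of laws of models is tested against continuous functions of names:
quenched convergence of `m n` to `P` says that for every continuous `f` the integrals of `f` of the
pullback name at a random vertex converge in mean to `∫ f ∂P` (`LocalMean`), and so do the averages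
of `f` over all vertices for a random model (`EmpiricalMean`).

**Recoding.** Let `Q` and `R` be process models of the same system, with values in `J` and `K`.
Since names under `Q` determine points almost surely, every bounded measurable function on the
system is an `L¹`-limit of continuous functions of the `Q`-name. A diagonal argument over such
approximations gives measurable maps `ψ n` from models with letters in `J` to models with letters
in `K` (`exists_isCoding`), which take sequences of laws that converge to the law of `Q` to
sequences that converge to the law of `R`, both for quenched convergence and, passing to Cartesian
squares, for doubly-quenched convergence. Conversely the letters of the `Q`-process are approximated
by continuous functions of the `R`-name, so outside a set of small measure a model is determined by
its recoding up to a small Hamming error. Hence recoding does not decrease covering numbers, up to a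
change of the parameters (`IsCoding.exists_covNumber_le`).

**Subadditivity.** Laws of models which converge to a process model of a joining are recoded as laws
of models with letters in `K × L` for the joining of the two given process models. Their marginals
converge to the two given processes, and covering numbers are submultiplicative
(`covNumber_le_mul`).

**Superadditivity.** Given laws of models for both systems one takes their products. Covering
numbers of products are supermultiplicative up to a change of the parameters
(`mul_le_covNumber_prodLaw`). Products of doubly-quenched convergent sequences are doubly-quenched
convergent (`DoublyQuenchedConv.prodLaw`). The essential case is a product `f(x) g(y)` of functions
of names where `f` has mean zero: for a fixed model of the second system the second moment of its
average over the vertices is an average over pairs of vertices of covariances of `f`, with bounded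
weights, and by the Cauchy–Schwarz inequality it is controlled by the second moment of the averages
of `f(x) f(x')` for two independent models of the first system, which tends to zero.
Products of quenched convergent sequences only converge locally, but if the product system
is ergodic this implies quenched convergence (`QuenchedConv.of_ergodic`): up to an error that is
small in `L²`, a continuous function of names with mean zero is a combination of coboundaries, whose
averages over the vertices of any model are small. One of the two limits in the product has to be a
limit inferior along all of `S`, since the two sequences of laws must live over the same
subsequence.

The product of a weakly mixing system on `X` and an ergodic one on `Y` is ergodic
(`ergodicSMul_prod_of_weaklyMixing`): ergodicity of `X`, `Y` and `X × X` makes the measures of the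
sections of an invariant set `E` and of the intersections of two of them constant, so that for every
subset `A` of `X` the measure of the part in `A` of the section of `E` at `y` has variance zero as
a function of `y`. Therefore `E` is independent of all rectangles, and hence of itself.
-/

open scoped BigOperators

/-! ### Averages over finite sets and integrals of bounded functions -/

section Averages

variable {V : Type*} [Fintype V]

theorem expect_mono {f g : V → ℝ} (h : ∀ v, f v ≤ g v) : 𝔼 v, f v ≤ 𝔼 v, g v :=
  Finset.expect_le_expect fun v _ => h v

theorem expect_nonneg' {f : V → ℝ} (h : ∀ v, 0 ≤ f v) : 0 ≤ 𝔼 v, f v :=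
  Finset.expect_nonneg fun v _ => h v

theorem abs_expect_le (f : V → ℝ) : |𝔼 v, f v| ≤ 𝔼 v, |f v| :=
  Finset.abs_expect_le Finset.univ f

theorem expect_le_const [Nonempty V] {f : V → ℝ} {C : ℝ} (h : ∀ v, f v ≤ C) : 𝔼 v, f v ≤ C :=
  (expect_mono h).trans_eq (Fintype.expect_const C)

theorem abs_expect_le_const [Nonempty V] {f : V → ℝ} {C : ℝ} (h : ∀ v, |f v| ≤ C) :
    |𝔼 v, f v| ≤ C :=
  (abs_expect_le f).trans (expect_le_const h)

theorem expect_comp_perm (e : Equiv.Perm V) (f : V → ℝ) : 𝔼 v, f (e v) = 𝔼 v, f v :=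
  Fintype.expect_equiv e _ _ fun _ => rfl

theorem measurable_expect {X : Type*} [MeasurableSpace X] {f : V → X → ℝ}
    (h : ∀ v, Measurable (f v)) : Measurable fun x => 𝔼 v, f v x := by
  simp only [Fintype.expect_eq_sum_div_card]
  fun_prop

theorem integral_expect {X : Type*} [MeasurableSpace X] {μ : Measure X} {f : V → X → ℝ}
    (h : ∀ v, Integrable (f v) μ) : ∫ x, 𝔼 v, f v x ∂μ = 𝔼 v, ∫ x, f v x ∂μ := by
  simp only [Fintype.expect_eq_sum_div_card]
  rw [integral_div, integral_finsetSum _ fun v _ => h v]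

theorem integrable_of_abs_le {X : Type*} [MeasurableSpace X] {μ : Measure X}
    [IsFiniteMeasure μ] {f : X → ℝ} (hf : Measurable f) {C : ℝ} (h : ∀ x, |f x| ≤ C) :
    Integrable f μ :=
  Integrable.of_bound hf.aestronglyMeasurable C (ae_of_all _ h)

theorem integral_le_const {X : Type*} [MeasurableSpace X] {μ : Measure X}
    [IsProbabilityMeasure μ] {f : X → ℝ} (hf : Measurable f) {C : ℝ} (h : ∀ x, |f x| ≤ C) :
    ∫ x, f x ∂μ ≤ C := by
  refine (integral_mono (integrable_of_abs_le hf h) (integrable_const C)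
    fun x => (le_abs_self _).trans (h x)).trans_eq (by simp)

theorem abs_integral_le_const {X : Type*} [MeasurableSpace X] {μ : Measure X}
    [IsProbabilityMeasure μ] {f : X → ℝ} {C : ℝ} (h : ∀ x, |f x| ≤ C) :
    |∫ x, f x ∂μ| ≤ C := by
  have := norm_integral_le_of_norm_le_const (μ := μ) (f := f) (C := C) (ae_of_all _ h)
  simpa using this

theorem tendsto_zero_of_eventually_le {a : ℕ → ℝ} (h0 : ∀ n, 0 ≤ a n)
    (h : ∀ η > 0, ∀ᶠ n in atTop, a n ≤ η) : Tendsto a atTop (𝓝 0) := by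
  refine Metric.tendsto_nhds.2 fun η hη => ?_
  filter_upwards [h (η / 2) (half_pos hη)] with n hn
  rw [Real.dist_eq, sub_zero, abs_of_nonneg (h0 n)]
  linarith

theorem eventually_le_of_tendsto_zero {a : ℕ → ℝ} (h : Tendsto a atTop (𝓝 0)) {η : ℝ}
    (hη : 0 < η) : ∀ᶠ n in atTop, a n ≤ η :=
  (h.eventually_lt_const hη).mono fun _ => le_of_lt

theorem eventually_le_add_of_tendsto {a : ℕ → ℝ} {c : ℝ} (h : Tendsto a atTop (𝓝 c)) {η : ℝ}
    (hη : 0 < η) : ∀ᶠ n in atTop, a n ≤ c + η :=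
  (h.eventually_lt_const (lt_add_of_pos_right c hη)).mono fun _ => le_of_lt

end Averages

/-! ### Events of high probability -/

section HighProb

variable {V : ℕ → Type} [∀ n, Fintype (V n)] [∀ n, Nonempty (V n)]

open scoped Classical in
theorem withHighProb_iff {p : ∀ n, V n → Prop} :
    WithHighProb V p ↔ Tendsto (fun n => 𝔼 v, if p n v then (0 : ℝ) else 1) atTop (𝓝 0) := by
  have key : ∀ n, (Nat.card {v : V n // p n v} : ℝ) / (Nat.card (V n) : ℝ) =
      1 - 𝔼 v, if p n v then (0 : ℝ) else 1 := by
    intro n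
    have h1 : 1 - 𝔼 v, (if p n v then (0 : ℝ) else 1) =
        𝔼 v, ((1 : ℝ) - if p n v then 0 else 1) := by
      rw [Finset.expect_sub_distrib, Fintype.expect_const]
    rw [h1, Fintype.expect_eq_sum_div_card]
    have h2 : ∀ v, ((1 : ℝ) - if p n v then 0 else 1) = if p n v then 1 else 0 := by
      intro v; split_ifs <;> simp
    simp only [h2, Finset.sum_boole, Nat.card_eq_fintype_card, Fintype.card_subtype]
  unfold WithHighProb
  simp only [key]
  constructor
  · intro h
    have := (tendsto_const_nhds (x := (1 : ℝ))).sub h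
    simpa using this
  · intro h
    have := (tendsto_const_nhds (x := (1 : ℝ))).sub h
    simpa using this

theorem WithHighProb.mono {p q : ∀ n, V n → Prop} (h : WithHighProb V p)
    (hpq : ∀ n v, p n v → q n v) : WithHighProb V q := by
  classical
  rw [withHighProb_iff] at h ⊢
  refine squeeze_zero (fun n => expect_nonneg' fun v => by split_ifs <;> simp)
    (fun n => expect_mono fun v => ?_) h
  by_cases hp : p n v
  · simp [hp, hpq n v hp]
  · simp only [hp, if_false]; split_ifs <;> simp

theorem WithHighProb.and {p q : ∀ n, V n → Prop} (hp : WithHighProb V p)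
    (hq : WithHighProb V q) : WithHighProb V (fun n v => p n v ∧ q n v) := by
  classical
  rw [withHighProb_iff] at hp hq ⊢
  have := hp.add hq
  rw [add_zero] at this
  refine squeeze_zero (fun n => expect_nonneg' fun v => by split_ifs <;> simp) (fun n => ?_) this
  rw [← Finset.expect_add_distrib]
  refine expect_mono fun v => ?_
  by_cases h1 : p n v <;> by_cases h2 : q n v <;> simp [h1, h2]

theorem withHighProb_true {p : ∀ n, V n → Prop} (h : ∀ n v, p n v) : WithHighProb V p := by
  classical
  rw [withHighProb_iff]
  simp [h]

theorem withHighProb_forall_mem {ι : Type*} (s : Finset ι) {p : ι → ∀ n, V n → Prop}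
    (h : ∀ i ∈ s, WithHighProb V (p i)) : WithHighProb V (fun n v => ∀ i ∈ s, p i n v) := by
  classical
  induction s using Finset.induction_on with
  | empty => exact withHighProb_true (by simp)
  | insert i s hi ih =>
    refine ((h i (by simp)).and (ih fun j hj => h j (by simp [hj]))).mono ?_
    intro n v hv j hj
    rcases Finset.mem_insert.1 hj with rfl | hj
    · exact hv.1
    · exact hv.2 j hj

theorem withHighProb_lt_of_tendsto {a : ∀ n, V n → ℝ} (h0 : ∀ n v, 0 ≤ a n v)
    (h : Tendsto (fun n => 𝔼 v, a n v) atTop (𝓝 0)) {η : ℝ} (hη : 0 < η) :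
    WithHighProb V (fun n v => a n v < η) := by
  classical
  rw [withHighProb_iff]
  have := h.div_const η
  rw [zero_div] at this
  refine squeeze_zero (fun n => expect_nonneg' fun v => by split_ifs <;> simp) (fun n => ?_) this
  rw [Finset.expect_div]
  refine expect_mono fun v => ?_
  split_ifs with hv
  · exact div_nonneg (h0 n v) hη.le
  · exact (one_le_div hη).2 (not_lt.1 hv)

theorem tendsto_expect_of_withHighProb {a : ∀ n, V n → ℝ} {B : ℝ} (h0 : ∀ n v, 0 ≤ a n v)
    (hB : ∀ n v, a n v ≤ B) (h : ∀ η > 0, WithHighProb V (fun n v => a n v < η)) :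
    Tendsto (fun n => 𝔼 v, a n v) atTop (𝓝 0) := by
  classical
  refine tendsto_zero_of_eventually_le (fun n => expect_nonneg' (h0 n)) fun η hη => ?_
  have h1 := (withHighProb_iff.1 (h (η / 2) (half_pos hη))).const_mul B
  rw [mul_zero] at h1
  filter_upwards [eventually_le_of_tendsto_zero h1 (half_pos hη)] with n hn
  calc 𝔼 v, a n v ≤ 𝔼 v, (η / 2 + B * if a n v < η / 2 then (0 : ℝ) else 1) := by
        refine expect_mono fun v => ?_
        split_ifs with hv
        · linarith
        · linarith [hB n v]
    _ = η / 2 + B * 𝔼 v, (if a n v < η / 2 then (0 : ℝ) else 1) := by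
        rw [Finset.expect_add_distrib, Fintype.expect_const, Finset.mul_expect]
    _ ≤ η := by linarith

end HighProb

/-! ### Convergence of measures on model spaces, in terms of test functions -/

/-- The weak topology is the initial topology for the integrals of continuous functions. -/
theorem nhds_probabilityMeasure_eq {Ω : Type*} [TopologicalSpace Ω] [CompactSpace Ω]
    [MeasurableSpace Ω] [OpensMeasurableSpace Ω] (P : ProbabilityMeasure Ω) :
    𝓝 P = ⨅ f : C(Ω, ℝ), comap (fun Q : ProbabilityMeasure Ω => ∫ x, f x ∂(Q : Measure Ω))
      (𝓝 (∫ x, f x ∂(P : Measure Ω))) := by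
  refine le_antisymm (le_iInf fun f => ?_) ?_
  · exact (ProbabilityMeasure.tendsto_iff_forall_integral_tendsto.1 tendsto_id
      (BoundedContinuousFunction.mkOfCompact f)).le_comap
  · refine ProbabilityMeasure.tendsto_iff_forall_integral_tendsto.2 fun f => ?_
    exact (tendsto_comap (f := fun Q : ProbabilityMeasure Ω =>
      ∫ x, f.toContinuousMap x ∂(Q : Measure Ω))).mono_left (iInf_le _ f.toContinuousMap)

/-- Basic neighbourhoods for the weak topology. -/
theorem mem_nhds_probabilityMeasure {Ω : Type*} [TopologicalSpace Ω] [CompactSpace Ω]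
    [MeasurableSpace Ω] [OpensMeasurableSpace Ω] {P : ProbabilityMeasure Ω}
    {O : Set (ProbabilityMeasure Ω)} (hO : O ∈ 𝓝 P) :
    ∃ s : Finset C(Ω, ℝ), ∃ η > 0, ∀ Q : ProbabilityMeasure Ω,
      (∀ f ∈ s, |∫ x, f x ∂(Q : Measure Ω) - ∫ x, f x ∂(P : Measure Ω)| < η) → Q ∈ O := by
  classical
  rw [nhds_probabilityMeasure_eq] at hO
  have hb := Filter.HasBasis.iInf (ι := C(Ω, ℝ))
    (fun f => (Metric.nhds_basis_ball (x := ∫ x, f x ∂(P : Measure Ω))).comap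
      (fun Q : ProbabilityMeasure Ω => ∫ x, f x ∂(Q : Measure Ω)))
  obtain ⟨⟨I, r⟩, ⟨hI, hr⟩, hsub⟩ := hb.mem_iff.1 hO
  obtain ⟨η, hη, hle⟩ : ∃ η > 0, ∀ f : I, η ≤ r f := by
    have := hI.to_subtype
    have hne : Finite I := this
    rcases isEmpty_or_nonempty I with he | he
    · exact ⟨1, one_pos, fun f => (he.false f).elim⟩
    · obtain ⟨f, hf⟩ := Finite.exists_min (fun f : I => r f)
      exact ⟨r f, hr f, hf⟩
  refine ⟨hI.toFinset, η, hη, fun Q hQ => hsub ?_⟩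
  simp only [Set.mem_iInter, Set.mem_preimage, Metric.mem_ball, Real.dist_eq]
  intro f
  exact (hQ f (by simp)).trans_le (hle f)

theorem integral_localLaw {G V K : Type*} [MeasurableSpace K] (σ : G → Equiv.Perm V)
    (m : ProbabilityMeasure (V → K)) (v : V) {f : (G → K) → ℝ} (hf : Measurable f) :
    ∫ a, f a ∂(localLaw σ m v : Measure (G → K)) =
      ∫ x, f (pullbackName σ v x) ∂(m : Measure (V → K)) := by
  rw [localLaw, ProbabilityMeasure.toMeasure_map,
    integral_map (measurable_pullbackName σ v).aemeasurable hf.aestronglyMeasurable]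

theorem integral_empirical {G V K : Type*} [Fintype V] [Nonempty V] [MeasurableSpace K]
    (σ : G → Equiv.Perm V) (x : V → K) {f : (G → K) → ℝ} (hf : Measurable f) :
    ∫ a, f a ∂(empirical σ x : Measure (G → K)) = 𝔼 v, f (pullbackName σ v x) := by
  have h : (empirical σ x : Measure (G → K)) =
    (Fintype.card V : ℝ≥0∞)⁻¹ • ∑ v : V, Measure.dirac (pullbackName σ v x) := rfl
  rw [h, integral_smul_measure, integral_finsetSum_measure
    (fun v _ => integrable_dirac' hf.stronglyMeasurable (by simp))]
  simp only [integral_dirac' _ _ hf.stronglyMeasurable, Fintype.expect_eq_sum_div_card]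
  simp [div_eq_inv_mul]

theorem measurable_postcomp {V K L : Type*} [MeasurableSpace K] [MeasurableSpace L] {e : K → L}
    (he : Measurable e) :
    Measurable fun (x : V → K) (v : V) => e (x v) :=
  measurable_pi_lambda _ fun v => he.comp (measurable_pi_apply v)

theorem abs_apply_le_norm {Ω : Type*} [TopologicalSpace Ω] [CompactSpace Ω] (f : C(Ω, ℝ))
    (x : Ω) : |f x| ≤ ‖f‖ :=
  f.norm_coe_le_norm x

theorem measurable_comp_pullbackName {G V K : Type*} [Countable G]
    [MetricSpace K] [CompactSpace K] [MeasurableSpace K] [BorelSpace K] (σ : G → Equiv.Perm V)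
    (v : V)
    (f : C(G → K, ℝ)) : Measurable fun x : V → K => f (pullbackName σ v x) :=
  f.continuous.measurable.comp (measurable_pullbackName σ v)

theorem measurable_empiricalError {G V K : Type*} [Countable G] [Fintype V]
    [MetricSpace K] [CompactSpace K] [MeasurableSpace K] [BorelSpace K]
    (σ : G → Equiv.Perm V) (f : C(G → K, ℝ)) (c : ℝ) :
    Measurable fun x : V → K => |𝔼 v, f (pullbackName σ v x) - c| := by
  refine Measurable.comp (g := fun t : ℝ => |t|) (continuous_abs.measurable) ?_
  exact (measurable_expect fun v => measurable_comp_pullbackName _ v f).sub_const c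

theorem abs_empiricalError_le {G V K : Type*} [Fintype V] [Nonempty V] [MetricSpace K]
    [CompactSpace K] (σ : G → Equiv.Perm V) (f : C(G → K, ℝ)) (c : ℝ) (x : V → K) :
    |(|𝔼 v, f (pullbackName σ v x) - c|)| ≤ ‖f‖ + |c| := by
  rw [abs_abs]
  refine (abs_sub _ _).trans (add_le_add (abs_expect_le_const fun v => ?_) le_rfl)
  exact abs_apply_le_norm f _

namespace SoficApproximation

variable {G : Type*} [Group G] [Countable G]
  {K : Type*} [MetricSpace K] [CompactSpace K] [MeasurableSpace K] [BorelSpace K]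

/-- The test function `f` witnesses local weak convergence, on average over the vertices. -/
def LocalMean (S : SoficApproximation G) (m : ∀ n, ProbabilityMeasure (S.V n → K))
    (P : ProbabilityMeasure (G → K)) (f : C(G → K, ℝ)) : Prop :=
  Tendsto (fun n => 𝔼 v, |∫ x, f (pullbackName (S.σ n) v x) ∂(m n : Measure (S.V n → K)) -
    ∫ a, f a ∂(P : Measure (G → K))|) atTop (𝓝 0)

/-- The integral of the test function `f` against the empirical distribution of a random model
converges in mean to its integral against `P`. -/
def EmpiricalMean (S : SoficApproximation G) (m : ∀ n, ProbabilityMeasure (S.V n → K))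
    (P : ProbabilityMeasure (G → K)) (f : C(G → K, ℝ)) : Prop :=
  Tendsto (fun n => ∫ x, |𝔼 v, f (pullbackName (S.σ n) v x) - ∫ a, f a ∂(P : Measure (G → K))|
    ∂(m n : Measure (S.V n → K))) atTop (𝓝 0)

variable {S : SoficApproximation G} {m : ∀ n, ProbabilityMeasure (S.V n → K)}
  {P : ProbabilityMeasure (G → K)}

theorem localWeakConv_iff : S.LocalWeakConv m P ↔ ∀ f : C(G → K, ℝ), S.LocalMean m P f := by
  constructor
  · intro h f
    refine tendsto_expect_of_withHighProb (B := ‖f‖ + ‖f‖) (fun _ _ => abs_nonneg _) ?_ ?_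
    · intro n v
      exact (abs_sub _ _).trans (add_le_add
        (abs_integral_le_const fun x => abs_apply_le_norm f _)
        (abs_integral_le_const fun x => abs_apply_le_norm f _))
    · intro η hη
      have hO : {Q : ProbabilityMeasure (G → K) | |∫ a, f a ∂(Q : Measure (G → K)) -
          ∫ a, f a ∂(P : Measure (G → K))| < η} ∈ 𝓝 P := by
        rw [nhds_probabilityMeasure_eq]
        refine mem_iInf_of_mem f ⟨_, Metric.ball_mem_nhds _ hη, fun Q hQ => ?_⟩
        simpa [Real.dist_eq] using hQ
      refine (h _ hO).mono fun n v hv => ?_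
      simpa only [Set.mem_ofPred_eq, integral_localLaw _ _ _ f.continuous.measurable] using hv
  · intro h O hO
    obtain ⟨s, η, hη, hs⟩ := mem_nhds_probabilityMeasure hO
    have := withHighProb_forall_mem s fun f _ =>
      withHighProb_lt_of_tendsto (fun n v => abs_nonneg _) (h f) hη
    refine this.mono fun n v hv => hs _ fun f hf => ?_
    rw [integral_localLaw _ _ _ f.continuous.measurable]
    exact hv f hf

theorem quenchedConv_iff : S.QuenchedConv m P ↔
    (∀ f : C(G → K, ℝ), S.LocalMean m P f) ∧ ∀ f : C(G → K, ℝ), S.EmpiricalMean m P f := by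
  refine and_congr localWeakConv_iff ⟨fun h f => ?_, fun h O hO => ?_⟩
  · refine tendsto_zero_of_eventually_le (fun n => integral_nonneg fun x => abs_nonneg _) ?_
    intro η hη
    set c := ∫ a, f a ∂(P : Measure (G → K)) with hc
    have hO : {Q : ProbabilityMeasure (G → K) | |∫ a, f a ∂(Q : Measure (G → K)) - c| < η / 2}
        ∈ 𝓝 P := by
      rw [nhds_probabilityMeasure_eq]
      refine mem_iInf_of_mem f ⟨_, Metric.ball_mem_nhds _ (half_pos hη), fun Q hQ => ?_⟩
      simpa [Real.dist_eq] using hQ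
    have h1 := h _ hO
    have h2 : Tendsto (fun n => (m n : Measure (S.V n → K)).real
        {x | ¬ |𝔼 v, f (pullbackName (S.σ n) v x) - c| < η / 2}) atTop (𝓝 0) := by
      have h3 : ∀ n, (m n : Measure (S.V n → K)).real
          {x | ¬ |𝔼 v, f (pullbackName (S.σ n) v x) - c| < η / 2} =
          1 - ((m n : Measure (S.V n → K)) (goodModels (S.σ n)
            {Q : ProbabilityMeasure (G → K) |
              |∫ a, f a ∂(Q : Measure (G → K)) - c| < η / 2})).toReal := by
        intro n
        have hset : goodModels (S.σ n) {Q : ProbabilityMeasure (G → K) |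
              |∫ a, f a ∂(Q : Measure (G → K)) - c| < η / 2} =
            {x | |𝔼 v, f (pullbackName (S.σ n) v x) - c| < η / 2} := by
          ext x
          simp only [goodModels, Set.mem_ofPred_eq,
            integral_empirical _ _ f.continuous.measurable]
        rw [hset, ← measureReal_def, ← probReal_compl_eq_one_sub]
        · rfl
        · exact measurableSet_lt (measurable_empiricalError _ f c) measurable_const
      simp only [h3]
      have := ((ENNReal.tendsto_toReal ENNReal.one_ne_top).comp h1).const_sub 1
      simpa using this
    have h4 := h2.const_mul (‖f‖ + |c|)
    rw [mul_zero] at h4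
    filter_upwards [eventually_le_of_tendsto_zero h4 (half_pos hη)] with n hn
    set A := {x | ¬ |𝔼 v, f (pullbackName (S.σ n) v x) - c| < η / 2} with hA
    have hAm : MeasurableSet A :=
      (measurableSet_lt (measurable_empiricalError _ f c) measurable_const).compl
    calc ∫ x, |𝔼 v, f (pullbackName (S.σ n) v x) - c| ∂(m n : Measure (S.V n → K))
        ≤ ∫ x, (η / 2 + A.indicator (fun _ => ‖f‖ + |c|) x) ∂(m n : Measure (S.V n → K)) := by
          refine integral_mono (integrable_of_abs_le (measurable_empiricalError _ f c)
            (abs_empiricalError_le _ f c)) ((integrable_const _).add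
              ((integrable_const _).indicator hAm)) fun x => ?_
          by_cases hx : x ∈ A
          · simp only [Set.indicator_of_mem hx]
            have := abs_empiricalError_le (S.σ n) f c x
            rw [abs_abs] at this
            linarith
          · simp only [Set.indicator_of_notMem hx, add_zero]
            simp only [hA, Set.mem_ofPred_eq, not_not] at hx
            exact hx.le
      _ = η / 2 + (‖f‖ + |c|) * (m n : Measure (S.V n → K)).real A := by
          rw [integral_add (integrable_const _) ((integrable_const _).indicator hAm),
            integral_indicator_const _ hAm]
          simp [mul_comm]
      _ ≤ η := by linarith
  · obtain ⟨s, η, hη, hs⟩ := mem_nhds_probabilityMeasure hO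
    have hbad : Tendsto (fun n => ∑ f ∈ s, (m n : Measure (S.V n → K))
        {x | η ≤ |𝔼 v, f (pullbackName (S.σ n) v x) - ∫ a, f a ∂(P : Measure (G → K))|})
        atTop (𝓝 0) := by
      rw [← Finset.sum_const_zero (s := s)]
      refine tendsto_finsetSum _ fun f _ => ?_
      have h5 : Tendsto (fun n => (m n : Measure (S.V n → K)).real
        {x | η ≤ |𝔼 v, f (pullbackName (S.σ n) v x) - ∫ a, f a ∂(P : Measure (G → K))|})
        atTop (𝓝 0) := by
        have h6 := (h f).div_const η
        rw [zero_div] at h6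
        refine squeeze_zero (fun n => measureReal_nonneg) (fun n => ?_) h6
        rw [le_div_iff₀ hη, mul_comm]
        exact mul_meas_ge_le_integral_of_nonneg (ae_of_all _ fun x => abs_nonneg _)
          (integrable_of_abs_le (measurable_empiricalError _ f _)
            (abs_empiricalError_le _ f _)) η
      have h7 := ENNReal.tendsto_ofReal h5
      simpa [ofReal_measureReal] using h7
    have hlow : Tendsto (fun n => (1 : ℝ≥0∞) - ∑ f ∈ s, (m n : Measure (S.V n → K))
        {x | η ≤ |𝔼 v, f (pullbackName (S.σ n) v x) - ∫ a, f a ∂(P : Measure (G → K))|})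
        atTop (𝓝 1) := by
      have := ENNReal.Tendsto.sub (tendsto_const_nhds (x := (1 : ℝ≥0∞))) hbad (by simp)
      simpa using this
    refine tendsto_of_tendsto_of_tendsto_of_le_of_le hlow tendsto_const_nhds (fun n => ?_)
      fun n => prob_le_one
    refine tsub_le_iff_right.2 ?_
    rw [← measure_univ (μ := (m n : Measure (S.V n → K)))]
    calc (m n : Measure (S.V n → K)) Set.univ
        ≤ (m n : Measure (S.V n → K)) (goodModels (S.σ n) O ∪ ⋃ f ∈ s,
          {x | η ≤ |𝔼 v, f (pullbackName (S.σ n) v x) -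
            ∫ a, f a ∂(P : Measure (G → K))|}) := by
          refine measure_mono fun x _ => ?_
          by_cases hx : x ∈ goodModels (S.σ n) O
          · exact Or.inl hx
          · right
            by_contra hx'
            refine hx (hs _ fun f hf => ?_)
            rw [integral_empirical _ _ f.continuous.measurable]
            simp only [Set.mem_iUnion, Set.mem_ofPred_eq, not_exists, not_le] at hx'
            exact hx' f hf
      _ ≤ _ := (measure_union_le _ _).trans (add_le_add le_rfl (measure_biUnion_finset_le _ _))

theorem QuenchedConv.localMean (h : S.QuenchedConv m P) (f : C(G → K, ℝ)) :
    S.LocalMean m P f :=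
  (quenchedConv_iff.1 h).1 f

theorem QuenchedConv.empiricalMean (h : S.QuenchedConv m P) (f : C(G → K, ℝ)) :
    S.EmpiricalMean m P f :=
  (quenchedConv_iff.1 h).2 f

/-- Quenched convergence passes to subsequences. -/
theorem QuenchedConv.sub (h : S.QuenchedConv m P) {n : ℕ → ℕ} (hn : StrictMono n) :
    (S.sub n hn).QuenchedConv (fun i => m (n i)) P :=
  ⟨fun O hO => (h.1 O hO).comp hn.tendsto_atTop, fun O hO => (h.2 O hO).comp hn.tendsto_atTop⟩

/-- Quenched convergence is preserved by continuous maps between the state spaces. -/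
theorem QuenchedConv.map {L : Type*} [MetricSpace L] [CompactSpace L] [MeasurableSpace L]
    [BorelSpace L] (h : S.QuenchedConv m P) {e : K → L} (he : Continuous e) :
    S.QuenchedConv (fun n => (m n).map (f := fun x v => e (x v))
      (measurable_postcomp he.measurable).aemeasurable)
      (P.map (f := fun a g => e (a g)) (measurable_postcomp he.measurable).aemeasurable) := by
  have hcont : Continuous fun (a : G → K) (g : G) => e (a g) := by fun_prop
  have hP : ∀ f : C(G → L, ℝ), ∫ a, f a ∂((P.map (f := fun a g => e (a g))
      (measurable_postcomp he.measurable).aemeasurable : ProbabilityMeasure (G → L)) :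
        Measure (G → L)) = ∫ a, f.comp ⟨_, hcont⟩ a ∂(P : Measure (G → K)) := by
    intro f
    rw [ProbabilityMeasure.toMeasure_map, integral_map
      (measurable_postcomp he.measurable).aemeasurable
      f.continuous.measurable.aestronglyMeasurable]
    rfl
  rw [quenchedConv_iff]
  refine ⟨fun f => ?_, fun f => ?_⟩
  · have h1 := h.localMean (f.comp ⟨_, hcont⟩)
    unfold LocalMean at h1 ⊢
    rw [hP]
    refine h1.congr fun n => Finset.expect_congr rfl fun v _ => ?_
    rw [ProbabilityMeasure.toMeasure_map, integral_map
      (measurable_postcomp he.measurable).aemeasurable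
      (measurable_comp_pullbackName _ _ f).aestronglyMeasurable]
    rfl
  · have h1 := h.empiricalMean (f.comp ⟨_, hcont⟩)
    unfold EmpiricalMean at h1 ⊢
    rw [hP]
    refine h1.congr fun n => ?_
    rw [ProbabilityMeasure.toMeasure_map, integral_map
      (measurable_postcomp he.measurable).aemeasurable
      (measurable_empiricalError _ f _).aestronglyMeasurable]
    rfl

end SoficApproximation

/-! ### Products of quenched and doubly-quenched convergent sequences -/

theorem sq_integral_le {X : Type*} [MeasurableSpace X] {μ : Measure X} [IsProbabilityMeasure μ]
    {f : X → ℝ} (hf : Measurable f) {C : ℝ} (h : ∀ x, |f x| ≤ C) :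
    (∫ x, f x ∂μ) ^ 2 ≤ ∫ x, f x ^ 2 ∂μ := by
  set c := ∫ x, f x ∂μ with hc
  have hi : Integrable f μ := integrable_of_abs_le hf h
  have hi2 : Integrable (fun x => f x ^ 2) μ := by
    refine integrable_of_abs_le (hf.pow_const 2) (C := C ^ 2) fun x => ?_
    rw [abs_pow]
    exact pow_le_pow_left₀ (abs_nonneg _) (h x) 2
  have h0 : 0 ≤ ∫ x, (f x - c) ^ 2 ∂μ := integral_nonneg fun x => sq_nonneg _
  have h1 : ∫ x, (f x - c) ^ 2 ∂μ = ∫ x, f x ^ 2 ∂μ - c ^ 2 := by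
    have : ∀ x, (f x - c) ^ 2 = f x ^ 2 - 2 * c * f x + c ^ 2 := fun x => by ring
    simp only [this]
    have hi3 : Integrable (fun x => 2 * c * f x) μ := hi.const_mul _
    have hi4 : Integrable (fun x => f x ^ 2 - 2 * c * f x) μ := hi2.sub hi3
    rw [integral_add hi4 (integrable_const _), integral_sub hi2 hi3, integral_const_mul, ← hc]
    simp
    ring
  linarith

theorem sq_expect_le {V : Type*} [Fintype V] [Nonempty V] (f : V → ℝ) :
    (𝔼 v, f v) ^ 2 ≤ 𝔼 v, f v ^ 2 := by
  set c := 𝔼 v, f v with hc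
  have h0 : 0 ≤ 𝔼 v, (f v - c) ^ 2 := expect_nonneg' fun v => sq_nonneg _
  have h1 : 𝔼 v, (f v - c) ^ 2 = 𝔼 v, f v ^ 2 - c ^ 2 := by
    have : ∀ x, (f x - c) ^ 2 = f x ^ 2 - 2 * c * f x + c ^ 2 := fun x => by ring
    simp only [this]
    rw [Finset.expect_add_distrib, Finset.expect_sub_distrib, ← Finset.mul_expect,
      Fintype.expect_const, ← hc]
    ring
  linarith

/-- A bound for weighted averages of the functions `F v` which is uniform in the weights: both
sides are governed by the correlations `∫ F v * F w`. -/
theorem integral_abs_expect_mul_le {V X : Type*} [Fintype V] [Nonempty V] [MeasurableSpace X]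
    {μ : Measure X} [IsProbabilityMeasure μ] {F : V → X → ℝ} (hF : ∀ v, Measurable (F v))
    {B : ℝ} (hB : ∀ v x, |F v x| ≤ B) {a : V → ℝ} {A : ℝ} (hA : ∀ v, |a v| ≤ A) :
    (∫ x, |𝔼 v, F v x * a v| ∂μ) ^ 4 ≤
      A ^ 4 * ∫ p, (𝔼 v, F v p.1 * F v p.2) ^ 2 ∂(μ.prod μ) := by
  have hA0 : 0 ≤ A := (abs_nonneg _).trans (hA (Classical.arbitrary V))
  have hB0 : 0 ≤ B := by
    obtain ⟨x⟩ : Nonempty X := nonempty_of_isProbabilityMeasure μ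
    exact (abs_nonneg _).trans (hB (Classical.arbitrary V) x)
  have hFF : ∀ v w, Integrable (fun x => F v x * F w x) μ := fun v w =>
    integrable_of_abs_le ((hF v).mul (hF w)) (C := B * B) fun x => by
      rw [abs_mul]; exact mul_le_mul (hB v x) (hB w x) (abs_nonneg _) hB0
  set C : V → V → ℝ := fun v w => ∫ x, F v x * F w x ∂μ with hC
  have hmeas : Measurable fun x => 𝔼 v, F v x * a v :=
    measurable_expect fun v => (hF v).mul_const _
  have h1 : (∫ x, |𝔼 v, F v x * a v| ∂μ) ^ 2 ≤ ∫ x, (𝔼 v, F v x * a v) ^ 2 ∂μ := by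
    have := sq_integral_le (μ := μ) (f := fun x => |𝔼 v, F v x * a v|)
      (continuous_abs.measurable.comp hmeas) (C := B * A) (fun x => by
        rw [abs_abs]
        refine abs_expect_le_const fun v => ?_
        rw [abs_mul]; exact mul_le_mul (hB v x) (hA v) (abs_nonneg _) hB0)
    simpa only [sq_abs] using this
  have h2 : ∫ x, (𝔼 v, F v x * a v) ^ 2 ∂μ = 𝔼 v, 𝔼 w, C v w * (a v * a w) := by
    have : ∀ x, (𝔼 v, F v x * a v) ^ 2 = 𝔼 v, 𝔼 w, (F v x * F w x) * (a v * a w) := by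
      intro x
      rw [sq, Finset.expect_mul_expect]
      exact Finset.expect_congr rfl fun v _ => Finset.expect_congr rfl fun w _ => by ring
    simp only [this]
    rw [integral_expect fun v => ?_]
    · refine Finset.expect_congr rfl fun v _ => ?_
      rw [integral_expect fun w => (hFF v w).mul_const _]
      exact Finset.expect_congr rfl fun w _ => integral_mul_const _ _
    · simp only [Fintype.expect_eq_sum_div_card]
      exact (integrable_finsetSum _ fun w _ => (hFF v w).mul_const _).div_const _
  have h3 : 𝔼 v, 𝔼 w, C v w * (a v * a w) ≤ A ^ 2 * 𝔼 v, 𝔼 w, |C v w| := by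
    rw [Finset.mul_expect]
    refine expect_mono fun v => ?_
    rw [Finset.mul_expect]
    refine expect_mono fun w => (le_abs_self _).trans ?_
    rw [abs_mul, mul_comm, abs_mul, sq]
    exact mul_le_mul_of_nonneg_right (mul_le_mul (hA v) (hA w) (abs_nonneg _) hA0) (abs_nonneg _)
  have h4 : (𝔼 v, 𝔼 w, |C v w|) ^ 2 ≤ 𝔼 v, 𝔼 w, C v w ^ 2 := by
    refine (sq_expect_le _).trans (expect_mono fun v => (sq_expect_le _).trans_eq ?_)
    simp only [sq_abs]
  have h5 : ∫ p, (𝔼 v, F v p.1 * F v p.2) ^ 2 ∂(μ.prod μ) = 𝔼 v, 𝔼 w, C v w ^ 2 := by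
    have : ∀ p : X × X, (𝔼 v, F v p.1 * F v p.2) ^ 2 =
        𝔼 v, 𝔼 w, (F v p.1 * F w p.1) * (F v p.2 * F w p.2) := by
      intro x
      rw [sq, Finset.expect_mul_expect]
      exact Finset.expect_congr rfl fun v _ => Finset.expect_congr rfl fun w _ => by ring
    simp only [this]
    rw [integral_expect fun v => ?_]
    · refine Finset.expect_congr rfl fun v _ => ?_
      rw [integral_expect fun w => (hFF v w).mul_prod (hFF v w)]
      refine Finset.expect_congr rfl fun w _ => ?_
      rw [integral_prod_mul (fun x => F v x * F w x) (fun x => F v x * F w x), sq]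
    · simp only [Fintype.expect_eq_sum_div_card]
      exact (integrable_finsetSum _ fun w _ => (hFF v w).mul_prod (hFF v w)).div_const _
  have h6 : 0 ≤ 𝔼 v, 𝔼 w, |C v w| := expect_nonneg' fun v => expect_nonneg' fun w => abs_nonneg _
  calc (∫ x, |𝔼 v, F v x * a v| ∂μ) ^ 4 = ((∫ x, |𝔼 v, F v x * a v| ∂μ) ^ 2) ^ 2 := by ring
    _ ≤ (A ^ 2 * 𝔼 v, 𝔼 w, |C v w|) ^ 2 :=
        pow_le_pow_left₀ (sq_nonneg _) (h1.trans (h2.trans_le h3)) 2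
    _ = A ^ 4 * (𝔼 v, 𝔼 w, |C v w|) ^ 2 := by ring
    _ ≤ A ^ 4 * 𝔼 v, 𝔼 w, C v w ^ 2 := mul_le_mul_of_nonneg_left h4 (by positivity)
    _ = _ := by rw [h5]

theorem measurable_zipModels {V K L : Type*} [MeasurableSpace K] [MeasurableSpace L] :
    Measurable fun (p : (V → K) × (V → L)) (v : V) => (p.1 v, p.2 v) :=
  measurable_pi_lambda _ fun v =>
    ((measurable_pi_apply v).comp measurable_fst).prodMk
      ((measurable_pi_apply v).comp measurable_snd)

theorem toMeasure_prodLaw {V K L : Type*} [MeasurableSpace K] [MeasurableSpace L]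
    (m : ProbabilityMeasure (V → K)) (m' : ProbabilityMeasure (V → L)) :
    (prodLaw m m' : Measure (V → K × L)) =
      ((m : Measure (V → K)).prod (m' : Measure (V → L))).map
        (fun p v => (p.1 v, p.2 v)) := by
  rw [prodLaw, ProbabilityMeasure.toMeasure_map, ProbabilityMeasure.toMeasure_prod]

theorem integral_prodLaw {V K L : Type*} [MeasurableSpace K] [MeasurableSpace L]
    (m : ProbabilityMeasure (V → K)) (m' : ProbabilityMeasure (V → L)) {f : (V → K × L) → ℝ}
    (hf : Measurable f) :
    ∫ x, f x ∂(prodLaw m m' : Measure (V → K × L)) =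
      ∫ p, f (fun v => (p.1 v, p.2 v)) ∂((m : Measure (V → K)).prod (m' : Measure (V → L))) := by
  rw [toMeasure_prodLaw, integral_map measurable_zipModels.aemeasurable
    hf.aestronglyMeasurable]

theorem lintegral_prodLaw {V K L : Type*} [MeasurableSpace K] [MeasurableSpace L]
    (m : ProbabilityMeasure (V → K)) (m' : ProbabilityMeasure (V → L))
    {F : (V → K × L) → ℝ≥0∞} (hF : Measurable F) :
    ∫⁻ x, F x ∂(prodLaw m m' : Measure (V → K × L)) =
      ∫⁻ a, ∫⁻ b, F (fun v => (a v, b v)) ∂(m' : Measure (V → L)) ∂(m : Measure (V → K)) := by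
  rw [toMeasure_prodLaw, lintegral_map hF measurable_zipModels]
  exact lintegral_prod _ (hF.comp measurable_zipModels).aemeasurable

theorem abs_integral_sub_integral_le {X : Type*} [MeasurableSpace X] {μ : Measure X}
    [IsProbabilityMeasure μ] {f g : X → ℝ} (hf : Integrable f μ) (hg : Integrable g μ) {C : ℝ}
    (h : ∀ x, |f x - g x| ≤ C) : |∫ x, f x ∂μ - ∫ x, g x ∂μ| ≤ C := by
  rw [← integral_sub hf hg]
  exact abs_integral_le_const h

theorem abs_apply_sub_le_norm {Ω : Type*} [TopologicalSpace Ω] [CompactSpace Ω] (f g : C(Ω, ℝ))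
    (x : Ω) : |f x - g x| ≤ ‖f - g‖ :=
  (f - g).norm_coe_le_norm x

section Tensor

variable {G : Type*} {K L : Type*} [MetricSpace K] [CompactSpace K] [MetricSpace L]
  [CompactSpace L]

/-- The function `(a, b) ↦ f a * g b`, for names `a` in `K` and `b` in `L`. -/
def tensor (f : C(G → K, ℝ)) (g : C(G → L, ℝ)) : C(G → K × L, ℝ) where
  toFun a := f (fun i => (a i).1) * g (fun i => (a i).2)
  continuous_toFun := by fun_prop

omit [CompactSpace K] [CompactSpace L] in
theorem tensor_apply (f : C(G → K, ℝ)) (g : C(G → L, ℝ)) (a : G → K × L) :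
    tensor f g a = f (fun i => (a i).1) * g (fun i => (a i).2) := rfl

/-- Tensor functions form a multiplicative monoid. -/
def tensorSubmonoid : Submonoid C(G → K × L, ℝ) where
  carrier := {h | ∃ f g, h = tensor f g}
  one_mem' := ⟨1, 1, by ext a; simp [tensor_apply]⟩
  mul_mem' := by
    rintro _ _ ⟨f, g, rfl⟩ ⟨f', g', rfl⟩
    refine ⟨f * f', g * g', ?_⟩
    ext a
    simp only [tensor_apply, ContinuousMap.mul_apply]
    ring

/-- A property of continuous functions which is closed under sums and uniform limits holds for
all functions if it holds for tensor functions. -/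
theorem tensor_induction {p : C(G → K × L, ℝ) → Prop} (h_tensor : ∀ f g, p (tensor f g))
    (h_add : ∀ f g, p f → p g → p (f + g))
    (h_lim : ∀ f, (∀ η > 0, ∃ g, p g ∧ ‖f - g‖ ≤ η) → p f) (f : C(G → K × L, ℝ)) : p f := by
  set A : Subalgebra ℝ C(G → K × L, ℝ) := Algebra.adjoin ℝ 
    ((tensorSubmonoid : Submonoid C(G → K × L, ℝ)) : Set C(G → K × L, ℝ)) with hA
  have hsep : A.SeparatesPoints := by
    intro a b hab
    obtain ⟨i, hi⟩ := Function.ne_iff.1 hab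
    have hi' : (a i).1 ≠ (b i).1 ∨ (a i).2 ≠ (b i).2 := by
      by_contra! h
      exact hi (Prod.ext h.1 h.2)
    rcases hi' with h | h
    · refine ⟨_, ⟨tensor ⟨fun x => dist (x i) (a i).1, by fun_prop⟩ 1,
        Algebra.subset_adjoin ⟨_, _, rfl⟩, rfl⟩, ?_⟩
      simpa [tensor_apply, eq_comm] using h
    · refine ⟨_, ⟨tensor 1 ⟨fun x => dist (x i) (a i).2, by fun_prop⟩,
        Algebra.subset_adjoin ⟨_, _, rfl⟩, rfl⟩, ?_⟩
      simpa [tensor_apply, eq_comm] using h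
  have hdense := ContinuousMap.subalgebra_topologicalClosure_eq_top_of_separatesPoints A hsep
  have hmem : ∀ g ∈ A, p g := by
    intro g hg
    rw [hA, ← Subalgebra.mem_toSubmodule, Algebra.adjoin_eq_span, Submonoid.closure_eq] at hg
    suffices h : ∀ c : ℝ, p (c • g) by simpa using h 1
    induction hg using Submodule.span_induction with
    | mem x hx =>
      obtain ⟨f, g, rfl⟩ := hx
      intro c
      have : c • tensor f g = tensor (c • f) g := by
        ext a; simp [tensor_apply, mul_assoc]
      rw [this]
      exact h_tensor _ _
    | zero =>
      intro c
      have : c • (0 : C(G → K × L, ℝ)) = tensor 0 0 := by ext a; simp [tensor_apply]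
      rw [this]; exact h_tensor 0 0
    | add x y _ _ hx hy => intro c; rw [smul_add]; exact h_add _ _ (hx c) (hy c)
    | smul a x _ hx => intro c; rw [smul_smul]; exact hx _
  refine h_lim f fun η hη => ?_
  have hf : f ∈ closure (A : Set C(G → K × L, ℝ)) := by
    rw [← Subalgebra.topologicalClosure_coe, hdense]; trivial
  obtain ⟨g, hg, hfg⟩ := Metric.mem_closure_iff.1 hf η hη
  exact ⟨g, hmem g hg, by rw [← dist_eq_norm]; exact hfg.le⟩

end Tensor

namespace SoficApproximation

variable {G : Type*} [Group G] [Countable G]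
  {K : Type*} [MetricSpace K] [CompactSpace K] [MeasurableSpace K] [BorelSpace K]
  {L : Type*} [MetricSpace L] [CompactSpace L] [MeasurableSpace L] [BorelSpace L]
  {S : SoficApproximation G} {m : ∀ n, ProbabilityMeasure (S.V n → K)}
  {P : ProbabilityMeasure (G → K)} {m' : ∀ n, ProbabilityMeasure (S.V n → L)}
  {P' : ProbabilityMeasure (G → L)}

theorem integrable_comp_pullbackName (n : ℕ) (v : S.V n) (f : C(G → K, ℝ)) :
    Integrable (fun x => f (pullbackName (S.σ n) v x)) (m n : Measure (S.V n → K)) :=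
  integrable_of_abs_le (measurable_comp_pullbackName _ v f) fun _ => abs_apply_le_norm f _

omit [Group G] in
theorem integrable_continuousMap (f : C(G → K, ℝ)) : Integrable f (P : Measure (G → K)) :=
  integrable_of_abs_le f.continuous.measurable (abs_apply_le_norm f)

theorem integrable_empiricalError (n : ℕ) (f : C(G → K, ℝ)) (c : ℝ) :
    Integrable (fun x => |𝔼 v, f (pullbackName (S.σ n) v x) - c|)
      (m n : Measure (S.V n → K)) :=
  integrable_of_abs_le (measurable_empiricalError _ f c) (abs_empiricalError_le _ f c)

theorem LocalMean.add {f g : C(G → K, ℝ)} (hf : S.LocalMean m P f) (hg : S.LocalMean m P g) :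
    S.LocalMean m P (f + g) := by
  have := Tendsto.add hf hg
  rw [add_zero] at this
  refine squeeze_zero (fun n => expect_nonneg' fun v => abs_nonneg _) (fun n => ?_) this
  rw [← Finset.expect_add_distrib]
  refine expect_mono fun v => ?_
  simp only [ContinuousMap.add_apply]
  rw [integral_add (integrable_comp_pullbackName n v f) (integrable_comp_pullbackName n v g),
    integral_add (integrable_continuousMap f) (integrable_continuousMap g), add_sub_add_comm]
  exact abs_add_le _ _

theorem EmpiricalMean.add {f g : C(G → K, ℝ)} (hf : S.EmpiricalMean m P f)
    (hg : S.EmpiricalMean m P g) : S.EmpiricalMean m P (f + g) := by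
  have := Tendsto.add hf hg
  rw [add_zero] at this
  refine squeeze_zero (fun n => integral_nonneg fun x => abs_nonneg _) (fun n => ?_) this
  rw [← integral_add (integrable_empiricalError n f _) (integrable_empiricalError n g _)]
  refine integral_mono (integrable_empiricalError n _ _)
    ((integrable_empiricalError n f _).add (integrable_empiricalError n g _)) fun x => ?_
  simp only [ContinuousMap.add_apply]
  rw [integral_add (integrable_continuousMap f) (integrable_continuousMap g),
    Finset.expect_add_distrib, add_sub_add_comm]
  exact abs_add_le _ _

theorem LocalMean.of_approx {f : C(G → K, ℝ)}
    (h : ∀ η > 0, ∃ g, S.LocalMean m P g ∧ ‖f - g‖ ≤ η) : S.LocalMean m P f := by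
  refine tendsto_zero_of_eventually_le (fun n => expect_nonneg' fun v => abs_nonneg _) ?_
  intro η hη
  obtain ⟨g, hg, hfg⟩ := h (η / 3) (by positivity)
  filter_upwards [eventually_le_of_tendsto_zero hg (show 0 < η / 3 by positivity)] with n hn
  calc _ ≤ 𝔼 v, (|∫ x, g (pullbackName (S.σ n) v x) ∂(m n : Measure (S.V n → K)) -
          ∫ a, g a ∂(P : Measure (G → K))| + (η / 3 + η / 3)) := by
        refine expect_mono fun v => ?_
        have h1 := abs_integral_sub_integral_le (integrable_comp_pullbackName (m := m) n v f)
          (integrable_comp_pullbackName n v g)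
          fun x => (abs_apply_sub_le_norm f g _).trans hfg
        have h2 := abs_integral_sub_integral_le (integrable_continuousMap (P := P) f)
          (integrable_continuousMap g) fun x => (abs_apply_sub_le_norm f g _).trans hfg
        rw [abs_le] at h1 h2
        have h3 := neg_abs_le (∫ x, g (pullbackName (S.σ n) v x) ∂(m n : Measure (S.V n → K)) -
          ∫ a, g a ∂(P : Measure (G → K)))
        have h4 := le_abs_self (∫ x, g (pullbackName (S.σ n) v x) ∂(m n : Measure (S.V n → K)) -
          ∫ a, g a ∂(P : Measure (G → K)))
        rw [abs_le]
        constructor <;> linarith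
    _ ≤ η := by
        rw [Finset.expect_add_distrib, Fintype.expect_const]
        linarith

theorem EmpiricalMean.of_approx {f : C(G → K, ℝ)}
    (h : ∀ η > 0, ∃ g, S.EmpiricalMean m P g ∧ ‖f - g‖ ≤ η) : S.EmpiricalMean m P f := by
  refine tendsto_zero_of_eventually_le (fun n => integral_nonneg fun v => abs_nonneg _) ?_
  intro η hη
  obtain ⟨g, hg, hfg⟩ := h (η / 3) (by positivity)
  filter_upwards [eventually_le_of_tendsto_zero hg (show 0 < η / 3 by positivity)] with n hn
  calc _ ≤ ∫ x, (|𝔼 v, g (pullbackName (S.σ n) v x) - ∫ a, g a ∂(P : Measure (G → K))| +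
          (η / 3 + η / 3)) ∂(m n : Measure (S.V n → K)) := by
        refine integral_mono (integrable_empiricalError n _ _)
          ((integrable_empiricalError n g _).add (integrable_const _)) fun x => ?_
        have h1 : |𝔼 v, f (pullbackName (S.σ n) v x) - 𝔼 v, g (pullbackName (S.σ n) v x)| ≤
            η / 3 := by
          rw [← Finset.expect_sub_distrib]
          exact abs_expect_le_const fun v => (abs_apply_sub_le_norm f g _).trans hfg
        have h2 := abs_integral_sub_integral_le (integrable_continuousMap (P := P) f)
          (integrable_continuousMap g) fun x => (abs_apply_sub_le_norm f g _).trans hfg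
        rw [abs_le] at h1 h2
        have h3 := neg_abs_le (𝔼 v, g (pullbackName (S.σ n) v x) -
          ∫ a, g a ∂(P : Measure (G → K)))
        have h4 := le_abs_self (𝔼 v, g (pullbackName (S.σ n) v x) -
          ∫ a, g a ∂(P : Measure (G → K)))
        simp only
        rw [abs_le]
        constructor <;> linarith
    _ ≤ η := by
        rw [integral_add (integrable_empiricalError n g _) (integrable_const _)]
        simp only [integral_const, probReal_univ, one_smul]
        linarith

omit [Group G] in
theorem integral_tensor_prodLaw (f : C(G → K, ℝ)) (g : C(G → L, ℝ)) :
    ∫ a, tensor f g a ∂(prodLaw P P' : Measure (G → K × L)) =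
      (∫ a, f a ∂(P : Measure (G → K))) * ∫ b, g b ∂(P' : Measure (G → L)) := by
  rw [integral_prodLaw _ _ (tensor f g).continuous.measurable, ← integral_prod_mul]
  rfl

theorem integral_tensor_pullbackName_prodLaw (n : ℕ) (v : S.V n) (f : C(G → K, ℝ))
    (g : C(G → L, ℝ)) :
    ∫ x, tensor f g (pullbackName (S.σ n) v x)
        ∂(prodLaw (m n) (m' n) : Measure (S.V n → K × L)) =
      (∫ x, f (pullbackName (S.σ n) v x) ∂(m n : Measure (S.V n → K))) *
        ∫ y, g (pullbackName (S.σ n) v y) ∂(m' n : Measure (S.V n → L)) := by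
  rw [integral_prodLaw _ _ (measurable_comp_pullbackName _ v _), ← integral_prod_mul]
  rfl

theorem localMean_prodLaw (h : ∀ f, S.LocalMean m P f) (h' : ∀ f, S.LocalMean m' P' f)
    (f : C(G → K × L, ℝ)) :
    S.LocalMean (fun n => prodLaw (m n) (m' n)) (prodLaw P P') f := by
  induction f using tensor_induction with
  | h_add f g hf hg => exact hf.add hg
  | h_lim f hf => exact LocalMean.of_approx hf
  | h_tensor f g =>
    unfold LocalMean
    simp only [integral_tensor_prodLaw, integral_tensor_pullbackName_prodLaw]
    have := ((h f).const_mul ‖g‖).add ((h' g).const_mul ‖f‖)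
    simp only [mul_zero, add_zero] at this
    refine squeeze_zero (fun n => expect_nonneg' fun v => abs_nonneg _) (fun n => ?_) this
    rw [Finset.mul_expect, Finset.mul_expect, ← Finset.expect_add_distrib]
    refine expect_mono fun v => ?_
    set a := ∫ x, f (pullbackName (S.σ n) v x) ∂(m n : Measure (S.V n → K))
    set b := ∫ x, g (pullbackName (S.σ n) v x) ∂(m' n : Measure (S.V n → L))
    set c := ∫ x, f x ∂(P : Measure (G → K)) with hc
    set d := ∫ x, g x ∂(P' : Measure (G → L))
    have hb : |b| ≤ ‖g‖ := abs_integral_le_const fun x => abs_apply_le_norm g _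
    have hc : |c| ≤ ‖f‖ := abs_integral_le_const fun x => abs_apply_le_norm f _
    have : a * b - c * d = b * (a - c) + c * (b - d) := by ring
    rw [this]
    refine (abs_add_le _ _).trans ?_
    rw [abs_mul, abs_mul]
    gcongr

/-- Convergence of averages of products `f(x) g(y)` of a function with mean zero and an arbitrary
function, when `x` has a law which converges in the doubly-quenched sense. -/
theorem tendsto_integral_expect_tensor_of_doublyQuenchedConv (h : S.DoublyQuenchedConv m P)
    (f : C(G → K, ℝ)) (hf : ∫ a, f a ∂(P : Measure (G → K)) = 0) (g : C(G → L, ℝ)) :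
    Tendsto (fun n => ∫ p, |𝔼 v, f (pullbackName (S.σ n) v p.1) *
      g (pullbackName (S.σ n) v p.2)| ∂((m n : Measure (S.V n → K)).prod
        (m' n : Measure (S.V n → L)))) atTop (𝓝 0) := by
  -- the second moment of the averages of `f ⊗ f`
  set D : ℕ → ℝ := fun n => ∫ p, (𝔼 v, f (pullbackName (S.σ n) v p.1) *
    f (pullbackName (S.σ n) v p.2)) ^ 2 ∂((m n : Measure (S.V n → K)).prod
      (m n : Measure (S.V n → K))) with hD
  have hmeas : ∀ n, Measurable fun p : (S.V n → K) × (S.V n → K) =>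
      𝔼 v, f (pullbackName (S.σ n) v p.1) * f (pullbackName (S.σ n) v p.2) := fun n =>
    measurable_expect fun v => ((measurable_comp_pullbackName _ v f).comp measurable_fst).mul
      ((measurable_comp_pullbackName _ v f).comp measurable_snd)
  have hbd : ∀ n (p : (S.V n → K) × (S.V n → K)),
      |𝔼 v, f (pullbackName (S.σ n) v p.1) * f (pullbackName (S.σ n) v p.2)| ≤ ‖f‖ * ‖f‖ := by
    intro n p
    refine abs_expect_le_const fun v => ?_
    rw [abs_mul]
    exact mul_le_mul (abs_apply_le_norm f _) (abs_apply_le_norm f _) (abs_nonneg _)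
      (norm_nonneg _)
  have hD0 : Tendsto D atTop (𝓝 0) := by
    have h1 := (QuenchedConv.empiricalMean h (tensor f f)).const_mul (‖f‖ * ‖f‖)
    rw [mul_zero] at h1
    refine squeeze_zero (fun n => integral_nonneg fun p => sq_nonneg _) (fun n => ?_) h1
    rw [integral_prodLaw _ _ (measurable_empiricalError _ _ _), integral_tensor_prodLaw, hf,
      zero_mul, ← integral_const_mul]
    simp only [sub_zero]
    change _ ≤ ∫ p, ‖f‖ * ‖f‖ * |𝔼 v, f (pullbackName (S.σ n) v p.1) *
      f (pullbackName (S.σ n) v p.2)| ∂((m n : Measure (S.V n → K)).prod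
      (m n : Measure (S.V n → K)))
    have hi1 : Integrable (fun p : (S.V n → K) × (S.V n → K) =>
        (𝔼 v, f (pullbackName (S.σ n) v p.1) * f (pullbackName (S.σ n) v p.2)) ^ 2)
        ((m n : Measure (S.V n → K)).prod (m n : Measure (S.V n → K))) :=
      integrable_of_abs_le ((hmeas n).pow_const 2) (C := (‖f‖ * ‖f‖) ^ 2) fun p => by
        rw [abs_pow]; exact pow_le_pow_left₀ (abs_nonneg _) (hbd n p) 2
    have hi2 : Integrable (fun p : (S.V n → K) × (S.V n → K) => ‖f‖ * ‖f‖ *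
        |𝔼 v, f (pullbackName (S.σ n) v p.1) * f (pullbackName (S.σ n) v p.2)|)
        ((m n : Measure (S.V n → K)).prod (m n : Measure (S.V n → K))) :=
      (integrable_of_abs_le (continuous_abs.measurable.comp (hmeas n)) (C := ‖f‖ * ‖f‖)
        fun p => by simp only [Function.comp, abs_abs]; exact hbd n p).const_mul _
    refine integral_mono hi1 hi2 fun p => ?_
    simp only
    rw [← sq_abs, sq]
    exact mul_le_mul_of_nonneg_right (hbd n p) (abs_nonneg _)
  have hlim : Tendsto (fun n => √(√(‖g‖ ^ 4 * D n))) atTop (𝓝 0) := by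
    have h1 := (hD0.const_mul (‖g‖ ^ 4)).sqrt.sqrt
    simpa using h1
  refine squeeze_zero (fun n => integral_nonneg fun p => abs_nonneg _) (fun n => ?_) hlim
  have hm2 : Measurable fun p : (S.V n → K) × (S.V n → L) =>
      |𝔼 v, f (pullbackName (S.σ n) v p.1) * g (pullbackName (S.σ n) v p.2)| :=
    continuous_abs.measurable.comp <|
    measurable_expect fun v => ((measurable_comp_pullbackName _ v f).comp measurable_fst).mul
      ((measurable_comp_pullbackName _ v g).comp measurable_snd)
  have hi2 : ∀ p : (S.V n → K) × (S.V n → L),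
      |(|𝔼 v, f (pullbackName (S.σ n) v p.1) * g (pullbackName (S.σ n) v p.2)|)| ≤
        ‖f‖ * ‖g‖ := by
    intro p
    rw [abs_abs]
    refine abs_expect_le_const fun v => ?_
    rw [abs_mul]
    exact mul_le_mul (abs_apply_le_norm f _) (abs_apply_le_norm g _) (abs_nonneg _)
      (norm_nonneg _)
  rw [integral_prod_symm _ (integrable_of_abs_le hm2 hi2)]
  refine (le_abs_self _).trans (abs_integral_le_const fun y => ?_)
  rw [abs_of_nonneg (integral_nonneg fun x => abs_nonneg _)]
  refine Real.le_sqrt_of_sq_le (Real.le_sqrt_of_sq_le ?_)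
  have hfin := integral_abs_expect_mul_le (μ := (m n : Measure (S.V n → K)))
    (F := fun v x => f (pullbackName (S.σ n) v x)) (a := fun v => g (pullbackName (S.σ n) v y))
    (fun v => measurable_comp_pullbackName _ v f)
    (fun v x => abs_apply_le_norm f _) (fun v => abs_apply_le_norm g _)
  rw [← pow_mul]
  exact hfin

/-- The product of a doubly-quenched convergent sequence with a quenched convergent one is
quenched convergent. -/
theorem DoublyQuenchedConv.prodLaw_quenchedConv (h : S.DoublyQuenchedConv m P)
    (h1 : S.QuenchedConv m P) (h' : S.QuenchedConv m' P') :
    S.QuenchedConv (fun n => prodLaw (m n) (m' n)) (prodLaw P P') := by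
  refine quenchedConv_iff.2 ⟨localMean_prodLaw h1.localMean h'.localMean, fun f => ?_⟩
  induction f using tensor_induction with
  | h_add f g hf hg => exact hf.add hg
  | h_lim f hf => exact EmpiricalMean.of_approx hf
  | h_tensor f g =>
    unfold EmpiricalMean
    rw [integral_tensor_prodLaw]
    set c := ∫ x, f x ∂(P : Measure (G → K)) with hc
    set d := ∫ x, g x ∂(P' : Measure (G → L)) with hd
    set f0 : C(G → K, ℝ) := f - ContinuousMap.const _ c with hf0
    have hf0' : ∫ x, f0 x ∂(P : Measure (G → K)) = 0 := by
      simp only [hf0, ContinuousMap.sub_apply, ContinuousMap.const_apply]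
      rw [integral_sub (integrable_continuousMap f) (integrable_const _), ← hc]
      simp
    have h2 := tendsto_integral_expect_tensor_of_doublyQuenchedConv (m' := m') h f0 hf0' g
    have h3 := h2.add ((h'.empiricalMean g).const_mul |c|)
    simp only [mul_zero, add_zero] at h3
    refine squeeze_zero (fun n => integral_nonneg fun v => abs_nonneg _) (fun n => ?_) h3
    rw [integral_prodLaw _ _ (measurable_empiricalError _ _ _)]
    have h4 : ∫ y, |𝔼 v, g (pullbackName (S.σ n) v y) - d| ∂(m' n : Measure (S.V n → L)) =
        ∫ p, |𝔼 v, g (pullbackName (S.σ n) v p.2) - d| ∂((m n : Measure (S.V n → K)).prod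
          (m' n : Measure (S.V n → L))) := by
      rw [integral_fun_snd (μ := (m n : Measure (S.V n → K)))
        (ν := (m' n : Measure (S.V n → L)))
        (fun y => |𝔼 v, g (pullbackName (S.σ n) v y) - d|)]
      simp
    have hm1 : Measurable fun p : (S.V n → K) × (S.V n → L) =>
      |𝔼 v, f0 (pullbackName (S.σ n) v p.1) * g (pullbackName (S.σ n) v p.2)| :=
      continuous_abs.measurable.comp <|
      measurable_expect fun v => ((measurable_comp_pullbackName _ v f0).comp measurable_fst).mul
        ((measurable_comp_pullbackName _ v g).comp measurable_snd)
    have hi1 : Integrable (fun p : (S.V n → K) × (S.V n → L) =>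
        |𝔼 v, f0 (pullbackName (S.σ n) v p.1) * g (pullbackName (S.σ n) v p.2)|)
        ((m n : Measure (S.V n → K)).prod (m' n : Measure (S.V n → L))) := by
      refine integrable_of_abs_le hm1 (C := ‖f0‖ * ‖g‖) fun p => ?_
      rw [abs_abs]
      refine abs_expect_le_const fun v => ?_
      rw [abs_mul]
      exact mul_le_mul (abs_apply_le_norm f0 _) (abs_apply_le_norm g _) (abs_nonneg _)
        (norm_nonneg _)
    have hi2 : Integrable (fun p : (S.V n → K) × (S.V n → L) =>
        |c| * |𝔼 v, g (pullbackName (S.σ n) v p.2) - d|)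
        ((m n : Measure (S.V n → K)).prod (m' n : Measure (S.V n → L))) :=
      (integrable_of_abs_le ((measurable_empiricalError _ g d).comp measurable_snd)
        fun p => abs_empiricalError_le _ g d p.2).const_mul _
    rw [← hd, h4, ← integral_const_mul |c|, ← integral_add hi1 hi2]
    refine integral_mono (integrable_of_abs_le ((measurable_empiricalError _ _ _).comp
      measurable_zipModels) fun p => abs_empiricalError_le _ _ _ _) (hi1.add hi2) fun p => ?_
    simp only [← abs_mul]
    refine le_trans (le_of_eq (congrArg _ ?_)) (abs_add_le _ _)
    rw [mul_sub, Finset.mul_expect, ← add_sub_assoc, ← Finset.expect_add_distrib]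
    congr 1
    refine Finset.expect_congr rfl fun v _ => ?_
    simp only [tensor_apply, hf0, ContinuousMap.sub_apply, ContinuousMap.const_apply]
    change f (pullbackName (S.σ n) v p.1) * g (pullbackName (S.σ n) v p.2) = _
    ring

omit [MetricSpace K] [CompactSpace K] [BorelSpace K] [MetricSpace L] [CompactSpace L]
  [BorelSpace L] in
theorem map_prodLaw_fst {V : Type*} (m : ProbabilityMeasure (V → K))
    (m' : ProbabilityMeasure (V → L)) :
    (prodLaw m m').map (f := fun x v => (x v).1)
      (measurable_postcomp measurable_fst).aemeasurable = m := by
  refine Subtype.ext ?_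
  simp only [ProbabilityMeasure.val_eq_to_measure]
  rw [ProbabilityMeasure.toMeasure_map, toMeasure_prodLaw,
    Measure.map_map (measurable_postcomp measurable_fst) measurable_zipModels]
  exact (Measure.map_fst_prod).trans (by simp)

theorem DoublyQuenchedConv.quenchedConv (h : S.DoublyQuenchedConv m P) : S.QuenchedConv m P := by
  have := QuenchedConv.map h (e := Prod.fst) continuous_fst
  simpa only [map_prodLaw_fst] using this

/-- Regrouping of the factors in a product of four laws. -/
theorem map_prodLaw_prodLaw_prodLaw {V : Type*} [Countable V] (m : ProbabilityMeasure (V → K))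
    (m' : ProbabilityMeasure (V → L)) :
    (prodLaw m (prodLaw m (prodLaw m' m'))).map
      (f := fun x v => (((x v).1, (x v).2.2.1), ((x v).2.1, (x v).2.2.2)))
      (measurable_postcomp (e := fun z : K × K × L × L => ((z.1, z.2.2.1), (z.2.1, z.2.2.2)))
        (by fun_prop)).aemeasurable =
    prodLaw (prodLaw m m') (prodLaw m m') := by
  refine Subtype.ext ?_
  simp only [ProbabilityMeasure.val_eq_to_measure]
  refine Measure.ext_of_lintegral _ fun F hF => ?_
  have h1 : Measurable fun x : V → K × K × L × L =>
      F fun v => (((x v).1, (x v).2.2.1), ((x v).2.1, (x v).2.2.2)) :=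
    hF.comp (by fun_prop)
  have h2 : Measurable fun q : (V → K) × (V → L) × (V → K) × (V → L) =>
      F fun v => ((q.1 v, q.2.1 v), (q.2.2.1 v, q.2.2.2 v)) :=
    hF.comp (by fun_prop)
  rw [ProbabilityMeasure.toMeasure_map]
  refine (lintegral_map hF (by fun_prop)).trans ?_
  rw [lintegral_prodLaw _ _ h1, lintegral_prodLaw _ _ hF, lintegral_prodLaw]
  · refine lintegral_congr fun x => ?_
    rw [lintegral_prodLaw]
    · simp only
      refine (lintegral_congr fun y => lintegral_prodLaw _ _ ?_).trans
        ((lintegral_lintegral_swap ?_).trans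
          (lintegral_congr fun x' => (lintegral_prodLaw _ _
            (F := fun b => F fun v => ((x v, x' v), b v)) ?_).symm))
      · exact hF.comp (by fun_prop)
      · refine Measurable.aemeasurable ?_
        refine Measurable.lintegral_prod_right' (f := fun q : ((V → K) × (V → L)) × (V → L) =>
          F fun v => ((x v, q.1.2 v), (q.1.1 v, q.2 v))) ?_
        exact hF.comp (by fun_prop)
      · exact hF.comp (by fun_prop)
    · exact hF.comp (by fun_prop)
  · refine Measurable.lintegral_prod_right' (f := fun q : (V → K × L) × (V → K × L) =>
      F fun v => (q.1 v, q.2 v)) ?_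
    exact hF.comp (by fun_prop)

/-- Doubly-quenched convergence is preserved by products. -/
theorem DoublyQuenchedConv.prodLaw (h : S.DoublyQuenchedConv m P)
    (h' : S.DoublyQuenchedConv m' P') :
    S.DoublyQuenchedConv (fun n => _root_.prodLaw (m n) (m' n)) (_root_.prodLaw P P') := by
  have h1 := h.prodLaw_quenchedConv h.quenchedConv (m' := fun n => _root_.prodLaw (m' n) (m' n))
    (P' := _root_.prodLaw P' P') h'
  have h2 := QuenchedConv.map (h.prodLaw_quenchedConv h.quenchedConv h1)
    (e := fun z : K × K × L × L => ((z.1, z.2.2.1), (z.2.1, z.2.2.2))) (by fun_prop)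
  simp only [map_prodLaw_prodLaw_prodLaw] at h2
  exact h2

end SoficApproximation

/-! ### Uniform continuity on name spaces and the asymptotic equivariance of pullback names -/

section UniformContinuity

variable {G : Type*} {K : Type*} [MetricSpace K] [CompactSpace K]

/-- Quantitative uniform continuity of a continuous function of names: up to a small error it is
Lipschitz in finitely many coordinates. -/
theorem exists_finset_abs_sub_le (θ : C(G → K, ℝ)) {τ : ℝ} (hτ : 0 < τ) :
    ∃ (F : Finset G) (C : ℝ), 0 ≤ C ∧
      ∀ a b : G → K, |θ a - θ b| ≤ τ + C * ∑ g ∈ F, dist (a g) (b g) := by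
  have huc := CompactSpace.uniformContinuous_of_continuous θ.continuous
  have h1 : {p : (G → K) × (G → K) | dist (θ p.1) (θ p.2) < τ} ∈ uniformity (G → K) :=
    huc (Metric.dist_mem_uniformity hτ)
  rw [Pi.uniformity] at h1
  have hb := Filter.HasBasis.iInf (ι := G) fun g =>
    (Metric.uniformity_basis_dist (α := K)).comap
      (fun a : (G → K) × (G → K) => (a.1 g, a.2 g))
  obtain ⟨⟨I, r⟩, ⟨hI, hr⟩, hsub⟩ := hb.mem_iff.1 h1
  obtain ⟨ρ, hρ, hle⟩ : ∃ ρ > 0, ∀ i : I, ρ ≤ r i := by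
    have := hI.to_subtype
    have hfin : Finite I := this
    rcases isEmpty_or_nonempty I with he | he
    · exact ⟨1, one_pos, fun f => (he.false f).elim⟩
    · obtain ⟨f, hf⟩ := Finite.exists_min (fun f : I => r f)
      exact ⟨r f, hr f, hf⟩
  refine ⟨hI.toFinset, 2 * ‖θ‖ / ρ, by positivity, fun a b => ?_⟩
  by_cases hab : ∀ g ∈ I, dist (a g) (b g) < ρ
  · have h2 : (a, b) ∈ {p : (G → K) × (G → K) | dist (θ p.1) (θ p.2) < τ} := by
      refine hsub ?_
      simp only [Set.mem_iInter, Set.mem_preimage]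
      exact fun i => (hab i i.2).trans_le (hle i)
    have h3 : 0 ≤ 2 * ‖θ‖ / ρ * ∑ g ∈ hI.toFinset, dist (a g) (b g) :=
      mul_nonneg (by positivity) (Finset.sum_nonneg fun g _ => dist_nonneg)
    have h4 : |θ a - θ b| < τ := h2
    linarith
  · push Not at hab
    obtain ⟨g, hg, hgρ⟩ := hab
    have h2 : ρ ≤ ∑ g ∈ hI.toFinset, dist (a g) (b g) :=
      hgρ.trans (Finset.single_le_sum (f := fun g => dist (a g) (b g))
        (fun g _ => dist_nonneg) (hI.mem_toFinset.2 hg))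
    have h3 : |θ a - θ b| ≤ 2 * ‖θ‖ := by
      refine (abs_sub _ _).trans ?_
      linarith [abs_apply_le_norm θ a, abs_apply_le_norm θ b]
    have h4 : 2 * ‖θ‖ ≤ 2 * ‖θ‖ / ρ * ∑ g ∈ hI.toFinset, dist (a g) (b g) := by
      rw [div_mul_eq_mul_div, le_div_iff₀ hρ]
      exact mul_le_mul_of_nonneg_left h2 (by positivity)
    linarith

theorem exists_dist_le (K : Type*) [MetricSpace K] [CompactSpace K] :
    ∃ D : ℝ, 0 ≤ D ∧ ∀ a b : K, dist a b ≤ D :=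
  ⟨Metric.diam (Set.univ : Set K), Metric.diam_nonneg, fun _ _ =>
    Metric.dist_le_diam_of_mem isCompact_univ.isBounded trivial trivial⟩

end UniformContinuity

/-- The right shift of a name. -/
def shiftName {G K : Type*} [Mul G] (g : G) (a : G → K) : G → K := fun h => a (h * g)

theorem continuous_shiftName {G K : Type*} [Mul G] [TopologicalSpace K] (g : G) :
    Continuous (shiftName (K := K) g) := by
  unfold shiftName; fun_prop

theorem measurable_shiftName {G K : Type*} [Mul G] [MeasurableSpace K] (g : G) :
    Measurable (shiftName (K := K) g) := by
  unfold shiftName; fun_prop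

namespace SoficApproximation

variable {G : Type*} [Group G] [Countable G]
  {K : Type*} [MetricSpace K] [CompactSpace K]
  {S : SoficApproximation G}

omit [Countable G] in
/-- The pullback name at `σ^g v` is close to the shift of the pullback name at `v`, for most
vertices `v` and uniformly over all models. -/
theorem eventually_expect_shift_le (S : SoficApproximation G) (θ : C(G → K, ℝ)) (g : G) {η : ℝ}
    (hη : 0 < η) : ∀ᶠ n in atTop, ∀ x : S.V n → K,
      𝔼 v, |θ (pullbackName (S.σ n) (S.σ n g v) x) -
        θ (shiftName g (pullbackName (S.σ n) v x))| ≤ η := by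
  classical
  obtain ⟨F, C, hC, hF⟩ := exists_finset_abs_sub_le θ (half_pos hη)
  obtain ⟨D, hD, hdist⟩ := exists_dist_le K
  have h1 : Tendsto (fun n => C * ∑ h ∈ F, D * 𝔼 v,
      if S.σ n h (S.σ n g v) = S.σ n (h * g) v then (0 : ℝ) else 1) atTop (𝓝 0) := by
    have := (tendsto_finsetSum F fun h _ =>
      (withHighProb_iff.1 (S.asymp_mul h g)).const_mul D).const_mul C
    simpa using this
  filter_upwards [eventually_le_of_tendsto_zero h1 (half_pos hη)] with n hn x
  calc _ ≤ 𝔼 v, (η / 2 + C * ∑ h ∈ F, D *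
        if S.σ n h (S.σ n g v) = S.σ n (h * g) v then (0 : ℝ) else 1) := by
        refine expect_mono fun v => (hF _ _).trans ?_
        gcongr with h hh
        simp only [pullbackName, shiftName]
        split_ifs with he
        · rw [he, dist_self, mul_zero]
        · rw [mul_one]; exact hdist _ _
    _ = η / 2 + C * ∑ h ∈ F, D * 𝔼 v,
        if S.σ n h (S.σ n g v) = S.σ n (h * g) v then (0 : ℝ) else 1 := by
        rw [Finset.expect_add_distrib, Fintype.expect_const, ← Finset.mul_expect,
          Finset.expect_sum_comm]
        simp only [Finset.mul_expect]
    _ ≤ η := by linarith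

variable [MeasurableSpace K] [BorelSpace K] {m : ∀ n, ProbabilityMeasure (S.V n → K)}
  {P : ProbabilityMeasure (G → K)}

omit [Countable G] [CompactSpace K] [BorelSpace K] in
theorem LocalMean.tendsto_expect {f : C(G → K, ℝ)} (h : S.LocalMean m P f) :
    Tendsto (fun n => 𝔼 v, ∫ x, f (pullbackName (S.σ n) v x) ∂(m n : Measure (S.V n → K)))
      atTop (𝓝 (∫ a, f a ∂(P : Measure (G → K)))) := by
  rw [tendsto_iff_dist_tendsto_zero]
  refine squeeze_zero (fun n => dist_nonneg) (fun n => ?_) h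
  rw [Real.dist_eq]
  refine le_trans (le_of_eq ?_) (abs_expect_le _)
  rw [Finset.expect_sub_distrib, Fintype.expect_const]

/-- Under local weak convergence, the mean of the empirical average of `f` converges. -/
theorem LocalMean.tendsto_integral_expect {f : C(G → K, ℝ)} (h : S.LocalMean m P f) :
    Tendsto (fun n => ∫ x, 𝔼 v, f (pullbackName (S.σ n) v x) ∂(m n : Measure (S.V n → K)))
      atTop (𝓝 (∫ a, f a ∂(P : Measure (G → K)))) := by
  refine h.tendsto_expect.congr fun n => ?_
  rw [integral_expect fun v => integrable_comp_pullbackName n v f]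

/-! ### Local weak convergence to an ergodic process is quenched -/

omit [Countable G] [CompactSpace K] [BorelSpace K] in
theorem EmpiricalMean.smul {f : C(G → K, ℝ)} (hf : S.EmpiricalMean m P f) (c : ℝ) :
    S.EmpiricalMean m P (c • f) := by
  have h := Tendsto.const_mul |c| hf
  rw [mul_zero] at h
  refine h.congr fun n => ?_
  rw [← integral_const_mul]
  refine integral_congr_ae (ae_of_all _ fun x => ?_)
  simp only [ContinuousMap.smul_apply, smul_eq_mul]
  rw [integral_const_mul, ← Finset.mul_expect, ← mul_sub, abs_mul]

omit [Countable G] [CompactSpace K] [BorelSpace K] in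
theorem empiricalMean_const (c : ℝ) : S.EmpiricalMean m P (ContinuousMap.const _ c) := by
  unfold EmpiricalMean
  simp

/-- Coboundaries of continuous functions satisfy the empirical convergence, for every sequence of
laws on models. -/
theorem empiricalMean_sub_shift (hinv : ∀ g : G, MeasurePreserving (shiftName g)
      (P : Measure (G → K)) P) (h : C(G → K, ℝ)) (g : G) :
    S.EmpiricalMean m P (h - h.comp ⟨shiftName g, continuous_shiftName g⟩) := by
  refine tendsto_zero_of_eventually_le (fun n => integral_nonneg fun x => abs_nonneg _) ?_
  intro η hη
  filter_upwards [eventually_expect_shift_le S h g hη] with n hn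
  have h0 : ∫ a, (h - h.comp ⟨shiftName g, continuous_shiftName g⟩) a ∂(P : Measure (G → K)) =
      0 := by
    simp only [ContinuousMap.sub_apply]
    rw [integral_sub (integrable_continuousMap h) (integrable_continuousMap _)]
    have h1 := integral_map (μ := (P : Measure (G → K))) (measurable_shiftName g).aemeasurable
      (h.continuous.measurable.aestronglyMeasurable)
    rw [(hinv g).map_eq] at h1
    exact sub_eq_zero.2 h1
  refine integral_le_const (measurable_empiricalError _ _ _) fun x => ?_
  rw [abs_abs, h0, sub_zero]
  refine le_trans ?_ (hn x)
  refine le_trans (le_of_eq (congrArg _ ?_)) (abs_expect_le _)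
  rw [Finset.expect_sub_distrib,
    expect_comp_perm (S.σ n g) fun v => h (pullbackName (S.σ n) v x), ← Finset.expect_sub_distrib]
  rfl

/-- Constants and coboundaries of continuous functions. -/
def coboundaries (G K : Type*) [Group G] [MetricSpace K] :
    Submodule ℝ C(G → K, ℝ) :=
  Submodule.span ℝ ({ContinuousMap.const _ 1} ∪
    {f | ∃ (h : C(G → K, ℝ)) (g : G), f = h - h.comp ⟨shiftName g, continuous_shiftName g⟩})

/-- For an ergodic shift-invariant law, constants and coboundaries of continuous functions are
dense among the continuous functions, for the `L¹`-distance. -/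
theorem exists_mem_coboundaries (hinv : ∀ g : G, MeasurePreserving (shiftName g)
      (P : Measure (G → K)) P)
    (herg : ∀ F : (G → K) → ℝ, Measurable F →
      (∀ g : G, F ∘ shiftName g =ᵐ[(P : Measure (G → K))] F) →
      ∃ c, F =ᵐ[(P : Measure (G → K))] fun _ => c)
    (f : C(G → K, ℝ)) {η : ℝ} (hη : 0 < η) :
    ∃ d ∈ coboundaries G K, ∫ a, |f a - d a| ∂(P : Measure (G → K)) ≤ η := by
  set T := ContinuousMap.toLp (E := ℝ) 2 (P : Measure (G → K)) ℝ with hT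
  set D := (coboundaries G K).map (T : C(G → K, ℝ) →ₗ[ℝ] Lp ℝ 2 (P : Measure (G → K))) with hD
  have hT_ae : ∀ h, T h =ᵐ[(P : Measure (G → K))] h := fun h => ContinuousMap.coeFn_toLp _ h
  have hdense : D.topologicalClosure = ⊤ := by
    rw [Submodule.topologicalClosure_eq_top_iff, Submodule.eq_bot_iff]
    intro F hF
    have hF' : ∀ d ∈ coboundaries G K, inner ℝ (T d) F = 0 := fun d hd =>
      (Submodule.mem_orthogonal _ _).1 hF _ (Submodule.mem_map_of_mem hd)
    have hconst : ∃ c, F =ᵐ[(P : Measure (G → K))] fun _ => c := by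
      refine herg F (Lp.stronglyMeasurable F).measurable fun g => ?_
      set U := Lp.compMeasurePreservingₗᵢ ℝ (E := ℝ) (p := 2) (shiftName g) (hinv g) with hU
      have hUT : ∀ h : C(G → K, ℝ), U (T h) =
          T (h.comp ⟨shiftName g, continuous_shiftName g⟩) := by
        intro h
        refine Lp.ext ?_
        have h1 : U (T h) =ᵐ[(P : Measure (G → K))] T h ∘ shiftName g :=
          Lp.coeFn_compMeasurePreserving _ (hinv g)
        have h2 : (T h ∘ shiftName g) =ᵐ[(P : Measure (G → K))] h ∘ shiftName g :=
          (hinv g).quasiMeasurePreserving.ae_eq_comp (hT_ae h)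
        exact h1.trans (h2.trans
          (hT_ae (h.comp ⟨shiftName g, continuous_shiftName g⟩)).symm)
      have hUF : F = U F := by
        refine (ContinuousMap.toLp_denseRange ℝ (P : Measure (G → K)) ℝ
          (p := 2) (by simp)).eq_of_inner_left ℝ fun h => ?_
        -- every continuous function is the shift by `g` of a continuous function
        set h' := h.comp ⟨shiftName g⁻¹, continuous_shiftName g⁻¹⟩ with hh'
        have hh : h = h'.comp ⟨shiftName g, continuous_shiftName g⟩ := by
          ext a
          change h a = h (shiftName g⁻¹ (shiftName g a))
          congr 1
          ext i
          simp [shiftName]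
        have h1 := hF' _ (Submodule.subset_span (Or.inr ⟨h', g, rfl⟩))
        rw [map_sub, inner_sub_left, sub_eq_zero, ← hUT h'] at h1
        have h2 : T h = U (T h') := by rw [hUT, ← hh]
        change inner ℝ F (T h) = inner ℝ (U F) (T h)
        rw [h2, U.inner_map_map, real_inner_comm, ← h1, real_inner_comm]
      have h3 : U F =ᵐ[(P : Measure (G → K))] F ∘ shiftName g :=
        Lp.coeFn_compMeasurePreserving _ (hinv g)
      exact h3.symm.trans (by rw [← hUF])
    obtain ⟨c, hc⟩ := hconst
    have h1 := hF' (ContinuousMap.const _ 1) (Submodule.subset_span (Or.inl rfl))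
    rw [L2.inner_def] at h1
    have h2 : ∫ a, inner ℝ (T (ContinuousMap.const _ 1) a) (F a) ∂(P : Measure (G → K)) =
        ∫ _a, c ∂(P : Measure (G → K)) := by
      refine integral_congr_ae ?_
      filter_upwards [hc, hT_ae (ContinuousMap.const _ 1)] with a ha hb
      rw [ha, hb]; simp
    rw [h1] at h2
    have hc0 : c = 0 := by simpa using h2.symm
    refine Lp.ext (hc.trans ?_)
    rw [hc0]
    exact (Lp.coeFn_zero _ _ _).symm
  have hmem : T f ∈ closure (D : Set (Lp ℝ 2 (P : Measure (G → K)))) := by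
    rw [← Submodule.topologicalClosure_coe, hdense]; trivial
  obtain ⟨_, ⟨d, hd, rfl⟩, hfd⟩ := Metric.mem_closure_iff.1 hmem η hη
  refine ⟨d, hd, ?_⟩
  have hmeas : Measurable fun a => |f a - d a| :=
    continuous_abs.measurable.comp (f - d).continuous.measurable
  have h1 := sq_integral_le (μ := (P : Measure (G → K))) hmeas (C := ‖f - d‖) fun a => by
    rw [abs_abs]; exact abs_apply_sub_le_norm f d a
  have h2 : ∫ a, |f a - d a| ^ 2 ∂(P : Measure (G → K)) = ‖T (f - d)‖ ^ 2 := by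
    rw [← real_inner_self_eq_norm_sq, L2.inner_def]
    refine integral_congr_ae ?_
    filter_upwards [hT_ae (f - d)] with a ha
    rw [ha]
    simp [sq]
  rw [h2] at h1
  have h3 : ‖T (f - d)‖ < η := by rw [map_sub, ← dist_eq_norm]; exact hfd
  exact (le_abs_self _).trans ((abs_le_of_sq_le_sq h1 (norm_nonneg _)).trans h3.le)

/-- Local weak convergence to an ergodic shift-invariant law is quenched convergence. -/
theorem QuenchedConv.of_ergodic (hinv : ∀ g : G, MeasurePreserving (shiftName g)
      (P : Measure (G → K)) P)
    (herg : ∀ F : (G → K) → ℝ, Measurable F →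
      (∀ g : G, F ∘ shiftName g =ᵐ[(P : Measure (G → K))] F) →
      ∃ c, F =ᵐ[(P : Measure (G → K))] fun _ => c)
    (hm : ∀ f, S.LocalMean m P f) : S.QuenchedConv m P := by
  have hcob : ∀ d ∈ coboundaries G K, S.EmpiricalMean m P d := by
    intro d hd
    induction hd using Submodule.span_induction with
    | mem x hx =>
      rcases hx with rfl | ⟨h, g, rfl⟩
      · exact empiricalMean_const 1
      · exact empiricalMean_sub_shift hinv h g
    | zero =>
      have : (0 : C(G → K, ℝ)) = ContinuousMap.const _ 0 := rfl
      rw [this]; exact empiricalMean_const 0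
    | add x y _ _ hx hy => exact hx.add hy
    | smul a x _ hx => exact hx.smul a
  refine quenchedConv_iff.2 ⟨hm, fun f => ?_⟩
  refine tendsto_zero_of_eventually_le (fun n => integral_nonneg fun x => abs_nonneg _) ?_
  intro η hη
  obtain ⟨d, hd, hfd⟩ := exists_mem_coboundaries hinv herg f (show 0 < η / 4 by positivity)
  set e : C(G → K, ℝ) := ⟨fun a => |f a - d a|, by fun_prop⟩ with he
  filter_upwards [eventually_le_of_tendsto_zero (hcob d hd) (show 0 < η / 4 by positivity),
    eventually_le_add_of_tendsto (hm e).tendsto_integral_expect (show 0 < η / 4 by positivity)]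
    with n h1 h2
  have hint : Integrable (fun x => 𝔼 v, e (pullbackName (S.σ n) v x))
      (m n : Measure (S.V n → K)) :=
    integrable_of_abs_le (measurable_expect fun v => measurable_comp_pullbackName _ v e)
      fun x => abs_expect_le_const fun v => abs_apply_le_norm e _
  have hfd' : |∫ a, f a ∂(P : Measure (G → K)) - ∫ a, d a ∂(P : Measure (G → K))| ≤ η / 4 := by
    rw [← integral_sub (integrable_continuousMap f) (integrable_continuousMap d)]
    exact (abs_integral_le_integral_abs).trans hfd
  calc _ ≤ ∫ x, (|𝔼 v, d (pullbackName (S.σ n) v x) - ∫ a, d a ∂(P : Measure (G → K))| +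
          𝔼 v, e (pullbackName (S.σ n) v x) + η / 4) ∂(m n : Measure (S.V n → K)) := by
        refine integral_mono (integrable_empiricalError n _ _)
          (((integrable_empiricalError n d _).add hint).add (integrable_const _)) fun x => ?_
        have h3 : |𝔼 v, f (pullbackName (S.σ n) v x) - 𝔼 v, d (pullbackName (S.σ n) v x)| ≤
            𝔼 v, e (pullbackName (S.σ n) v x) := by
          rw [← Finset.expect_sub_distrib]
          exact abs_expect_le _
        have h4 := abs_sub_le (𝔼 v, f (pullbackName (S.σ n) v x))
          (𝔼 v, d (pullbackName (S.σ n) v x)) (∫ a, f a ∂(P : Measure (G → K)))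
        have h5 := abs_sub_le (𝔼 v, d (pullbackName (S.σ n) v x))
          (∫ a, d a ∂(P : Measure (G → K))) (∫ a, f a ∂(P : Measure (G → K)))
        rw [abs_sub_comm (∫ a, d a ∂(P : Measure (G → K)))] at h5
        simp only
        linarith
    _ ≤ η := by
        rw [integral_add (f := fun x => |𝔼 v, d (pullbackName (S.σ n) v x) -
            ∫ a, d a ∂(P : Measure (G → K))| + 𝔼 v, e (pullbackName (S.σ n) v x))
            ((integrable_empiricalError n d _).add hint) (integrable_const _),
          integral_add (integrable_empiricalError n d _) hint]
        simp only [integral_const, probReal_univ, one_smul]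
        have : ∫ a, e a ∂(P : Measure (G → K)) ≤ η / 4 := hfd
        linarith

end SoficApproximation

/-! ### Ergodicity of product systems -/

section Ergodic

variable {G : Type*} [Group G]

theorem smulInvariantMeasure_prod {X Y : Type*} [MeasurableSpace X] [MeasurableSpace Y]
    [MulAction G X] [MulAction G Y] [MeasurableConstSMul G X] [MeasurableConstSMul G Y]
    (μ : Measure X) (ν : Measure Y) [SFinite μ] [SFinite ν] [SMulInvariantMeasure G X μ]
    [SMulInvariantMeasure G Y ν] : SMulInvariantMeasure G (X × Y) (μ.prod ν) where
  measure_preimage_smul g _ hs :=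
    ((measurePreserving_smul g μ).prod (measurePreserving_smul g ν)).measure_preimage
      hs.nullMeasurableSet

/-- A measurable function which is invariant under an ergodic action is constant almost
everywhere. -/
theorem ae_eq_const_of_forall_smul_ae_eq {X β : Type*} [MeasurableSpace X] [MulAction G X]
    {μ : Measure X} [ErgodicSMul G X μ] [Nonempty β] [MeasurableSpace β]
    [MeasurableSpace.CountablySeparated β] {f : X → β} (hf : Measurable f)
    (h : ∀ g : G, (fun x => f (g • x)) =ᵐ[μ] f) : ∃ c, f =ᵐ[μ] fun _ => c := by
  refine exists_eventuallyEq_const_of_forall_separating MeasurableSet fun U hU => ?_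
  refine eventuallyConst_set.1 ?_
  refine aeconst_of_forall_preimage_smul_ae_eq G (hf hU).nullMeasurableSet fun g => ?_
  refine ((h g).mono fun x hx => ?_).set_eq
  change f (g • x) ∈ U ↔ f x ∈ U
  rw [show f (g • x) = f x from hx]

variable {X Y : Type*} [MeasurableSpace X] [MeasurableSpace Y]
    [MulAction G X] [MulAction G Y] [MeasurableConstSMul G X] [MeasurableConstSMul G Y]

omit [MeasurableConstSMul G X] [MeasurableConstSMul G Y] in
/-- The sections of an almost invariant set over an ergodic system have almost surely the same
measure. -/
theorem exists_measure_section_ae_eq (μ : Measure X) (ν : Measure Y) [IsProbabilityMeasure μ]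
    [IsProbabilityMeasure ν] [ErgodicSMul G X μ] [SMulInvariantMeasure G Y ν] {E : Set (X × Y)}
    (hE : MeasurableSet E) (h : ∀ g : G, (g • ·) ⁻¹' E =ᵐ[μ.prod ν] E) :
    ∃ c, ∀ᵐ x ∂μ, ν (Prod.mk x ⁻¹' E) = c := by
  refine ae_eq_const_of_forall_smul_ae_eq (G := G) (measurable_measure_prodMk_left hE) fun g => ?_
  filter_upwards [Measure.ae_ae_of_ae_prod (h g)] with x hx
  rw [← measure_preimage_smul (μ := ν) g (Prod.mk (g • x) ⁻¹' E)]
  exact measure_congr hx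

omit [Group G] [MulAction G X] [MulAction G Y] [MeasurableConstSMul G X]
  [MeasurableConstSMul G Y] in
theorem prod_inter_of_section_ae_eq {μ : Measure X} {ν : Measure Y} [IsProbabilityMeasure ν]
    {E : Set (X × Y)} (hE : MeasurableSet E) {c : ℝ≥0∞}
    (hc : ∀ᵐ x ∂μ, ν (Prod.mk x ⁻¹' E) = c) {A : Set X} (hA : MeasurableSet A) :
    (μ.prod ν) ((A ×ˢ Set.univ) ∩ E) = c * μ A := by
  rw [Measure.prod_apply ((hA.prod MeasurableSet.univ).inter hE)]
  have : ∀ᵐ x ∂μ, ν (Prod.mk x ⁻¹' ((A ×ˢ Set.univ) ∩ E)) = A.indicator (fun _ => c) x := by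
    filter_upwards [hc] with x hx
    by_cases hxA : x ∈ A
    · rw [Set.indicator_of_mem hxA, ← hx]
      congr 1; ext y; simp [hxA]
    · rw [Set.indicator_of_notMem hxA]
      have : Prod.mk x ⁻¹' ((A ×ˢ Set.univ) ∩ E) = ∅ := by ext y; simp [hxA]
      rw [this, measure_empty]
  rw [lintegral_congr_ae this, lintegral_indicator_const hA]

/-- The product of a weakly mixing system with an ergodic one is ergodic. -/
theorem ergodicSMul_prod_of_weaklyMixing (μ : Measure X) (ν : Measure Y)
    [IsProbabilityMeasure μ] [IsProbabilityMeasure ν] [ErgodicSMul G X μ] [ErgodicSMul G Y ν]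
    [ErgodicSMul G (X × X) (μ.prod μ)] : ErgodicSMul G (X × Y) (μ.prod ν) := by
  have := smulInvariantMeasure_prod (G := G) μ ν
  refine ⟨fun {E} hE hinv => ?_⟩
  -- constancy of the measures of the sections of `E` in both directions
  obtain ⟨c₁, hc₁⟩ := exists_measure_section_ae_eq μ ν hE hinv
  obtain ⟨c₂, hc₂⟩ : ∃ c, ∀ᵐ y ∂ν, μ ((fun x => (x, y)) ⁻¹' E) = c := by
    refine exists_measure_section_ae_eq (G := G) ν μ (measurable_swap hE) fun g => ?_
    exact (Measure.measurePreserving_swap (μ := ν) (ν := μ)).quasiMeasurePreserving.tendsto_ae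
      (hinv g)
  have hEE : MeasurableSet {p : (X × X) × Y | (p.1.1, p.2) ∈ E ∧ (p.1.2, p.2) ∈ E} := by
    have hm1 : Measurable fun p : (X × X) × Y => (p.1.1, p.2) := by fun_prop
    have hm2 : Measurable fun p : (X × X) × Y => (p.1.2, p.2) := by fun_prop
    exact (hm1 hE).inter (hm2 hE)
  -- constancy of the measures of the intersections of two sections
  obtain ⟨c₃, hc₃⟩ : ∃ c, ∀ᵐ x ∂(μ.prod μ),
      ν (Prod.mk x ⁻¹' {p : (X × X) × Y | (p.1.1, p.2) ∈ E ∧ (p.1.2, p.2) ∈ E}) = c := by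
    have hp1 : MeasurePreserving (fun p : (X × X) × Y => (p.1.1, p.2)) ((μ.prod μ).prod ν)
        (μ.prod ν) :=
      (measurePreserving_fst (μ := μ) (ν := μ)).prod (MeasurePreserving.id ν)
    have hp2 : MeasurePreserving (fun p : (X × X) × Y => (p.1.2, p.2)) ((μ.prod μ).prod ν)
        (μ.prod ν) :=
      (measurePreserving_snd (μ := μ) (ν := μ)).prod (MeasurePreserving.id ν)
    refine exists_measure_section_ae_eq (G := G) (μ.prod μ) ν hEE fun g => ?_
    have e1 := hp1.quasiMeasurePreserving.tendsto_ae (hinv g)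
    have e2 := hp2.quasiMeasurePreserving.tendsto_ae (hinv g)
    exact Filter.EventuallyEq.inter e1 e2
  have hsec : ∀ y, MeasurableSet ((fun x => (x, y)) ⁻¹' E) := fun y => measurable_prodMk_right hE
  -- `f A y` is the measure of the part of the section of `E` at `y` which lies in `A`
  set f : Set X → Y → ℝ := fun A y => μ.real (A ∩ (fun x => (x, y)) ⁻¹' E) with hf
  have hEA : ∀ A, MeasurableSet A → MeasurableSet ((A ×ˢ Set.univ) ∩ E) := fun A hA =>
    (hA.prod MeasurableSet.univ).inter hE
  have hfm' : ∀ A, MeasurableSet A → Measurable fun y => μ (A ∩ (fun x => (x, y)) ⁻¹' E) := by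
    intro A hA
    have h1 : (fun y => μ (A ∩ (fun x => (x, y)) ⁻¹' E)) =
        fun y => μ ((fun x => (x, y)) ⁻¹' ((A ×ˢ Set.univ) ∩ E)) := by
      ext y; congr 1; ext x; simp
    rw [h1]
    exact measurable_measure_prodMk_right (hEA A hA)
  have hfm : ∀ A, MeasurableSet A → Measurable (f A) := fun A hA => (hfm' A hA).ennreal_toReal
  have hfb : ∀ A y, |f A y| ≤ 1 := fun A y => by
    rw [abs_of_nonneg measureReal_nonneg]; exact measureReal_le_one
  have hc1t : c₁ ≠ ∞ := by
    obtain ⟨x, hx⟩ := hc₁.exists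
    rw [← hx]; exact measure_ne_top _ _
  have hc2t : c₂ ≠ ∞ := by
    obtain ⟨x, hx⟩ := hc₂.exists
    rw [← hx]; exact measure_ne_top _ _
  have hc3t : c₃ ≠ ∞ := by
    obtain ⟨x, hx⟩ := hc₃.exists
    rw [← hx]; exact measure_ne_top _ _
  have hint1 : ∀ A, MeasurableSet A → ∫ y, f A y ∂ν = c₁.toReal * μ.real A := by
    intro A hA
    have h1 : (μ.prod ν) ((A ×ˢ Set.univ) ∩ E) = c₁ * μ A :=
      prod_inter_of_section_ae_eq hE hc₁ hA
    have h2 : (μ.prod ν) ((A ×ˢ Set.univ) ∩ E) = ∫⁻ y, μ (A ∩ (fun x => (x, y)) ⁻¹' E) ∂ν := by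
      rw [Measure.prod_apply_symm (hEA A hA)]
      refine lintegral_congr fun y => congrArg μ ?_
      ext x; simp
    simp only [hf, measureReal_def]
    rw [integral_toReal (hfm' A hA).aemeasurable (ae_of_all _ fun y => measure_lt_top _ _),
      ← h2, h1, ENNReal.toReal_mul]
  have hint2 : ∀ A, MeasurableSet A → ∫ y, f A y ^ 2 ∂ν = c₃.toReal * μ.real A ^ 2 := by
    intro A hA
    have h1 := prod_inter_of_section_ae_eq hEE hc₃ (hA.prod hA)
    have h2 : ((μ.prod μ).prod ν) (((A ×ˢ A) ×ˢ Set.univ) ∩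
        {p : (X × X) × Y | (p.1.1, p.2) ∈ E ∧ (p.1.2, p.2) ∈ E}) =
        ∫⁻ y, μ (A ∩ (fun x => (x, y)) ⁻¹' E) * μ (A ∩ (fun x => (x, y)) ⁻¹' E) ∂ν := by
      rw [Measure.prod_apply_symm (((hA.prod hA).prod MeasurableSet.univ).inter hEE)]
      refine lintegral_congr fun y => ?_
      rw [← Measure.prod_prod]
      congr 1
      ext x
      simp only [Set.mem_preimage, Set.mem_inter_iff, Set.mem_prod, Set.mem_univ, and_true,
        Set.mem_ofPred_eq]
      tauto
    have h3 : ∀ y, f A y ^ 2 = (μ (A ∩ (fun x => (x, y)) ⁻¹' E) *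
        μ (A ∩ (fun x => (x, y)) ⁻¹' E)).toReal := fun y => by
      rw [ENNReal.toReal_mul, sq]; rfl
    simp only [h3]
    rw [integral_toReal (f := fun y => μ (A ∩ (fun x => (x, y)) ⁻¹' E) *
        μ (A ∩ (fun x => (x, y)) ⁻¹' E)) ((hfm' A hA).mul (hfm' A hA)).aemeasurable
      (ae_of_all _ fun y => ENNReal.mul_lt_top (measure_lt_top _ _) (measure_lt_top _ _)),
      ← h2, h1, Measure.prod_prod, ENNReal.toReal_mul, ENNReal.toReal_mul, sq]
    rfl
  have hcc : c₁.toReal = c₂.toReal := by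
    have h1 := hint1 Set.univ MeasurableSet.univ
    have h2 : ∫ y, f Set.univ y ∂ν = ∫ _y, c₂.toReal ∂ν := integral_congr_ae <| by
      filter_upwards [hc₂] with y hy
      simp only [hf, Set.univ_inter, measureReal_def, hy]
    rw [h2] at h1
    simpa using h1.symm
  have hc3 : c₃.toReal = c₁.toReal ^ 2 := by
    have h1 := hint2 Set.univ MeasurableSet.univ
    have h2 : ∫ y, f Set.univ y ^ 2 ∂ν = ∫ _y, c₂.toReal ^ 2 ∂ν := integral_congr_ae <| by
      filter_upwards [hc₂] with y hy
      simp only [hf, Set.univ_inter, measureReal_def, hy]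
    rw [h2] at h1
    rw [hcc]
    simpa using h1.symm
  have hconst : ∀ A, MeasurableSet A → f A =ᵐ[ν] fun _ => c₁.toReal * μ.real A := by
    intro A hA
    have hi : Integrable (f A) ν := integrable_of_abs_le (hfm A hA) (hfb A)
    have hi2 : Integrable (fun y => f A y ^ 2) ν :=
      integrable_of_abs_le ((hfm A hA).pow_const 2) (C := 1) fun y => by
        rw [abs_pow]; exact pow_le_one₀ (abs_nonneg _) (hfb A y)
    set c := c₁.toReal * μ.real A with hc
    have hi3 : Integrable (fun y => 2 * c * f A y) ν := hi.const_mul _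
    have hi4 : Integrable (fun y => f A y ^ 2 - 2 * c * f A y) ν := hi2.sub hi3
    have h1 : ∫ y, (f A y - c) ^ 2 ∂ν = 0 := by
      have : ∀ y, (f A y - c) ^ 2 = f A y ^ 2 - 2 * c * f A y + c ^ 2 := fun y => by ring
      simp only [this]
      rw [integral_add hi4 (integrable_const _), integral_sub hi2 hi3, integral_const_mul,
        hint1 A hA, hint2 A hA, hc3]
      simp only [integral_const, probReal_univ, one_smul, hc]
      ring
    have h2 : Integrable (fun y => (f A y - c) ^ 2) ν := by
      have : (fun y => (f A y - c) ^ 2) = fun y => f A y ^ 2 - 2 * c * f A y + c ^ 2 := by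
        ext y; ring
      rw [this]
      exact hi4.add (integrable_const _)
    rw [integral_eq_zero_iff_of_nonneg (fun y => sq_nonneg _) h2] at h1
    filter_upwards [h1] with y hy
    have := pow_eq_zero_iff (two_ne_zero) |>.1 hy
    linarith
  have hrestrict : (μ.prod ν).restrict E = c₁ • (μ.prod ν) := by
    refine Measure.ext_prod fun {A B} hA hB => ?_
    rw [Measure.restrict_apply (hA.prod hB), Measure.smul_apply, Measure.prod_prod,
      smul_eq_mul, Measure.prod_apply_symm ((hA.prod hB).inter hE)]
    have : ∀ᵐ y ∂ν, μ ((fun x => (x, y)) ⁻¹' (A ×ˢ B ∩ E)) =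
        B.indicator (fun _ => c₁ * μ A) y := by
      filter_upwards [hconst A hA] with y hy
      by_cases hyB : y ∈ B
      · rw [Set.indicator_of_mem hyB]
        have h1 : (fun x => (x, y)) ⁻¹' (A ×ˢ B ∩ E) = A ∩ (fun x => (x, y)) ⁻¹' E := by
          ext x; simp [hyB]
        rw [h1, ← ENNReal.toReal_eq_toReal_iff' (measure_ne_top _ _)
          (ENNReal.mul_ne_top hc1t (measure_ne_top _ _)), ENNReal.toReal_mul]
        exact hy
      · rw [Set.indicator_of_notMem hyB]
        have h1 : (fun x => (x, y)) ⁻¹' (A ×ˢ B ∩ E) = ∅ := by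
          ext x; simp [hyB]
        rw [h1, measure_empty]
    rw [lintegral_congr_ae this, lintegral_indicator_const hB, mul_assoc]
  have hp : (μ.prod ν) E = c₁ := by
    have := congrArg (fun ρ : Measure (X × Y) => ρ Set.univ) hrestrict
    simpa using this
  have hpp : (μ.prod ν) E = (μ.prod ν) E * (μ.prod ν) E := by
    have := congrArg (fun ρ : Measure (X × Y) => ρ E) hrestrict
    simp only [Measure.restrict_apply_self, Measure.smul_apply, smul_eq_mul] at this
    rwa [← hp] at this
  rw [eventuallyConst_set]
  by_cases h0 : (μ.prod ν) E = 0
  · right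
    exact measure_eq_zero_iff_ae_notMem.1 h0
  · left
    have h1 : (μ.prod ν) E = 1 := by
      have h2 := hpp.symm.trans (mul_one ((μ.prod ν) E)).symm
      exact (ENNReal.mul_right_inj h0 (measure_ne_top _ _)).1 h2
    exact (mem_ae_iff_prob_eq_one hE).2 h1

end Ergodic

/-! ### Names of points under process models -/

namespace ProcessModel

variable {G : Type*} [Group G] {X : Type*} [MeasurableSpace X]
  [MulAction G X] {μ : ProbabilityMeasure X}
  {K : Type*} [MeasurableSpace K]

/-- The name of the point `x`: its image in the process. -/
def name (M : ProcessModel G μ K) (x : X) : G → K := fun g => M.φ (g • x)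

theorem name_smul (M : ProcessModel G μ K) (g : G) (x : X) :
    M.name (g • x) = shiftName g (M.name x) := by
  ext h
  simp [name, shiftName, mul_smul]

variable [MeasurableConstSMul G X]

theorem measurable_name (M : ProcessModel G μ K) : Measurable M.name :=
  measurable_pi_lambda _ fun g => M.measurable_φ.comp (measurable_const_smul g)

theorem toMeasure_law (M : ProcessModel G μ K) :
    (M.law : Measure (G → K)) = (μ : Measure X).map M.name := by
  rw [law, ProbabilityMeasure.toMeasure_map]; rfl

theorem integral_law (M : ProcessModel G μ K) {f : (G → K) → ℝ} (hf : Measurable f) :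
    ∫ a, f a ∂(M.law : Measure (G → K)) = ∫ x, f (M.name x) ∂(μ : Measure X) := by
  rw [toMeasure_law, integral_map M.measurable_name.aemeasurable hf.aestronglyMeasurable]

theorem measurePreserving_shiftName [SMulInvariantMeasure G X (μ : Measure X)]
    (M : ProcessModel G μ K) (g : G) :
    MeasurePreserving (shiftName g) (M.law : Measure (G → K)) M.law where
  measurable := measurable_shiftName g
  map_eq := by
    rw [toMeasure_law, Measure.map_map (measurable_shiftName g) M.measurable_name]
    have : shiftName g ∘ M.name = M.name ∘ (g • ·) := by
      ext x : 1
      exact (M.name_smul g x).symm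
    rw [this, ← Measure.map_map M.measurable_name (measurable_const_smul g),
      (measurePreserving_smul g (μ : Measure X)).map_eq]

/-- The law of a process model of an ergodic system has no non-constant invariant functions. -/
theorem ae_eq_const_of_ergodic [ErgodicSMul G X (μ : Measure X)] (M : ProcessModel G μ K)
    (F : (G → K) → ℝ) (hF : Measurable F)
    (h : ∀ g : G, F ∘ shiftName g =ᵐ[(M.law : Measure (G → K))] F) :
    ∃ c, F =ᵐ[(M.law : Measure (G → K))] fun _ => c := by
  obtain ⟨c, hc⟩ := ae_eq_const_of_forall_smul_ae_eq (G := G) (μ := (μ : Measure X))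
    (hF.comp M.measurable_name) fun g => by
      have h1 := h g
      rw [toMeasure_law] at h1
      filter_upwards [ae_of_ae_map M.measurable_name.aemeasurable h1] with x hx
      simpa [name_smul] using hx
  refine ⟨c, ?_⟩
  rw [toMeasure_law]
  exact (ae_map_iff M.measurable_name.aemeasurable
    (measurableSet_eq_fun hF measurable_const)).2 hc

/-- Since names determine points almost surely, bounded measurable functions on the system are
approximated in `L¹` by continuous functions of the name. -/
theorem exists_continuous_integral_sub_le [Countable G] [StandardBorelSpace X]
    {J : Type*} [MetricSpace J]
    [CompactSpace J] [MeasurableSpace J] [BorelSpace J] (M : ProcessModel G μ J) {U : X → ℝ}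
    (hU : Measurable U) {C : ℝ} (hC : ∀ x, |U x| ≤ C) {η : ℝ} (hη : 0 < η) :
    ∃ θ : C(G → J, ℝ), ∫ x, |U x - θ (M.name x)| ∂(μ : Measure X) ≤ η := by
  obtain ⟨A, hA, hA0, hinj⟩ := M.injOn_conull
  have := hA.standardBorel
  have hemb : MeasurableEmbedding fun x : A => M.name x :=
    (M.measurable_name.comp measurable_subtype_coe).measurableEmbedding
      fun x y hxy => Subtype.ext (hinj x.2 y.2 hxy)
  obtain ⟨H, hH, hHU⟩ := hemb.exists_measurable_extend (hU.comp measurable_subtype_coe)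
    fun _ => inferInstance
  have hae : ∀ᵐ x ∂(μ : Measure X), H (M.name x) = U x := by
    filter_upwards [compl_mem_ae_iff.2 hA0] with x hx
    rw [compl_compl] at hx
    exact congrFun hHU ⟨x, hx⟩
  have hHi : Integrable H (M.law : Measure (G → J)) := by
    rw [toMeasure_law, integrable_map_measure hH.aestronglyMeasurable
      M.measurable_name.aemeasurable]
    exact (integrable_of_abs_le hU hC).congr (hae.mono fun x hx => hx.symm)
  obtain ⟨θ, hθ, _⟩ := hHi.exists_boundedContinuous_integral_sub_le hη
  refine ⟨θ.toContinuousMap, le_trans (le_of_eq ?_) hθ⟩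
  have hm : Measurable fun a => ‖H a - θ a‖ := (hH.sub θ.continuous.measurable).norm
  rw [M.integral_law hm]
  refine integral_congr_ae ?_
  filter_upwards [hae] with x hx
  rw [← hx]
  rfl

end ProcessModel

/-! ### Functions of models which are approximated by functions of pullback names -/

section Approximable

variable {G : Type*} [Group G] [Countable G] {X : Type*} [MeasurableSpace X]
  [MulAction G X] [MeasurableConstSMul G X] {μ : ProbabilityMeasure X}
  {J : Type*} [MetricSpace J] [CompactSpace J] [MeasurableSpace J] [BorelSpace J]

/-- Let the models `z : V n → J` have laws `m n`, and let `Q` be a process model of a system. The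
functions `F n v` of models, indexed by vertices, are `Approximable`, with limit the function `U`
on the system, if they are approximated in mean by the pullbacks of continuous functions of names
which also approximate `U`. -/
structure Approximable (S : SoficApproximation G) (m : ∀ n, ProbabilityMeasure (S.V n → J))
    (Q : ProcessModel G μ J) (F : ∀ n, S.V n → (S.V n → J) → ℝ) (U : X → ℝ) : Prop where
  measurable_left : ∀ n v, Measurable (F n v)
  measurable_right : Measurable U
  bounded : ∃ C, (∀ n v z, |F n v z| ≤ C) ∧ ∀ x, |U x| ≤ C
  approx : ∀ η > 0, ∃ θ : C(G → J, ℝ), ∫ x, |U x - θ (Q.name x)| ∂(μ : Measure X) ≤ η ∧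
    ∀ᶠ n in atTop, ∫ z, 𝔼 v, |F n v z - θ (pullbackName (S.σ n) v z)|
      ∂(m n : Measure (S.V n → J)) ≤ η

namespace Approximable

variable {S : SoficApproximation G} {m : ∀ n, ProbabilityMeasure (S.V n → J)}
  {Q : ProcessModel G μ J} {F F' : ∀ n, S.V n → (S.V n → J) → ℝ} {U U' : X → ℝ}

theorem integrable_right (h : Approximable S m Q F U) (θ : C(G → J, ℝ)) :
    Integrable (fun x => |U x - θ (Q.name x)|) (μ : Measure X) := by
  obtain ⟨C, -, hC⟩ := h.bounded
  exact ((integrable_of_abs_le h.measurable_right hC).sub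
    (integrable_of_abs_le (θ.continuous.measurable.comp Q.measurable_name)
      fun x => abs_apply_le_norm θ _)).abs

omit [Countable G] [MetricSpace J] [CompactSpace J] [BorelSpace J] in
theorem integrable_expect_abs {n : ℕ} {H : S.V n → (S.V n → J) → ℝ}
    (hH : ∀ v, Measurable (H v)) {C : ℝ} (hC : ∀ v z, |H v z| ≤ C) :
    Integrable (fun z => 𝔼 v, |H v z|) (m n : Measure (S.V n → J)) :=
  integrable_of_abs_le (measurable_expect fun v => continuous_abs.measurable.comp (hH v))
    fun z => abs_expect_le_const fun v => by rw [abs_abs]; exact hC v z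

omit [MeasurableConstSMul G X] in
theorem integrable_left (h : Approximable S m Q F U) (θ : C(G → J, ℝ)) (n : ℕ) :
    Integrable (fun z => 𝔼 v, |F n v z - θ (pullbackName (S.σ n) v z)|)
      (m n : Measure (S.V n → J)) := by
  obtain ⟨C, hC, -⟩ := h.bounded
  exact integrable_expect_abs
    (fun v => (h.measurable_left n v).sub (measurable_comp_pullbackName _ v θ))
    (C := C + ‖θ‖) fun v z => (abs_sub _ _).trans
      (add_le_add (hC n v z) (abs_apply_le_norm θ _))

/-- A criterion for approximability in terms of a pointwise estimate by approximable functions. -/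
theorem of_le {H : ∀ n, S.V n → (S.V n → J) → ℝ} {W : X → ℝ}
    (hH : ∀ n v, Measurable (H n v)) (hW : Measurable W)
    (hb : ∃ C, (∀ n v z, |H n v z| ≤ C) ∧ ∀ x, |W x| ≤ C) {C : ℝ} (hC : 0 < C)
    (h : Approximable S m Q F U) (h' : Approximable S m Q F' U')
    (Θ : C(G → J, ℝ) → C(G → J, ℝ) → C(G → J, ℝ))
    (h1 : ∀ θ θ' n v z, |H n v z - Θ θ θ' (pullbackName (S.σ n) v z)| ≤
      C * |F n v z - θ (pullbackName (S.σ n) v z)| +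
        C * |F' n v z - θ' (pullbackName (S.σ n) v z)|)
    (h2 : ∀ θ θ' x, |W x - Θ θ θ' (Q.name x)| ≤
      C * |U x - θ (Q.name x)| + C * |U' x - θ' (Q.name x)|) :
    Approximable S m Q H W where
  measurable_left := hH
  measurable_right := hW
  bounded := hb
  approx := by
    intro η hη
    obtain ⟨θ, hθ, hθn⟩ := h.approx (η / (2 * C)) (by positivity)
    obtain ⟨θ', hθ', hθn'⟩ := h'.approx (η / (2 * C)) (by positivity)
    obtain ⟨B, hB, hB'⟩ := hb
    have hη2 : C * (η / (2 * C)) + C * (η / (2 * C)) = η := by field_simp; ring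
    refine ⟨Θ θ θ', ?_, ?_⟩
    · calc _ ≤ ∫ x, (C * |U x - θ (Q.name x)| + C * |U' x - θ' (Q.name x)|)
            ∂(μ : Measure X) := by
            refine integral_mono ?_ (((h.integrable_right θ).const_mul _).add
              ((h'.integrable_right θ').const_mul _)) (h2 θ θ')
            exact ((integrable_of_abs_le hW hB').sub
              (integrable_of_abs_le ((Θ θ θ').continuous.measurable.comp Q.measurable_name)
              fun x => abs_apply_le_norm _ _)).abs
        _ ≤ η := by
            rw [integral_add ((h.integrable_right θ).const_mul _)
              ((h'.integrable_right θ').const_mul _), integral_const_mul, integral_const_mul]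
            have := mul_le_mul_of_nonneg_left hθ hC.le
            have := mul_le_mul_of_nonneg_left hθ' hC.le
            linarith
    · filter_upwards [hθn, hθn'] with n hn hn'
      calc _ ≤ ∫ z, (C * 𝔼 v, |F n v z - θ (pullbackName (S.σ n) v z)| +
            C * 𝔼 v, |F' n v z - θ' (pullbackName (S.σ n) v z)|)
            ∂(m n : Measure (S.V n → J)) := by
            refine integral_mono ?_ (((h.integrable_left θ n).const_mul _).add
              ((h'.integrable_left θ' n).const_mul _)) fun z => ?_
            · exact integrable_expect_abs
                (fun v => (hH n v).sub (measurable_comp_pullbackName _ v _))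
                (C := B + ‖Θ θ θ'‖) fun v z => (abs_sub _ _).trans
                (add_le_add (hB n v z) (abs_apply_le_norm _ _))
            · simp only [Finset.mul_expect, ← Finset.expect_add_distrib]
              exact expect_mono fun v => h1 θ θ' n v z
        _ ≤ η := by
            rw [integral_add ((h.integrable_left θ n).const_mul _)
              ((h'.integrable_left θ' n).const_mul _), integral_const_mul, integral_const_mul]
            have := mul_le_mul_of_nonneg_left hn hC.le
            have := mul_le_mul_of_nonneg_left hn' hC.le
            linarith

theorem sub (h : Approximable S m Q F U) (h' : Approximable S m Q F' U') :
    Approximable S m Q (fun n v z => F n v z - F' n v z) (fun x => U x - U' x) := by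
  obtain ⟨B, hB, hB'⟩ := h.bounded
  obtain ⟨D, hD, hD'⟩ := h'.bounded
  refine of_le (fun n v => (h.measurable_left n v).sub (h'.measurable_left n v))
    (h.measurable_right.sub h'.measurable_right) ⟨B + D, fun n v z => ?_, fun x => ?_⟩
    one_pos h h' (fun θ θ' => θ - θ') ?_ ?_
  · exact (abs_sub _ _).trans (add_le_add (hB n v z) (hD n v z))
  · exact (abs_sub _ _).trans (add_le_add (hB' x) (hD' x))
  · intro θ θ' n v z
    simp only [ContinuousMap.sub_apply, one_mul]
    rw [sub_sub_sub_comm]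
    exact abs_sub _ _
  · intro θ θ' x
    simp only [ContinuousMap.sub_apply, one_mul]
    rw [sub_sub_sub_comm]
    exact abs_sub _ _

theorem abs (h : Approximable S m Q F U) :
    Approximable S m Q (fun n v z => |F n v z|) (fun x => |U x|) := by
  obtain ⟨B, hB, hB'⟩ := h.bounded
  refine of_le (fun n v => continuous_abs.measurable.comp (h.measurable_left n v))
    (continuous_abs.measurable.comp h.measurable_right) ⟨B, fun n v z => ?_, fun x => ?_⟩
    one_pos h h (fun θ _ => ⟨fun a => |θ a|, by fun_prop⟩) ?_ ?_
  · rw [abs_abs]; exact hB n v z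
  · rw [abs_abs]; exact hB' x
  · intro θ θ' n v z
    have := abs_nonneg (F n v z - θ' (pullbackName (S.σ n) v z))
    have := abs_abs_sub_abs_le_abs_sub (F n v z) (θ (pullbackName (S.σ n) v z))
    simp only [ContinuousMap.coe_mk]
    linarith
  · intro θ θ' x
    have := abs_nonneg (U x - θ' (Q.name x))
    have := abs_abs_sub_abs_le_abs_sub (U x) (θ (Q.name x))
    simp only [ContinuousMap.coe_mk]
    linarith

/-- Truncation of a function to the interval `[-B, B]`. -/
def truncate {Ω : Type*} [TopologicalSpace Ω] (B : ℝ) (θ : C(Ω, ℝ)) : C(Ω, ℝ) :=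
  ⟨fun a => max (-B) (min (θ a) B), by fun_prop⟩

theorem abs_truncate_le {Ω : Type*} [TopologicalSpace Ω] {B : ℝ} (hB : 0 ≤ B) (θ : C(Ω, ℝ))
    (a : Ω) : |truncate B θ a| ≤ B :=
  abs_le.2 ⟨le_max_left _ _, max_le (by linarith) (min_le_right _ _)⟩

theorem abs_sub_truncate_le {Ω : Type*} [TopologicalSpace Ω] {B t : ℝ} (ht : |t| ≤ B)
    (θ : C(Ω, ℝ)) (a : Ω) : |t - truncate B θ a| ≤ |t - θ a| := by
  have h1 : t = max (-B) (min t B) := by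
    rw [min_eq_left (abs_le.1 ht).2, max_eq_right (abs_le.1 ht).1]
  conv_lhs => rw [h1]
  refine (abs_max_sub_max_le_max _ _ _ _).trans ?_
  rw [sub_self, abs_zero, max_eq_right (abs_nonneg _)]
  refine (abs_min_sub_min_le_max _ _ _ _).trans ?_
  rw [sub_self, abs_zero, max_eq_left (abs_nonneg _)]

theorem abs_mul_sub_mul_le {a b c d B D C : ℝ} (hBC : B ≤ C) (hDC : D ≤ C) (ha : |a| ≤ B)
    (hd : |d| ≤ D) : |a * b - c * d| ≤ C * |a - c| + C * |b - d| := by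
  have : a * b - c * d = d * (a - c) + a * (b - d) := by ring
  rw [this]
  refine (abs_add_le _ _).trans ?_
  rw [abs_mul, abs_mul]
  gcongr
  · exact hd.trans hDC
  · exact ha.trans hBC

theorem mul (h : Approximable S m Q F U) (h' : Approximable S m Q F' U') :
    Approximable S m Q (fun n v z => F n v z * F' n v z) (fun x => U x * U' x) := by
  obtain ⟨x₀⟩ := μ.nonempty
  obtain ⟨B, hB, hB'⟩ := h.bounded
  obtain ⟨D, hD, hD'⟩ := h'.bounded
  have hB0 : 0 ≤ B := (abs_nonneg _).trans (hB' x₀)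
  have hD0 : 0 ≤ D := (abs_nonneg _).trans (hD' x₀)
  refine of_le (fun n v => (h.measurable_left n v).mul (h'.measurable_left n v))
    (h.measurable_right.mul h'.measurable_right) ⟨B * D, fun n v z => ?_, fun x => ?_⟩
    (show 0 < B + D + 1 by positivity) h h' (fun θ θ' => truncate B θ * truncate D θ') ?_ ?_
  · rw [abs_mul]; exact mul_le_mul (hB n v z) (hD n v z) (abs_nonneg _) hB0
  · rw [abs_mul]; exact mul_le_mul (hB' x) (hD' x) (abs_nonneg _) hB0
  · intro θ θ' n v z
    refine (abs_mul_sub_mul_le (C := B + D + 1) (by linarith) (by linarith) (hB n v z)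
      (abs_truncate_le hD0 θ' _)).trans ?_
    have hC : 0 ≤ B + D + 1 := by positivity
    exact add_le_add (mul_le_mul_of_nonneg_left (abs_sub_truncate_le (hB n v z) θ _) hC)
      (mul_le_mul_of_nonneg_left (abs_sub_truncate_le (hD n v z) θ' _) hC)
  · intro θ θ' x
    refine (abs_mul_sub_mul_le (C := B + D + 1) (by linarith) (by linarith) (hB' x)
      (abs_truncate_le hD0 θ' _)).trans ?_
    have hC : 0 ≤ B + D + 1 := by positivity
    exact add_le_add (mul_le_mul_of_nonneg_left (abs_sub_truncate_le (hB' x) θ _) hC)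
      (mul_le_mul_of_nonneg_left (abs_sub_truncate_le (hD' x) θ' _) hC)

omit [Countable G] [MeasurableConstSMul G X] [CompactSpace J] [BorelSpace J] in
theorem const (c : ℝ) : Approximable S m Q (fun _ _ _ => c) (fun _ => c) where
  measurable_left _ _ := measurable_const
  measurable_right := measurable_const
  bounded := ⟨|c|, fun _ _ _ => le_rfl, fun _ => le_rfl⟩
  approx η hη := ⟨ContinuousMap.const _ c, by simpa using hη.le, by simp [hη.le]⟩

theorem add (h : Approximable S m Q F U) (h' : Approximable S m Q F' U') :
    Approximable S m Q (fun n v z => F n v z + F' n v z) (fun x => U x + U' x) := by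
  have := h.sub ((const 0).sub h')
  simpa using this

/-- Uniform limits of approximable functions are approximable. -/
theorem of_uniform_approx (hF : ∀ n v, Measurable (F n v)) (hU : Measurable U)
    (hb : ∃ C, (∀ n v z, |F n v z| ≤ C) ∧ ∀ x, |U x| ≤ C)
    (h : ∀ η > 0, ∃ F' U', Approximable S m Q F' U' ∧ (∀ n v z, |F n v z - F' n v z| ≤ η) ∧
      ∀ x, |U x - U' x| ≤ η) : Approximable S m Q F U where
  measurable_left := hF
  measurable_right := hU
  bounded := hb
  approx := by
    intro η hη
    obtain ⟨F', U', hA, h1, h2⟩ := h (η / 2) (half_pos hη)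
    obtain ⟨θ, hθ, hθn⟩ := hA.approx (η / 2) (half_pos hη)
    obtain ⟨C, hC, hC'⟩ := hb
    refine ⟨θ, ?_, ?_⟩
    · calc _ ≤ ∫ x, (|U' x - θ (Q.name x)| + η / 2) ∂(μ : Measure X) := by
            refine integral_mono ?_ ((hA.integrable_right θ).add (integrable_const _))
              fun x => ?_
            · exact ((integrable_of_abs_le hU hC').sub
                (integrable_of_abs_le (θ.continuous.measurable.comp Q.measurable_name)
                fun x => abs_apply_le_norm _ _)).abs
            · have := abs_sub_le (U x) (U' x) (θ (Q.name x))
              simp only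
              linarith [h2 x]
        _ ≤ η := by
            rw [integral_add (hA.integrable_right θ) (integrable_const _)]
            simp only [integral_const, probReal_univ, one_smul]
            linarith
    · filter_upwards [hθn] with n hn
      calc _ ≤ ∫ z, (𝔼 v, |F' n v z - θ (pullbackName (S.σ n) v z)| + η / 2)
            ∂(m n : Measure (S.V n → J)) := by
            refine integral_mono ?_ ((hA.integrable_left θ n).add (integrable_const _))
              fun z => ?_
            · exact integrable_expect_abs
                (fun v => (hF n v).sub (measurable_comp_pullbackName _ v _))
                (C := C + ‖θ‖) fun v z => (abs_sub _ _).trans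
                (add_le_add (hC n v z) (abs_apply_le_norm _ _))
            · simp only
              rw [← Fintype.expect_const (ι := S.V n) (η / 2), ← Finset.expect_add_distrib]
              refine expect_mono fun v => ?_
              have := abs_sub_le (F n v z) (F' n v z) (θ (pullbackName (S.σ n) v z))
              linarith [h1 n v z]
        _ ≤ η := by
            rw [integral_add (hA.integrable_left θ n) (integrable_const _)]
            simp only [integral_const, probReal_univ, one_smul]
            linarith

/-- Approximability is preserved by moving the vertex with `σ^g`, if the limit is moved with `g`:
this uses the invariance of the system and the asymptotic equivariance of pullback names. -/
theorem shift [SMulInvariantMeasure G X (μ : Measure X)] (h : Approximable S m Q F U) (g : G) :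
    Approximable S m Q (fun n v z => F n (S.σ n g v) z) (fun x => U (g • x)) where
  measurable_left n v := h.measurable_left n _
  measurable_right := h.measurable_right.comp (measurable_const_smul g)
  bounded := by
    obtain ⟨C, hC, hC'⟩ := h.bounded
    exact ⟨C, fun n v z => hC n _ z, fun x => hC' _⟩
  approx := by
    intro η hη
    obtain ⟨θ, hθ, hθn⟩ := h.approx (η / 2) (half_pos hη)
    refine ⟨θ.comp ⟨shiftName g, continuous_shiftName g⟩, ?_, ?_⟩
    · have h1 : ∫ x, |U (g • x) - θ (Q.name (g • x))| ∂(μ : Measure X) =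
          ∫ x, |U x - θ (Q.name x)| ∂(μ : Measure X) := by
        have hm : Measurable fun x => |U x - θ (Q.name x)| :=
          continuous_abs.measurable.comp (h.measurable_right.sub
            (θ.continuous.measurable.comp Q.measurable_name))
        have := integral_map (μ := (μ : Measure X)) (measurable_const_smul g).aemeasurable
          hm.aestronglyMeasurable
        rw [(measurePreserving_smul g (μ : Measure X)).map_eq] at this
        exact this.symm
      simp only [ContinuousMap.comp_apply, ContinuousMap.coe_mk, ← Q.name_smul]
      rw [h1]
      linarith
    · obtain ⟨C, hC, -⟩ := h.bounded
      filter_upwards [hθn, S.eventually_expect_shift_le θ g (half_pos hη)] with n hn hs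
      calc _ ≤ ∫ z, (𝔼 v, |F n v z - θ (pullbackName (S.σ n) v z)| + η / 2)
            ∂(m n : Measure (S.V n → J)) := by
            refine integral_mono ?_ ((h.integrable_left θ n).add (integrable_const _))
              fun z => ?_
            · exact integrable_expect_abs
                (fun v => (h.measurable_left n _).sub (measurable_comp_pullbackName _ v _))
                (C := C + ‖θ.comp ⟨shiftName g, continuous_shiftName g⟩‖)
                fun v z => (abs_sub _ _).trans (add_le_add (hC n _ z) (abs_apply_le_norm _ _))
            · simp only
              refine le_trans ?_ (add_le_add_right (hs z) _)
              rw [← expect_comp_perm (S.σ n g)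
                fun v => |F n v z - θ (pullbackName (S.σ n) v z)|, ← Finset.expect_add_distrib]
              exact expect_mono fun v => abs_sub_le _ _ _
        _ ≤ η := by
            rw [integral_add (h.integrable_left θ n) (integrable_const _)]
            simp only [integral_const, probReal_univ, one_smul]
            linarith

omit [Countable G] [MeasurableConstSMul G X] in
/-- The permutation of the identity of `G` fixes most vertices. -/
theorem withHighProb_one (S : SoficApproximation G) :
    WithHighProb S.V (fun n v => S.σ n 1 v = v) :=
  (S.asymp_mul 1 1).mono fun n v hv => (S.σ n 1).injective (by rw [hv, one_mul])

omit [Countable G] [MeasurableConstSMul G X] in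
/-- The values of the model at the vertices are approximable, with limit the observable of the
process. -/
theorem value (u : C(J, ℝ)) :
    Approximable S m Q (fun _ v z => u (z v)) (fun x => u (Q.φ x)) where
  measurable_left n v := u.continuous.measurable.comp (measurable_pi_apply v)
  measurable_right := u.continuous.measurable.comp Q.measurable_φ
  bounded := ⟨‖u‖, fun n v z => abs_apply_le_norm u _, fun x => abs_apply_le_norm u _⟩
  approx := by
    classical
    intro η hη
    refine ⟨⟨fun a => u (a 1), by fun_prop⟩, ?_, ?_⟩
    · simpa [ProcessModel.name] using hη.le
    · have h1 := (withHighProb_iff.1 (withHighProb_one S)).const_mul (2 * ‖u‖)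
      rw [mul_zero] at h1
      filter_upwards [eventually_le_of_tendsto_zero h1 hη] with n hn
      refine (le_abs_self _).trans (abs_integral_le_const fun z => ?_)
      rw [abs_of_nonneg (expect_nonneg' fun v => abs_nonneg _)]
      rw [Finset.mul_expect] at hn
      refine le_trans (expect_mono fun v => ?_) hn
      simp only [ContinuousMap.coe_mk, pullbackName]
      split_ifs with hv
      · rw [hv]; simp
      · rw [mul_one, two_mul]
        exact (abs_sub _ _).trans (add_le_add (abs_apply_le_norm u _) (abs_apply_le_norm u _))

/-- Approximable functions have, locally and on average, the integrals of their limits. -/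
theorem tendsto_expect_abs (h : Approximable S m Q F U) (hm : ∀ f, S.LocalMean m Q.law f) :
    Tendsto (fun n => 𝔼 v, |∫ z, F n v z ∂(m n : Measure (S.V n → J)) -
      ∫ x, U x ∂(μ : Measure X)|) atTop (𝓝 0) := by
  refine tendsto_zero_of_eventually_le (fun n => expect_nonneg' fun v => abs_nonneg _) ?_
  intro η hη
  obtain ⟨θ, hθ, hθn⟩ := h.approx (η / 3) (by positivity)
  obtain ⟨C, hC, hC'⟩ := h.bounded
  have hUi := integrable_of_abs_le (μ := (μ : Measure X)) h.measurable_right hC'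
  have hθi : Integrable (fun x => θ (Q.name x)) (μ : Measure X) :=
    integrable_of_abs_le (θ.continuous.measurable.comp Q.measurable_name)
      fun x => abs_apply_le_norm _ _
  have hU : |∫ x, θ (Q.name x) ∂(μ : Measure X) - ∫ x, U x ∂(μ : Measure X)| ≤ η / 3 := by
    rw [abs_sub_comm, ← integral_sub hUi hθi]
    exact abs_integral_le_integral_abs.trans hθ
  filter_upwards [hθn, eventually_le_of_tendsto_zero (hm θ) (show 0 < η / 3 by positivity)]
    with n hn h1
  have hFi : ∀ v, Integrable (F n v) (m n : Measure (S.V n → J)) := fun v =>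
    integrable_of_abs_le (h.measurable_left n v) (hC n v)
  have hti := fun v => SoficApproximation.integrable_comp_pullbackName (m := m) n v θ
  rw [Q.integral_law θ.continuous.measurable] at h1
  rw [integral_expect (f := fun v z => |F n v z - θ (pullbackName (S.σ n) v z)|)
    fun v => ((hFi v).sub (hti v)).abs] at hn
  calc _ ≤ 𝔼 v, (∫ z, |F n v z - θ (pullbackName (S.σ n) v z)| ∂(m n : Measure (S.V n → J)) +
        |∫ z, θ (pullbackName (S.σ n) v z) ∂(m n : Measure (S.V n → J)) -
          ∫ x, θ (Q.name x) ∂(μ : Measure X)| + η / 3) := by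
        refine expect_mono fun v => ?_
        have h2 : |∫ z, F n v z ∂(m n : Measure (S.V n → J)) -
            ∫ z, θ (pullbackName (S.σ n) v z) ∂(m n : Measure (S.V n → J))| ≤
            ∫ z, |F n v z - θ (pullbackName (S.σ n) v z)| ∂(m n : Measure (S.V n → J)) := by
          rw [← integral_sub (hFi v) (hti v)]
          exact abs_integral_le_integral_abs
        have h3 := abs_sub_le (∫ z, F n v z ∂(m n : Measure (S.V n → J)))
          (∫ z, θ (pullbackName (S.σ n) v z) ∂(m n : Measure (S.V n → J)))
          (∫ x, U x ∂(μ : Measure X))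
        have h4 := abs_sub_le (∫ z, θ (pullbackName (S.σ n) v z) ∂(m n : Measure (S.V n → J)))
          (∫ x, θ (Q.name x) ∂(μ : Measure X)) (∫ x, U x ∂(μ : Measure X))
        linarith
    _ ≤ η := by
        rw [Finset.expect_add_distrib, Finset.expect_add_distrib, Fintype.expect_const]
        linarith

/-- Averages of approximable functions have mean converging to the integral of the limit. -/
theorem tendsto_integral_expect (h : Approximable S m Q F U)
    (hm : ∀ f, S.LocalMean m Q.law f) :
    Tendsto (fun n => ∫ z, 𝔼 v, F n v z ∂(m n : Measure (S.V n → J))) atTop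
      (𝓝 (∫ x, U x ∂(μ : Measure X))) := by
  obtain ⟨C, hC, -⟩ := h.bounded
  rw [tendsto_iff_dist_tendsto_zero]
  refine squeeze_zero (fun n => dist_nonneg) (fun n => ?_) (h.tendsto_expect_abs hm)
  rw [Real.dist_eq, integral_expect fun v =>
    integrable_of_abs_le (h.measurable_left n v) (hC n v)]
  refine le_trans (le_of_eq ?_) (abs_expect_le _)
  rw [Finset.expect_sub_distrib, Fintype.expect_const]

/-- Averages of approximable functions converge in mean to the integral of the limit. -/
theorem tendsto_integral_abs (h : Approximable S m Q F U)
    (hm : ∀ f, S.EmpiricalMean m Q.law f) :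
    Tendsto (fun n => ∫ z, |𝔼 v, F n v z - ∫ x, U x ∂(μ : Measure X)|
      ∂(m n : Measure (S.V n → J))) atTop (𝓝 0) := by
  refine tendsto_zero_of_eventually_le (fun n => integral_nonneg fun v => abs_nonneg _) ?_
  intro η hη
  obtain ⟨θ, hθ, hθn⟩ := h.approx (η / 3) (by positivity)
  obtain ⟨C, hC, hC'⟩ := h.bounded
  have hUi := integrable_of_abs_le (μ := (μ : Measure X)) h.measurable_right hC'
  have hθi : Integrable (fun x => θ (Q.name x)) (μ : Measure X) :=
    integrable_of_abs_le (θ.continuous.measurable.comp Q.measurable_name)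
      fun x => abs_apply_le_norm _ _
  have hU : |∫ x, θ (Q.name x) ∂(μ : Measure X) - ∫ x, U x ∂(μ : Measure X)| ≤ η / 3 := by
    rw [abs_sub_comm, ← integral_sub hUi hθi]
    exact abs_integral_le_integral_abs.trans hθ
  filter_upwards [hθn, eventually_le_of_tendsto_zero (hm θ) (show 0 < η / 3 by positivity)]
    with n hn h1
  have hei := SoficApproximation.integrable_empiricalError (m := m) n θ
    (∫ x, θ (Q.name x) ∂(μ : Measure X))
  rw [Q.integral_law θ.continuous.measurable] at h1
  have hsum := (h.integrable_left θ n).add hei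
  calc _ ≤ ∫ z, (𝔼 v, |F n v z - θ (pullbackName (S.σ n) v z)| +
        |𝔼 v, θ (pullbackName (S.σ n) v z) - ∫ x, θ (Q.name x) ∂(μ : Measure X)| + η / 3)
        ∂(m n : Measure (S.V n → J)) := by
        refine integral_mono ?_ (hsum.add (integrable_const _)) fun z => ?_
        · exact ((integrable_of_abs_le (measurable_expect fun v => h.measurable_left n v)
            fun z => abs_expect_le_const fun v => hC n v z).sub (integrable_const _)).abs
        · have h2 : |𝔼 v, F n v z - 𝔼 v, θ (pullbackName (S.σ n) v z)| ≤
              𝔼 v, |F n v z - θ (pullbackName (S.σ n) v z)| := by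
            rw [← Finset.expect_sub_distrib]
            exact abs_expect_le _
          have h3 := abs_sub_le (𝔼 v, F n v z) (𝔼 v, θ (pullbackName (S.σ n) v z))
            (∫ x, U x ∂(μ : Measure X))
          have h4 := abs_sub_le (𝔼 v, θ (pullbackName (S.σ n) v z))
            (∫ x, θ (Q.name x) ∂(μ : Measure X)) (∫ x, U x ∂(μ : Measure X))
          simp only
          linarith
    _ ≤ η := by
        rw [integral_add (f := fun z => 𝔼 v, |F n v z - θ (pullbackName (S.σ n) v z)| +
            |𝔼 v, θ (pullbackName (S.σ n) v z) - ∫ x, θ (Q.name x) ∂(μ : Measure X)|)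
            hsum (integrable_const _),
          integral_add (h.integrable_left θ n) hei]
        simp only [integral_const, probReal_univ, one_smul]
        linarith

end Approximable

end Approximable

/-! ### Joinings and products of process models -/

section Pair

variable {G : Type*} [Group G] {X Y : Type*} [MeasurableSpace X] [MeasurableSpace Y]
  [MulAction G X] [MulAction G Y] {μ : ProbabilityMeasure X} {ν : ProbabilityMeasure Y}
  {K L : Type*} [MeasurableSpace K] [MeasurableSpace L]

/-- The process model of a joining which observes both factors. -/
def ProcessModel.pair (M : ProcessModel G μ K) (N : ProcessModel G ν L)
    {l : ProbabilityMeasure (X × Y)} (hl : IsJoining G μ ν l) : ProcessModel G l (K × L) where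
  φ p := (M.φ p.1, N.φ p.2)
  measurable_φ := (M.measurable_φ.comp measurable_fst).prodMk (N.measurable_φ.comp measurable_snd)
  injOn_conull := by
    obtain ⟨A, hA, hA0, hAi⟩ := M.injOn_conull
    obtain ⟨B, hB, hB0, hBi⟩ := N.injOn_conull
    refine ⟨A ×ˢ B, hA.prod hB, ?_, ?_⟩
    · have h1 : (l : Measure (X × Y)) (Prod.fst ⁻¹' Aᶜ) = 0 := by
        rw [← Measure.map_apply measurable_fst hA.compl, hl.map_fst, hA0]
      have h2 : (l : Measure (X × Y)) (Prod.snd ⁻¹' Bᶜ) = 0 := by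
        rw [← Measure.map_apply measurable_snd hB.compl, hl.map_snd, hB0]
      refine measure_mono_null ?_ (measure_union_null h1 h2)
      rintro ⟨x, y⟩ hxy
      by_contra h
      simp only [Set.mem_union, Set.mem_preimage, Set.mem_compl_iff, not_or, not_not] at h
      exact hxy ⟨h.1, h.2⟩
    · rintro ⟨x, y⟩ hx ⟨x', y'⟩ hx' h
      refine Prod.ext (hAi hx.1 hx'.1 ?_) (hBi hx.2 hx'.2 ?_)
      · ext g
        exact congrArg Prod.fst (congrFun h g)
      · ext g
        exact congrArg Prod.snd (congrFun h g)

theorem isJoining_prod [MeasurableConstSMul G X] [MeasurableConstSMul G Y]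
    (μ : ProbabilityMeasure X) (ν : ProbabilityMeasure Y)
    [SMulInvariantMeasure G X (μ : Measure X)] [SMulInvariantMeasure G Y (ν : Measure Y)] :
    IsJoining G μ ν (μ.prod ν) where
  invariant := by
    rw [ProbabilityMeasure.toMeasure_prod]
    exact smulInvariantMeasure_prod _ _
  map_fst := by
    rw [ProbabilityMeasure.toMeasure_prod, Measure.map_fst_prod]; simp
  map_snd := by
    rw [ProbabilityMeasure.toMeasure_prod, Measure.map_snd_prod]; simp

variable [MeasurableConstSMul G X] [MeasurableConstSMul G Y]

theorem ProcessModel.law_pair_prod (M : ProcessModel G μ K) (N : ProcessModel G ν L)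
    (h : IsJoining G μ ν (μ.prod ν)) : (M.pair N h).law = prodLaw M.law N.law := by
  refine Subtype.ext ?_
  simp only [ProbabilityMeasure.val_eq_to_measure]
  rw [toMeasure_law, toMeasure_prodLaw, toMeasure_law, toMeasure_law,
    Measure.map_prod_map _ _ M.measurable_name N.measurable_name,
    Measure.map_map measurable_zipModels
      (M.measurable_name.prodMap N.measurable_name),
    ProbabilityMeasure.toMeasure_prod]
  rfl

theorem ProcessModel.map_law_pair_fst (M : ProcessModel G μ K) (N : ProcessModel G ν L)
    {l : ProbabilityMeasure (X × Y)} (h : IsJoining G μ ν l) :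
    (M.pair N h).law.map (f := fun a g => (a g).1)
      (measurable_postcomp measurable_fst).aemeasurable = M.law := by
  refine Subtype.ext ?_
  simp only [ProbabilityMeasure.val_eq_to_measure]
  rw [ProbabilityMeasure.toMeasure_map, toMeasure_law, toMeasure_law,
    Measure.map_map (measurable_postcomp measurable_fst) (M.pair N h).measurable_name,
    ← h.map_fst, Measure.map_map M.measurable_name measurable_fst]
  rfl

theorem ProcessModel.map_law_pair_snd (M : ProcessModel G μ K) (N : ProcessModel G ν L)
    {l : ProbabilityMeasure (X × Y)} (h : IsJoining G μ ν l) :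
    (M.pair N h).law.map (f := fun a g => (a g).2)
      (measurable_postcomp measurable_snd).aemeasurable = N.law := by
  refine Subtype.ext ?_
  simp only [ProbabilityMeasure.val_eq_to_measure]
  rw [ProbabilityMeasure.toMeasure_map, toMeasure_law, toMeasure_law,
    Measure.map_map (measurable_postcomp measurable_snd) (M.pair N h).measurable_name,
    ← h.map_snd, Measure.map_map N.measurable_name measurable_snd]
  rfl

end Pair

/-! ### Recoding of models -/

section Coding

variable {G : Type*} [Group G] [Countable G] {X : Type*} [MeasurableSpace X]
  [MulAction G X] [MeasurableConstSMul G X] {μ : ProbabilityMeasure X}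
  {J : Type*} [MetricSpace J] [CompactSpace J] [MeasurableSpace J] [BorelSpace J]
  {K : Type*} [MetricSpace K] [CompactSpace K] [MeasurableSpace K] [BorelSpace K]
  {S : SoficApproximation G} {m : ∀ n, ProbabilityMeasure (S.V n → J)}

/-- Approximability of all continuous functions of a quantity follows from that of a family which
separates points, by the Stone–Weierstrass theorem. -/
theorem Approximable.comp_of_separates {Q : ProcessModel G μ J} {Z : Type*} [TopologicalSpace Z]
    [CompactSpace Z] [MeasurableSpace Z] [OpensMeasurableSpace Z]
    {F : ∀ n, S.V n → (S.V n → J) → Z} {U : X → Z} (hF : ∀ n v, Measurable (F n v))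
    (hU : Measurable U) (T : Set C(Z, ℝ)) (hT : ∀ a b, a ≠ b → ∃ u ∈ T, u a ≠ u b)
    (h : ∀ u ∈ T, Approximable S m Q (fun n v z => u (F n v z)) (fun x => u (U x)))
    (u : C(Z, ℝ)) : Approximable S m Q (fun n v z => u (F n v z)) (fun x => u (U x)) := by
  set A : Subalgebra ℝ C(Z, ℝ) :=
    { carrier := {u | Approximable S m Q (fun n v z => u (F n v z)) (fun x => u (U x))}
      mul_mem' := fun h h' => Approximable.mul h h'
      add_mem' := fun h h' => Approximable.add h h'
      algebraMap_mem' := fun c => Approximable.const c } with hA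
  have hsep : A.SeparatesPoints := by
    intro a b hab
    obtain ⟨u, hu, hne⟩ := hT a b hab
    exact ⟨u, ⟨u, h u hu, rfl⟩, hne⟩
  have hdense := ContinuousMap.subalgebra_topologicalClosure_eq_top_of_separatesPoints A hsep
  have hu : u ∈ closure (A : Set C(Z, ℝ)) := by
    rw [← Subalgebra.topologicalClosure_coe, hdense]; trivial
  refine Approximable.of_uniform_approx (fun n v => u.continuous.measurable.comp (hF n v))
    (u.continuous.measurable.comp hU)
    ⟨‖u‖, fun n v z => abs_apply_le_norm u _, fun x => abs_apply_le_norm u _⟩ fun η hη => ?_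
  obtain ⟨w, hw, huw⟩ := Metric.mem_closure_iff.1 hu η hη
  rw [dist_eq_norm] at huw
  exact ⟨_, _, hw, fun n v z => (abs_apply_sub_le_norm u w _).trans huw.le,
    fun x => (abs_apply_sub_le_norm u w _).trans huw.le⟩

/-- The maps `ψ n` recode models of the process of `Q` as models of the process of `R`: all
continuous functions of the letters of the new models are approximable. -/
structure IsCoding (S : SoficApproximation G) (m : ∀ n, ProbabilityMeasure (S.V n → J))
    (Q : ProcessModel G μ J) (R : ProcessModel G μ K)
    (ψ : ∀ n, (S.V n → J) → (S.V n → K)) : Prop where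
  measurable : ∀ n, Measurable (ψ n)
  approximable : ∀ u : C(K, ℝ),
    Approximable S m Q (fun n v z => u (ψ n z v)) (fun x => u (R.φ x))

namespace IsCoding

variable {Q : ProcessModel G μ J} {R : ProcessModel G μ K}
  {ψ : ∀ n, (S.V n → J) → (S.V n → K)}

/-- Continuous functions of the pullback names of recoded models are approximable. -/
theorem approximable_name [SMulInvariantMeasure G X (μ : Measure X)]
    (h : IsCoding S m Q R ψ) (f : C(G → K, ℝ)) :
    Approximable S m Q (fun n v z => f (pullbackName (S.σ n) v (ψ n z)))
      (fun x => f (R.name x)) := by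
  refine Approximable.comp_of_separates
    (fun n v => (measurable_pullbackName _ v).comp (h.measurable n)) R.measurable_name
    {f | ∃ (u : C(K, ℝ)) (g : G), f = ⟨fun a => u (a g), by fun_prop⟩} ?_ ?_ f
  · intro a b hab
    obtain ⟨g, hg⟩ := Function.ne_iff.1 hab
    refine ⟨_, ⟨⟨fun k => dist k (b g), by fun_prop⟩, g, rfl⟩, ?_⟩
    simpa using hg
  · rintro _ ⟨u, g, rfl⟩
    exact (h.approximable u).shift g

variable [SMulInvariantMeasure G X (μ : Measure X)]

theorem quenchedConv (h : IsCoding S m Q R ψ) (hm : S.QuenchedConv m Q.law) :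
    S.QuenchedConv (fun n => (m n).map (h.measurable n).aemeasurable) R.law := by
  rw [SoficApproximation.quenchedConv_iff]
  refine ⟨fun f => ?_, fun f => ?_⟩
  · have h1 := (h.approximable_name f).tendsto_expect_abs hm.localMean
    unfold SoficApproximation.LocalMean
    rw [R.integral_law f.continuous.measurable]
    refine h1.congr fun n => Finset.expect_congr rfl fun v _ => ?_
    rw [ProbabilityMeasure.toMeasure_map, integral_map (h.measurable n).aemeasurable
      (measurable_comp_pullbackName _ _ f).aestronglyMeasurable]
  · have h1 := (h.approximable_name f).tendsto_integral_abs hm.empiricalMean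
    unfold SoficApproximation.EmpiricalMean
    rw [R.integral_law f.continuous.measurable]
    refine h1.congr fun n => ?_
    rw [ProbabilityMeasure.toMeasure_map, integral_map (h.measurable n).aemeasurable
      (measurable_empiricalError _ f _).aestronglyMeasurable]

end IsCoding

section Square

variable {Q : ProcessModel G μ J} {R : ProcessModel G μ K}
  {ψ : ∀ n, (S.V n → J) → (S.V n → K)}

omit [MeasurableConstSMul G X] in
theorem Approximable.comp_fst {F : ∀ n, S.V n → (S.V n → J) → ℝ} {U : X → ℝ}
    (h : Approximable S m Q F U) (hl : IsJoining G μ μ (μ.prod μ)) :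
    Approximable S (fun n => prodLaw (m n) (m n)) (Q.pair Q hl)
      (fun n v z => F n v (fun w => (z w).1)) (fun p => U p.1) where
  measurable_left n v := (h.measurable_left n v).comp (measurable_postcomp measurable_fst)
  measurable_right := h.measurable_right.comp measurable_fst
  bounded := by
    obtain ⟨C, hC, hC'⟩ := h.bounded
    exact ⟨C, fun n v z => hC n v _, fun x => hC' _⟩
  approx := by
    intro η hη
    obtain ⟨θ, hθ, hθn⟩ := h.approx η hη
    refine ⟨⟨fun a => θ fun g => (a g).1, by fun_prop⟩, ?_, ?_⟩
    · rw [ProbabilityMeasure.toMeasure_prod]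
      refine le_trans (le_of_eq ?_) hθ
      exact (integral_fun_fst (μ := (μ : Measure X)) (ν := (μ : Measure X))
        (fun x => |U x - θ (Q.name x)|)).trans (by simp)
    · filter_upwards [hθn] with n hn
      refine le_trans (le_of_eq ?_) hn
      rw [integral_prodLaw]
      · exact (integral_fun_fst (μ := (m n : Measure (S.V n → J)))
          (ν := (m n : Measure (S.V n → J)))
          (fun z => 𝔼 v, |F n v z - θ (pullbackName (S.σ n) v z)|)).trans (by simp)
      · exact measurable_expect fun v => continuous_abs.measurable.comp
          (((h.measurable_left n v).comp (measurable_postcomp measurable_fst)).sub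
            (measurable_comp_pullbackName _ v
              (⟨fun a => θ fun g => (a g).1, by fun_prop⟩ : C(G → J × J, ℝ))))

omit [MeasurableConstSMul G X] in
theorem Approximable.comp_snd {F : ∀ n, S.V n → (S.V n → J) → ℝ} {U : X → ℝ}
    (h : Approximable S m Q F U) (hl : IsJoining G μ μ (μ.prod μ)) :
    Approximable S (fun n => prodLaw (m n) (m n)) (Q.pair Q hl)
      (fun n v z => F n v (fun w => (z w).2)) (fun p => U p.2) where
  measurable_left n v := (h.measurable_left n v).comp (measurable_postcomp measurable_snd)
  measurable_right := h.measurable_right.comp measurable_snd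
  bounded := by
    obtain ⟨C, hC, hC'⟩ := h.bounded
    exact ⟨C, fun n v z => hC n v _, fun x => hC' _⟩
  approx := by
    intro η hη
    obtain ⟨θ, hθ, hθn⟩ := h.approx η hη
    refine ⟨⟨fun a => θ fun g => (a g).2, by fun_prop⟩, ?_, ?_⟩
    · rw [ProbabilityMeasure.toMeasure_prod]
      refine le_trans (le_of_eq ?_) hθ
      exact (integral_fun_snd (μ := (μ : Measure X)) (ν := (μ : Measure X))
        (fun x => |U x - θ (Q.name x)|)).trans (by simp)
    · filter_upwards [hθn] with n hn
      refine le_trans (le_of_eq ?_) hn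
      rw [integral_prodLaw]
      · exact (integral_fun_snd (μ := (m n : Measure (S.V n → J)))
          (ν := (m n : Measure (S.V n → J)))
          (fun z => 𝔼 v, |F n v z - θ (pullbackName (S.σ n) v z)|)).trans (by simp)
      · exact measurable_expect fun v => continuous_abs.measurable.comp
          (((h.measurable_left n v).comp (measurable_postcomp measurable_snd)).sub
            (measurable_comp_pullbackName _ v
              (⟨fun a => θ fun g => (a g).2, by fun_prop⟩ : C(G → J × J, ℝ))))

/-- Recodings apply to pairs of models. -/
theorem IsCoding.square (h : IsCoding S m Q R ψ) (hl : IsJoining G μ μ (μ.prod μ)) :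
    IsCoding S (fun n => prodLaw (m n) (m n)) (Q.pair Q hl) (R.pair R hl)
      (fun n z v => (ψ n (fun w => (z w).1) v, ψ n (fun w => (z w).2) v)) where
  measurable n := measurable_pi_lambda _ fun v =>
    ((measurable_pi_apply v).comp ((h.measurable n).comp (measurable_postcomp
      measurable_fst))).prodMk ((measurable_pi_apply v).comp ((h.measurable n).comp
        (measurable_postcomp measurable_snd)))
  approximable := by
    refine Approximable.comp_of_separates (fun n v => ?_) ?_
      ({u | ∃ w : C(K, ℝ), u = ⟨fun k => w k.1, by fun_prop⟩} ∪
        {u | ∃ w : C(K, ℝ), u = ⟨fun k => w k.2, by fun_prop⟩}) ?_ ?_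
    · exact ((measurable_pi_apply v).comp ((h.measurable n).comp (measurable_postcomp
        measurable_fst))).prodMk ((measurable_pi_apply v).comp ((h.measurable n).comp
        (measurable_postcomp measurable_snd)))
    · exact (R.pair R hl).measurable_φ
    · intro a b hab
      have hi' : a.1 ≠ b.1 ∨ a.2 ≠ b.2 := by
        by_contra! h
        exact hab (Prod.ext h.1 h.2)
      rcases hi' with h | h
      · exact ⟨_, Or.inl ⟨⟨fun k => dist k b.1, by fun_prop⟩, rfl⟩, by simpa using h⟩
      · exact ⟨_, Or.inr ⟨⟨fun k => dist k b.2, by fun_prop⟩, rfl⟩, by simpa using h⟩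
    · rintro u (⟨w, rfl⟩ | ⟨w, rfl⟩)
      · exact (h.approximable w).comp_fst hl
      · exact (h.approximable w).comp_snd hl

theorem IsCoding.doublyQuenchedConv [SMulInvariantMeasure G X (μ : Measure X)]
    (h : IsCoding S m Q R ψ) (hm : S.DoublyQuenchedConv m Q.law) :
    S.DoublyQuenchedConv (fun n => (m n).map (h.measurable n).aemeasurable) R.law := by
  have hl := isJoining_prod (G := G) μ μ
  have := hl.invariant
  have h1 := h.square hl
  have hm' : S.QuenchedConv (fun n => prodLaw (m n) (m n)) (Q.pair Q hl).law := by
    rw [ProcessModel.law_pair_prod]; exact hm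
  have h2 := h1.quenchedConv hm'
  rw [ProcessModel.law_pair_prod] at h2
  have h3 : ∀ n, (prodLaw (m n) (m n)).map (h1.measurable n).aemeasurable =
      prodLaw ((m n).map (h.measurable n).aemeasurable)
        ((m n).map (h.measurable n).aemeasurable) := by
    intro n
    refine Subtype.ext ?_
    simp only [ProbabilityMeasure.val_eq_to_measure]
    rw [ProbabilityMeasure.toMeasure_map, toMeasure_prodLaw, toMeasure_prodLaw,
      ProbabilityMeasure.toMeasure_map, Measure.map_map (h1.measurable n) measurable_zipModels,
      Measure.map_prod_map _ _ (h.measurable n) (h.measurable n),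
      Measure.map_map measurable_zipModels
        ((h.measurable n).prodMap (h.measurable n))]
    rfl
  simp only [h3] at h2
  exact h2

end Square

omit [BorelSpace K] in
/-- A measurable selection: `ψ a` is a letter whose distances from the first `s` points of a dense
sequence are close to `θ j a`, up to an error controlled by the continuous function `γ a`, which
is at most the error for any other letter. -/
theorem exists_measurable_selection {Ω : Type*} [TopologicalSpace Ω] [MeasurableSpace Ω]
    [OpensMeasurableSpace Ω] [Nonempty K] (θ : ℕ → C(Ω, ℝ)) (s : ℕ) {η : ℝ} (hη : 0 < η) :
    ∃ (γ : C(Ω, ℝ)) (ψ : Ω → K), Measurable ψ ∧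
      (∀ a k, γ a ≤ ∑ j ∈ Finset.range s, |dist k (TopologicalSpace.denseSeq K j) - θ j a|) ∧
      ∀ a, ∀ j < s, |dist (ψ a) (TopologicalSpace.denseSeq K j) - θ j a| ≤ γ a + η := by
  classical
  set H : Ω → K → ℝ := fun a k =>
    ∑ j ∈ Finset.range s, |dist k (TopologicalSpace.denseSeq K j) - θ j a| with hH
  have hHc : Continuous ↿H := by
    simp only [hH, Function.HasUncurry.uncurry, id]
    fun_prop
  have hbdd : ∀ a, BddBelow (H a '' Set.univ) := fun a => ⟨0, by
    rintro _ ⟨k, -, rfl⟩; exact Finset.sum_nonneg fun j _ => abs_nonneg _⟩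
  set γ : C(Ω, ℝ) := ⟨fun a => sInf (H a '' Set.univ), isCompact_univ.continuous_sInf hHc⟩
    with hγ
  have hex : ∀ a, ∃ i, H a (TopologicalSpace.denseSeq K i) < γ a + η := by
    intro a
    obtain ⟨_, ⟨k, -, rfl⟩, hk⟩ := exists_lt_of_csInf_lt (Set.univ_nonempty.image (H a))
      (show sInf (H a '' Set.univ) < γ a + η from lt_add_of_pos_right _ hη)
    have hopen : IsOpen {k | H a k < γ a + η} :=
      isOpen_lt (hHc.comp (Continuous.prodMk_right a)) continuous_const
    obtain ⟨i, hi⟩ := (TopologicalSpace.denseRange_denseSeq K).exists_mem_open hopen ⟨k, hk⟩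
    exact ⟨i, hi⟩
  refine ⟨γ, fun a => TopologicalSpace.denseSeq K (Nat.find (hex a)), ?_, ?_, ?_⟩
  · refine (measurable_from_nat).comp (measurable_find hex fun i => ?_)
    exact (isOpen_lt (hHc.comp (Continuous.prodMk_left _))
      (γ.continuous.add continuous_const)).measurableSet
  · intro a k
    exact csInf_le (hbdd a) ⟨k, trivial, rfl⟩
  · intro a j hj
    refine le_trans ?_ (Nat.find_spec (hex a)).le
    exact Finset.single_le_sum (f := fun j => |dist (TopologicalSpace.denseSeq K
      (Nat.find (hex a))) (TopologicalSpace.denseSeq K j) - θ j a|)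
      (fun j _ => abs_nonneg _) (Finset.mem_range.2 hj)

/-- A diagonal sequence. -/
theorem exists_tendsto_atTop_of_forall_eventually {p : ℕ → ℕ → Prop}
    (h : ∀ s, ∀ᶠ n in atTop, p s n) :
    ∃ s : ℕ → ℕ, Tendsto s atTop atTop ∧ ∀ᶠ n in atTop, p (s n) n := by
  choose N hN using fun s => eventually_atTop.1 (h s)
  refine ⟨fun n => Nat.findGreatest (fun s => N s ≤ n) n, ?_, ?_⟩
  · refine tendsto_atTop.2 fun k => ?_
    filter_upwards [eventually_ge_atTop (max k (N k))] with n hn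
    exact Nat.le_findGreatest ((le_max_left _ _).trans hn) ((le_max_right _ _).trans hn)
  · filter_upwards [eventually_ge_atTop (N 0)] with n hn
    exact hN _ _ (Nat.findGreatest_spec (P := fun s => N s ≤ n) (Nat.zero_le n) hn)

/-- Any sequence of models for a generating process of a system can be recoded as a sequence of
models for any other process on the system. -/
theorem exists_isCoding [StandardBorelSpace X] (Q : ProcessModel G μ J) (R : ProcessModel G μ K)
    (hm : ∀ f, S.LocalMean m Q.law f) : ∃ ψ, IsCoding S m Q R ψ := by
  obtain ⟨x₀⟩ := μ.nonempty
  have : Nonempty K := ⟨R.φ x₀⟩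
  set w : ℕ → C(K, ℝ) := fun j => ⟨fun k => dist k (TopologicalSpace.denseSeq K j), by fun_prop⟩
    with hw
  have hpos : ∀ s : ℕ, (0 : ℝ) < 1 / ((s : ℝ) + 1) := fun s => by positivity
  -- approximations of the distances of the letter under `R` from the points of a dense sequence
  have hθ : ∀ j s : ℕ, ∃ θ : C(G → J, ℝ), ∫ x, |w j (R.φ x) - θ (Q.name x)| ∂(μ : Measure X) ≤
      (1 / ((s : ℝ) + 1)) ^ 2 := fun j s =>
    Q.exists_continuous_integral_sub_le ((w j).continuous.measurable.comp R.measurable_φ)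
      (fun x => abs_apply_le_norm (w j) _) (by positivity)
  choose θ hθ using hθ
  -- `ψ s` chooses a letter by its distances from the first `s` points; its error is controlled by
  -- `γ s`, which has small mean since the letter under `R` is one of the candidates
  choose γ ψ hψ hγ hψγ using fun s : ℕ =>
    exists_measurable_selection (K := K) (fun j => θ j s) s (hpos s)
  have hi : ∀ j s, Integrable (fun x => |w j (R.φ x) - θ j s (Q.name x)|) (μ : Measure X) :=
    fun j s => ((integrable_of_abs_le ((w j).continuous.measurable.comp R.measurable_φ)
      fun x => abs_apply_le_norm (w j) _).sub (integrable_of_abs_le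
      ((θ j s).continuous.measurable.comp Q.measurable_name)
      fun x => abs_apply_le_norm (θ j s) _)).abs
  have hγi : ∀ s, ∫ a, γ s a ∂(Q.law : Measure (G → J)) ≤ 1 / ((s : ℝ) + 1) := by
    intro s
    rw [Q.integral_law (γ s).continuous.measurable]
    calc _ ≤ ∫ x, ∑ j ∈ Finset.range s, |w j (R.φ x) - θ j s (Q.name x)| ∂(μ : Measure X) :=
          integral_mono (integrable_of_abs_le ((γ s).continuous.measurable.comp
            Q.measurable_name) fun x => abs_apply_le_norm (γ s) _)
            (integrable_finsetSum _ fun j _ => hi j s) fun x => hγ s _ _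
      _ ≤ ∑ j ∈ Finset.range s, (1 / ((s : ℝ) + 1)) ^ 2 := by
          rw [integral_finsetSum _ fun j _ => hi j s]
          exact Finset.sum_le_sum fun j _ => hθ j s
      _ ≤ 1 / ((s : ℝ) + 1) := by
          rw [Finset.sum_const, Finset.card_range, nsmul_eq_mul, sq, ← mul_assoc]
          refine mul_le_of_le_one_left (hpos s).le ?_
          rw [mul_one_div, div_le_one (by positivity)]
          linarith
  have hθθ : ∀ j s t, ∫ a, |θ j s a - θ j t a| ∂(Q.law : Measure (G → J)) ≤
      (1 / ((s : ℝ) + 1)) ^ 2 + (1 / ((t : ℝ) + 1)) ^ 2 := by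
    intro j s t
    have hmeas : Measurable fun a => |θ j s a - θ j t a| :=
      continuous_abs.measurable.comp (θ j s - θ j t).continuous.measurable
    rw [Q.integral_law hmeas]
    calc _ ≤ ∫ x, (|w j (R.φ x) - θ j s (Q.name x)| + |w j (R.φ x) - θ j t (Q.name x)|)
          ∂(μ : Measure X) := by
          refine integral_mono (integrable_of_abs_le (hmeas.comp Q.measurable_name)
            (C := ‖θ j s - θ j t‖) fun x => ?_) ((hi j s).add (hi j t)) fun x => ?_
          · simp only [abs_abs]
            exact abs_apply_sub_le_norm _ _ _
          · have := abs_sub_le (θ j s (Q.name x)) (w j (R.φ x)) (θ j t (Q.name x))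
            rwa [abs_sub_comm (θ j s (Q.name x)) (w j (R.φ x))] at this
      _ ≤ _ := by
          rw [integral_add (hi j s) (hi j t)]
          exact add_le_add (hθ j s) (hθ j t)
  set dθ : ℕ → ℕ → ℕ → C(G → J, ℝ) := fun j s t => ⟨fun a => |θ j s a - θ j t a|, by fun_prop⟩
    with hdθ
  -- for models of index `n` the map `ψ (s n)` is used, where `s n → ∞` slowly enough
  obtain ⟨s, hs, hsp⟩ := exists_tendsto_atTop_of_forall_eventually
    (p := fun s n =>
      (∫ z, 𝔼 v, γ s (pullbackName (S.σ n) v z) ∂(m n : Measure (S.V n → J)) ≤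
        1 / ((s : ℝ) + 1) + 1 / ((s : ℝ) + 1)) ∧
      ∀ t ∈ Finset.range (s + 1), ∀ j ∈ Finset.range (s + 1),
        ∫ z, 𝔼 v, dθ j s t (pullbackName (S.σ n) v z) ∂(m n : Measure (S.V n → J)) ≤
        (1 / ((s : ℝ) + 1)) ^ 2 + (1 / ((t : ℝ) + 1)) ^ 2 + 1 / ((s : ℝ) + 1)) <| by
      intro s
      refine Filter.Eventually.and ?_ ?_
      · filter_upwards [eventually_le_add_of_tendsto (hm (γ s)).tendsto_integral_expect (hpos s)]
          with n hn
        linarith [hγi s]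
      · refine (Filter.eventually_all_finset _).2 fun t _ =>
          (Filter.eventually_all_finset _).2 fun j _ => ?_
        filter_upwards [eventually_le_add_of_tendsto (hm (dθ j s t)).tendsto_integral_expect
          (hpos s)] with n hn
        have : ∫ a, dθ j s t a ∂(Q.law : Measure (G → J)) ≤ _ := hθθ j s t
        linarith
  have hmeas : ∀ n (v : S.V n), Measurable fun z : S.V n → J =>
      ψ (s n) (pullbackName (S.σ n) v z) := fun n v =>
    (hψ (s n)).comp (measurable_pullbackName _ v)
  refine ⟨fun n z v => ψ (s n) (pullbackName (S.σ n) v z),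
    fun n => measurable_pi_lambda _ (hmeas n), ?_⟩
  refine Approximable.comp_of_separates hmeas R.measurable_φ (Set.range w) ?_ ?_
  · intro a b hab
    obtain ⟨_, hj, ⟨j, rfl⟩⟩ := Metric.dense_iff.1 (TopologicalSpace.denseRange_denseSeq K) a
      (dist a b / 2) (half_pos (dist_pos.2 hab))
    refine ⟨w j, ⟨j, rfl⟩, fun h => ?_⟩
    have h1 : dist a (TopologicalSpace.denseSeq K j) =
      dist b (TopologicalSpace.denseSeq K j) := h
    have h2 := dist_triangle_right a b (TopologicalSpace.denseSeq K j)
    rw [Metric.mem_ball, dist_comm] at hj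
    linarith
  rintro _ ⟨j, rfl⟩
  refine ⟨fun n v => (w j).continuous.measurable.comp (hmeas n v),
    (w j).continuous.measurable.comp R.measurable_φ,
    ⟨‖w j‖, fun n v z => abs_apply_le_norm (w j) _, fun x => abs_apply_le_norm (w j) _⟩,
    fun η hη => ?_⟩
  obtain ⟨t₀, ht₀⟩ := exists_nat_one_div_lt (show 0 < η / 6 by positivity)
  set t := max t₀ (j + 1) with ht
  have htη : 1 / ((t : ℝ) + 1) ≤ η / 6 :=
    (one_div_le_one_div_of_le (by positivity) (by
      have : (t₀ : ℝ) ≤ t := by exact_mod_cast le_max_left _ _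
      linarith)).trans ht₀.le
  have hsq : ∀ s : ℕ, (1 / ((s : ℝ) + 1)) ^ 2 ≤ 1 / ((s : ℝ) + 1) := fun s => by
    rw [sq]
    refine mul_le_of_le_one_left (hpos s).le ?_
    rw [div_le_one (by positivity)]
    have : (0 : ℝ) ≤ s := Nat.cast_nonneg s
    linarith
  refine ⟨θ j t, (hθ j t).trans ((hsq t).trans (by linarith)), ?_⟩
  filter_upwards [hsp, hs.eventually_ge_atTop t] with n hn hst
  have hjs : j < s n := (Nat.lt_succ_self j).trans_le ((le_max_right _ _).trans hst)
  have h1 := hn.1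
  have h2 := hn.2 t (Finset.mem_range.2 (by omega)) j (Finset.mem_range.2 (by omega))
  have hsη : 1 / ((s n : ℝ) + 1) ≤ η / 6 :=
    (one_div_le_one_div_of_le (by positivity) (by
      have : (t : ℝ) ≤ s n := by exact_mod_cast hst
      linarith)).trans htη
  have hint : ∀ f : C(G → J, ℝ), Integrable (fun z => 𝔼 v, f (pullbackName (S.σ n) v z))
      (m n : Measure (S.V n → J)) := fun f =>
    integrable_of_abs_le (measurable_expect fun v => measurable_comp_pullbackName _ v f)
      fun z => abs_expect_le_const fun v => abs_apply_le_norm f _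
  calc _ ≤ ∫ z, (𝔼 v, γ (s n) (pullbackName (S.σ n) v z) +
        𝔼 v, dθ j (s n) t (pullbackName (S.σ n) v z) + 1 / ((s n : ℝ) + 1))
        ∂(m n : Measure (S.V n → J)) := by
        refine integral_mono ?_ (((hint _).add (hint _)).add (integrable_const _)) fun z => ?_
        · exact Approximable.integrable_expect_abs (fun v =>
            ((w j).continuous.measurable.comp (hmeas n v)).sub
              (measurable_comp_pullbackName _ v (θ j t))) (C := ‖w j‖ + ‖θ j t‖) fun v z =>
            (abs_sub _ _).trans (add_le_add (abs_apply_le_norm _ _) (abs_apply_le_norm _ _))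
        · simp only
          rw [← Fintype.expect_const (ι := S.V n) (1 / ((s n : ℝ) + 1)),
            ← Finset.expect_add_distrib, ← Finset.expect_add_distrib]
          refine expect_mono fun v => ?_
          have h3 := abs_sub_le (w j (ψ (s n) (pullbackName (S.σ n) v z)))
            (θ j (s n) (pullbackName (S.σ n) v z)) (θ j t (pullbackName (S.σ n) v z))
          have h4 := hψγ (s n) (pullbackName (S.σ n) v z) j hjs
          have h5 : dθ j (s n) t (pullbackName (S.σ n) v z) =
            |θ j (s n) (pullbackName (S.σ n) v z) - θ j t (pullbackName (S.σ n) v z)| := rfl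
          have h6 : w j (ψ (s n) (pullbackName (S.σ n) v z)) =
            dist (ψ (s n) (pullbackName (S.σ n) v z)) (TopologicalSpace.denseSeq K j) := rfl
          rw [h5]
          rw [← h6] at h4
          linarith
    _ ≤ η := by
        rw [integral_add (f := fun z => 𝔼 v, γ (s n) (pullbackName (S.σ n) v z) +
          𝔼 v, dθ j (s n) t (pullbackName (S.σ n) v z)) ((hint _).add (hint _))
          (integrable_const _), integral_add (hint _) (hint _)]
        simp only [integral_const, probReal_univ, one_smul]
        have := hsq t
        have := hsq (s n)
        linarith

end Coding

/-! ### Covering numbers -/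

section Hamming

variable {V K L : Type*} [Fintype V] [MetricSpace K] [MetricSpace L]

theorem hammingAvg_eq_expect (x y : V → K) : hammingAvg x y = 𝔼 v, dist (x v) (y v) := by
  rw [hammingAvg, Fintype.expect_eq_sum_div_card, div_eq_inv_mul]

theorem hammingAvg_comm (x y : V → K) : hammingAvg x y = hammingAvg y x := by
  simp only [hammingAvg_eq_expect, dist_comm]

theorem hammingAvg_triangle (x y z : V → K) :
    hammingAvg x z ≤ hammingAvg x y + hammingAvg y z := by
  simp only [hammingAvg_eq_expect, ← Finset.expect_add_distrib]
  exact expect_mono fun v => dist_triangle _ _ _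

theorem hammingAvg_fst_le (x y : V → K × L) :
    hammingAvg (fun v => (x v).1) (fun v => (y v).1) ≤ hammingAvg x y := by
  simp only [hammingAvg_eq_expect]
  exact expect_mono fun v => le_max_left _ _

theorem hammingAvg_snd_le (x y : V → K × L) :
    hammingAvg (fun v => (x v).2) (fun v => (y v).2) ≤ hammingAvg x y := by
  simp only [hammingAvg_eq_expect]
  exact expect_mono fun v => le_max_right _ _

theorem hammingAvg_prod_le (x y : V → K × L) :
    hammingAvg x y ≤ hammingAvg (fun v => (x v).1) (fun v => (y v).1) +
      hammingAvg (fun v => (x v).2) (fun v => (y v).2) := by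
  simp only [hammingAvg_eq_expect, ← Finset.expect_add_distrib]
  exact expect_mono fun v => max_le_add_of_nonneg dist_nonneg dist_nonneg

theorem measurable_hammingAvg [CompactSpace K] [MeasurableSpace K] [BorelSpace K] (x : V → K) :
    Measurable fun y => hammingAvg y x := by
  unfold hammingAvg
  exact (Finset.measurable_sum _ fun v _ =>
    (measurable_pi_apply v).dist measurable_const).const_mul _

end Hamming

section Covering

variable {V K L : Type*} [Fintype V] [MetricSpace K] [CompactSpace K] [MeasurableSpace K]
  [BorelSpace K] [MetricSpace L] [CompactSpace L] [MeasurableSpace L] [BorelSpace L]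
  {m : ProbabilityMeasure (V → K)} {ε δ : ℝ}

/-- The set of models which are at distance at least `δ` from the finite set `F`. -/
def uncovered (F : Finset (V → K)) (δ : ℝ) : Set (V → K) :=
  {y | ∀ x ∈ F, δ ≤ hammingAvg y x}

theorem measurableSet_uncovered (F : Finset (V → K)) (δ : ℝ) :
    MeasurableSet (uncovered F δ) := by
  have : uncovered F δ = ⋂ x ∈ F, {y | δ ≤ hammingAvg y x} := by
    ext; simp [uncovered]
  rw [this]
  exact Finset.measurableSet_biInter _ fun x _ =>
    measurableSet_le measurable_const (measurable_hammingAvg x)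

theorem one_sub_lt_iff_uncovered {F : Finset (V → K)} :
    1 - ε < (m : Measure (V → K)).real {y | ∃ x ∈ F, hammingAvg y x < δ} ↔
      (m : Measure (V → K)).real (uncovered F δ) < ε := by
  have : {y | ∃ x ∈ F, hammingAvg y x < δ} = (uncovered F δ)ᶜ := by
    ext; simp [uncovered]
  rw [this, probReal_compl_eq_one_sub (measurableSet_uncovered F δ)]
  constructor <;> intro h <;> linarith

theorem covNumber_le {F : Finset (V → K)}
    (h : (m : Measure (V → K)).real (uncovered F δ) < ε) : covNumber m ε δ ≤ F.card :=
  iInf₂_le F (one_sub_lt_iff_uncovered.2 h)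

theorem le_covNumber {c : ℕ∞} (h : ∀ F : Finset (V → K),
    (m : Measure (V → K)).real (uncovered F δ) < ε → c ≤ F.card) : c ≤ covNumber m ε δ :=
  le_iInf₂ fun F hF => h F (one_sub_lt_iff_uncovered.1 hF)

theorem exists_card_eq_covNumber (h : covNumber m ε δ ≠ ⊤) : ∃ F : Finset (V → K),
    (m : Measure (V → K)).real (uncovered F δ) < ε ∧ covNumber m ε δ = F.card := by
  have hne : Nonempty {F : Finset (V → K) //
      1 - ε < (m : Measure (V → K)).real {y | ∃ x ∈ F, hammingAvg y x < δ}} := by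
    by_contra hc
    rw [not_nonempty_iff] at hc
    refine h ?_
    unfold covNumber
    rw [iInf_subtype', iInf_of_empty]
  obtain ⟨F, hF⟩ := ENat.exists_eq_iInf fun F : {F : Finset (V → K) //
      1 - ε < (m : Measure (V → K)).real {y | ∃ x ∈ F, hammingAvg y x < δ}} =>
    (F.1.card : ℕ∞)
  refine ⟨F.1, one_sub_lt_iff_uncovered.1 F.2, ?_⟩
  rw [hF]
  unfold covNumber
  rw [iInf_subtype']

/-- The bound on `ε` excludes the empty covering. -/
theorem one_le_covNumber (h : ε ≤ 1) : 1 ≤ covNumber m ε δ := by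
  refine le_covNumber fun F hF => ?_
  rw [← Nat.cast_one, Nat.cast_le, Nat.one_le_iff_ne_zero, Ne, Finset.card_eq_zero]
  rintro rfl
  simp only [uncovered, Finset.notMem_empty, IsEmpty.forall_iff, implies_true, Set.ofPred_true,
    probReal_univ] at hF
  linarith

theorem covNumber_anti {ε' δ' : ℝ} (hε : ε' ≤ ε) (hδ : δ' ≤ δ) :
    covNumber m ε δ ≤ covNumber m ε' δ' :=
  le_covNumber fun _ hF => covNumber_le <| (hF.trans_le hε).trans_le' <|
    measureReal_mono fun _ hy x hx => hδ.trans (hy x hx)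

/-- If, off a small exceptional set, two models are close as soon as their images under `Ψ` are,
then the covering numbers of a law are bounded by those of its image. -/
theorem covNumber_le_covNumber_map {Ψ : (V → K) → (V → L)} (hΨ : Measurable Ψ) {δ' : ℝ}
    {A : Set (V → K)} (hA : (m : Measure (V → K)).real Aᶜ ≤ ε / 2)
    (h : ∀ x ∈ A, ∀ x' ∈ A, hammingAvg (Ψ x) (Ψ x') < 2 * δ' → hammingAvg x x' < δ) :
    covNumber m ε δ ≤ covNumber (m.map hΨ.aemeasurable) (ε / 2) δ' := by
  classical
  refine le_covNumber fun F hF => ?_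
  have hex : ∀ z : V → L, ∃ x : V → K, (∃ x' ∈ A, hammingAvg (Ψ x') z < δ') →
      x ∈ A ∧ hammingAvg (Ψ x) z < δ' := by
    intro z
    by_cases hz : ∃ x' ∈ A, hammingAvg (Ψ x') z < δ'
    · obtain ⟨x', hx'⟩ := hz
      exact ⟨x', fun _ => hx'⟩
    · obtain ⟨x'⟩ := m.nonempty
      exact ⟨x', fun h => (hz h).elim⟩
  choose c hc using hex
  refine (covNumber_le (F := F.image c) ?_).trans (Nat.cast_le.2 Finset.card_image_le)
  have hsub : uncovered (F.image c) δ ⊆ Aᶜ ∪ Ψ ⁻¹' uncovered F δ' := by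
    intro x hx
    by_contra hcon
    simp only [Set.mem_union, Set.mem_compl_iff, not_or, not_not, Set.mem_preimage, uncovered,
      Set.mem_ofPred_eq, not_forall, not_le] at hcon
    obtain ⟨hxA, z, hz, hxz⟩ := hcon
    obtain ⟨h1, h2⟩ := hc z ⟨x, hxA, hxz⟩
    refine (hx (c z) (Finset.mem_image_of_mem c hz)).not_gt (h _ hxA _ h1 ?_)
    have := hammingAvg_triangle (Ψ x) z (Ψ (c z))
    rw [hammingAvg_comm z] at this
    linarith
  have h3 : (m : Measure (V → K)).real (Ψ ⁻¹' uncovered F δ') < ε / 2 := by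
    rwa [ProbabilityMeasure.toMeasure_map, map_measureReal_apply hΨ
      (measurableSet_uncovered F δ')] at hF
  have h4 := (measureReal_mono (μ := (m : Measure (V → K))) hsub).trans (measureReal_union_le _ _)
  linarith

/-- Covering numbers are submultiplicative: products of coverings of the marginals are coverings. -/
theorem covNumber_le_mul (l : ProbabilityMeasure (V → K × L)) (hε : ε ≤ 1) :
    covNumber l ε δ ≤
      covNumber (l.map (f := fun x v => (x v).1) (measurable_postcomp measurable_fst).aemeasurable)
        (ε / 2) (δ / 2) *
      covNumber (l.map (f := fun x v => (x v).2) (measurable_postcomp measurable_snd).aemeasurable)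
        (ε / 2) (δ / 2) := by
  classical
  set l₁ := l.map (f := fun x v => (x v).1) (measurable_postcomp measurable_fst).aemeasurable
  set l₂ := l.map (f := fun x v => (x v).2) (measurable_postcomp measurable_snd).aemeasurable
  have hne₁ := (one_le_covNumber (m := l₁) (ε := ε / 2) (δ := δ / 2) (by linarith)).trans_lt'
    one_pos
  have hne₂ := (one_le_covNumber (m := l₂) (ε := ε / 2) (δ := δ / 2) (by linarith)).trans_lt'
    one_pos
  -- the covering numbers are not zero, so an infinite factor makes the product infinite
  by_cases h₁ : covNumber l₁ (ε / 2) (δ / 2) = ⊤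
  · rw [h₁, ENat.top_mul hne₂.ne']
    exact le_top
  by_cases h₂ : covNumber l₂ (ε / 2) (δ / 2) = ⊤
  · rw [h₂, ENat.mul_top hne₁.ne']
    exact le_top
  obtain ⟨F₁, hF₁, hc₁⟩ := exists_card_eq_covNumber h₁
  obtain ⟨F₂, hF₂, hc₂⟩ := exists_card_eq_covNumber h₂
  rw [hc₁, hc₂, ← Nat.cast_mul, ← Finset.card_product]
  refine (covNumber_le (F := (F₁ ×ˢ F₂).image fun p v => (p.1 v, p.2 v)) ?_).trans
    (Nat.cast_le.2 Finset.card_image_le)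
  have hsub : uncovered ((F₁ ×ˢ F₂).image fun p v => (p.1 v, p.2 v)) δ ⊆
      (fun (x : V → K × L) v => (x v).1) ⁻¹' uncovered F₁ (δ / 2) ∪
        (fun (x : V → K × L) v => (x v).2) ⁻¹' uncovered F₂ (δ / 2) := by
    intro x hx
    by_contra hcon
    simp only [Set.mem_union, not_or, Set.mem_preimage, uncovered,
      Set.mem_ofPred_eq, not_forall, not_le] at hcon
    obtain ⟨⟨y, hy, hxy⟩, z, hz, hxz⟩ := hcon
    have h1 := hx _ (Finset.mem_image_of_mem _ (Finset.mk_mem_product hy hz))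
    have h2 := hammingAvg_prod_le x fun v => (y v, z v)
    linarith
  have h3 := (measureReal_mono (μ := (l : Measure (V → K × L))) hsub).trans
    (measureReal_union_le _ _)
  rw [ProbabilityMeasure.toMeasure_map, map_measureReal_apply
    (measurable_postcomp measurable_fst) (measurableSet_uncovered _ _)] at hF₁
  rw [ProbabilityMeasure.toMeasure_map, map_measureReal_apply
    (measurable_postcomp measurable_snd) (measurableSet_uncovered _ _)] at hF₂
  linarith

/-- If each point of `A` is related to at least `k` points of the finite set `F`, then there are at
most `F.card / k` points such that every point of `A` has a related point in common with one of
them: choose points of `A` greedily, and discard the points of `F` related to them. -/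
theorem exists_finset_card_mul_le {α β : Type*} (r : α → β → Prop) [∀ a b, Decidable (r a b)]
    {k : ℕ} (hk : 0 < k) (F : Finset β) (A : Set α)
    (h : ∀ x ∈ A, k ≤ (F.filter fun p => r x p).card) :
    ∃ D : Finset α, D.card * k ≤ F.card ∧ ∀ x ∈ A, ∃ x' ∈ D, ∃ p, r x p ∧ r x' p := by
  classical
  induction hF : F.card using Nat.strong_induction_on generalizing F A with
  | _ N ih =>
    subst hF
    rcases A.eq_empty_or_nonempty with rfl | ⟨x, hx⟩
    · exact ⟨∅, by simp, by simp⟩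
    have hcard := Finset.card_filter_add_card_filter_not (s := F) (fun p => r x p)
    have hkx := h x hx
    obtain ⟨D, hD, hDA⟩ := ih _ (by omega) (F.filter fun p => ¬ r x p)
      {x' ∈ A | ∀ p, r x p → ¬ r x' p} (fun x' hx' => by
        refine (h x' hx'.1).trans (Finset.card_le_card fun p hp => ?_)
        rw [Finset.mem_filter] at hp
        rw [Finset.mem_filter, Finset.mem_filter]
        exact ⟨⟨hp.1, fun hxp => hx'.2 p hxp hp.2⟩, hp.2⟩) rfl
    refine ⟨insert x D, ?_, fun x' hx' => ?_⟩
    · calc (insert x D).card * k ≤ (D.card + 1) * k :=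
            Nat.mul_le_mul_right _ (Finset.card_insert_le _ _)
        _ ≤ F.card := by rw [add_mul, one_mul]; omega
    · by_cases hxx : ∀ p, r x p → ¬ r x' p
      · obtain ⟨y, hy, hp⟩ := hDA x' ⟨hx', hxx⟩
        exact ⟨y, Finset.mem_insert_of_mem hy, hp⟩
      · push Not at hxx
        obtain ⟨p, hp, hp'⟩ := hxx
        exact ⟨x, Finset.mem_insert_self _ _, p, hp', hp⟩

/-- Covering numbers of products of laws are supermultiplicative, up to a change of parameters: by
Fubini, for most models `x` the points of a covering of the product whose first coordinate is close
to `x` give a covering for the second law, and these parts of the covering are disjoint for models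
`x` which are separated from each other. -/
theorem mul_le_covNumber_prodLaw (m : ProbabilityMeasure (V → K)) (m' : ProbabilityMeasure (V → L))
    (hε : 0 < ε) (hε1 : ε ≤ 1) :
    covNumber m ε (2 * δ) * covNumber m' ε δ ≤ covNumber (prodLaw m m') (ε ^ 2) δ := by
  classical
  refine le_covNumber fun F hF => ?_
  set E : Set ((V → K) × (V → L)) := (fun p v => (p.1 v, p.2 v)) ⁻¹' uncovered F δ with hE
  have hEm : MeasurableSet E := measurable_zipModels (measurableSet_uncovered F δ)
  -- the models `x` of the first system such that `F` covers most of the fibre over `x`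
  set A : Set (V → K) := {x | (m' : Measure (V → L)).real (Prod.mk x ⁻¹' E) < ε} with hA
  have hmeas : Measurable fun x => (m' : Measure (V → L)).real (Prod.mk x ⁻¹' E) :=
    (measurable_measure_prodMk_left hEm).ennreal_toReal
  have hAc : (m : Measure (V → K)).real Aᶜ < ε := by
    have h1 : ∫ x, (m' : Measure (V → L)).real (Prod.mk x ⁻¹' E) ∂(m : Measure (V → K)) <
        ε ^ 2 := by
      rw [toMeasure_prodLaw, map_measureReal_apply measurable_zipModels
        (measurableSet_uncovered F δ), Measure.real, Measure.prod_apply hEm] at hF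
      exact (integral_toReal (measurable_measure_prodMk_left hEm).aemeasurable
        (ae_of_all _ fun x => measure_lt_top _ _)).trans_lt hF
    have h2 := mul_meas_ge_le_integral_of_nonneg (μ := (m : Measure (V → K)))
      (ae_of_all _ fun x => measureReal_nonneg)
      (integrable_of_abs_le hmeas (C := 1) fun x => by
        rw [abs_of_nonneg measureReal_nonneg]; exact measureReal_le_one) ε
    have h3 : Aᶜ = {x | ε ≤ (m' : Measure (V → L)).real (Prod.mk x ⁻¹' E)} := by
      ext; simp [hA]
    rw [h3]
    nlinarith
  have hcov : ∀ x ∈ A, covNumber m' ε δ ≤ ((F.filter fun p : V → K × L =>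
      hammingAvg x (fun v => (p v).1) < δ).card : ℕ∞) := by
    intro x hx
    refine (covNumber_le (F := (F.filter fun p : V → K × L =>
      hammingAvg x (fun v => (p v).1) < δ).image fun p v => (p v).2) ?_).trans
      (Nat.cast_le.2 Finset.card_image_le)
    refine lt_of_le_of_lt (measureReal_mono ?_) hx
    intro y hy p hp
    by_contra hcon
    rw [not_le] at hcon
    have h1 := (hammingAvg_fst_le _ p).trans_lt hcon
    have h2 := (hammingAvg_snd_le _ p).trans_lt hcon
    exact h2.not_ge (hy _ (Finset.mem_image_of_mem _ (Finset.mem_filter.2 ⟨hp, h1⟩)))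
  obtain ⟨x₀, hx₀⟩ : A.Nonempty := by
    by_contra hcon
    rw [Set.not_nonempty_iff_eq_empty] at hcon
    rw [hcon, Set.compl_empty, probReal_univ] at hAc
    linarith
  have hfin : covNumber m' ε δ ≠ ⊤ := ne_top_of_le_ne_top (ENat.natCast_ne_top _) (hcov x₀ hx₀)
  obtain ⟨k, hk⟩ := ENat.ne_top_iff_exists.1 hfin
  have hk0 : 0 < k := by
    have := one_le_covNumber (m := m') (δ := δ) hε1
    rw [← hk] at this
    exact_mod_cast this
  rw [← hk] at hcov ⊢
  obtain ⟨D, hD, hDA⟩ := exists_finset_card_mul_le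
    (fun (x : V → K) (p : V → K × L) => hammingAvg x (fun v => (p v).1) < δ) hk0 F A
    fun x hx => Nat.cast_le.1 (hcov x hx)
  have hDc : covNumber m ε (2 * δ) ≤ D.card := by
    refine covNumber_le (lt_of_le_of_lt (measureReal_mono ?_) hAc)
    intro x hx hxA
    obtain ⟨x', hx', p, hp, hp'⟩ := hDA x hxA
    have h1 := hx x' hx'
    have h2 := hammingAvg_triangle x (fun v => (p v).1) x'
    rw [hammingAvg_comm (fun v => (p v).1) x'] at h2
    linarith
  calc _ ≤ (D.card : ℕ∞) * k := by gcongr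
    _ ≤ _ := by exact_mod_cast hD

end Covering

/-! ### Covering numbers of recoded models -/

section Coding

variable {G : Type*} [Group G] [Countable G] {X : Type*} [MeasurableSpace X]
  [StandardBorelSpace X] [MulAction G X] [MeasurableConstSMul G X] {μ : ProbabilityMeasure X}
  [SMulInvariantMeasure G X (μ : Measure X)]
  {J : Type*} [MetricSpace J] [CompactSpace J] [MeasurableSpace J] [BorelSpace J]
  {K : Type*} [MetricSpace K] [CompactSpace K] [MeasurableSpace K] [BorelSpace K]
  {S : SoficApproximation G} {m : ∀ n, ProbabilityMeasure (S.V n → J)}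
  {Q : ProcessModel G μ J} {R : ProcessModel G μ K}
  {ψ : ∀ n, (S.V n → J) → (S.V n → K)}

/-- Recoding does not decrease covering numbers, up to a change of parameters: since the letters of
the old process are approximated by continuous functions of names of the new one, most models are
determined by their recodings, up to a small error. -/
theorem IsCoding.exists_covNumber_le (h : IsCoding S m Q R ψ) (hm : ∀ f, S.LocalMean m Q.law f)
    {ε δ : ℝ} (hε : 0 < ε) (hδ : 0 < δ) :
    ∃ δ' > 0, ∀ᶠ n in atTop, covNumber (m n) ε δ ≤
      covNumber ((m n).map (h.measurable n).aemeasurable) (ε / 2) δ' := by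
  classical
  -- the distances from the points of a finite net `N` determine a letter, up to a small error
  obtain ⟨N, -, hN⟩ := isCompact_univ.elim_nhds_subcover (fun p : J => Metric.ball p (δ / 8))
    fun p _ => Metric.ball_mem_nhds p (by positivity)
  have hdist : ∀ a b : J, dist a b ≤ δ / 4 + ∑ p ∈ N, |dist a p - dist b p| := by
    intro a b
    obtain ⟨p, hp, hap⟩ := Set.mem_iUnion₂.1 (hN (Set.mem_univ a))
    rw [Metric.mem_ball] at hap
    have h1 : |dist a p - dist b p| ≤ ∑ p ∈ N, |dist a p - dist b p| :=
      Finset.single_le_sum (f := fun p => |dist a p - dist b p|) (fun p _ => abs_nonneg _) hp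
    have h2 := dist_triangle_right a b p
    have h3 := neg_abs_le (dist a p - dist b p)
    linarith
  set u : J → C(J, ℝ) := fun p => ⟨fun a => dist a p, by fun_prop⟩ with hu
  set c : ℝ := (N.card : ℝ) with hc
  have hc0 : 0 ≤ c := Nat.cast_nonneg _
  set η : ℝ := ε * (δ / 8) / (4 * (c + 1)) with hη
  have hη0 : 0 < η := by positivity
  have hθ : ∀ p : J, ∃ θ : C(G → K, ℝ),
      ∫ x, |u p (Q.φ x) - θ (R.name x)| ∂(μ : Measure X) ≤ η := fun p =>
    R.exists_continuous_integral_sub_le ((u p).continuous.measurable.comp Q.measurable_φ)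
      (fun x => abs_apply_le_norm (u p) _) hη0
  choose θ hθ using hθ
  have hτ : 0 < δ / (8 * (c + 1)) := by positivity
  choose F C hC hF using fun p => exists_finset_abs_sub_le (θ p) hτ
  set B : ℝ := ∑ p ∈ N, C p * (F p).card with hB
  have hB0 : 0 ≤ B := Finset.sum_nonneg fun p _ => mul_nonneg (hC p) (Nat.cast_nonneg _)
  refine ⟨δ / (16 * (B + 1)), by positivity, ?_⟩
  -- the error in recovering the distances from `p` from the recoded model
  set H : ∀ n, J → (S.V n → J) → ℝ := fun n p z =>
    𝔼 v, |u p (z v) - θ p (pullbackName (S.σ n) v (ψ n z))| with hH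
  have hev : ∀ᶠ n in atTop, ∀ p ∈ N, ∫ z, H n p z ∂(m n : Measure (S.V n → J)) ≤ η + η := by
    refine (Filter.eventually_all_finset _).2 fun p _ => ?_
    have h1 := ((Approximable.value (S := S) (m := m) (Q := Q) (u p)).sub
      (h.approximable_name (θ p))).abs.tendsto_integral_expect hm
    filter_upwards [eventually_le_add_of_tendsto h1 hη0] with n hn
    exact hn.trans (by linarith [hθ p])
  filter_upwards [hev] with n hn
  have hHm : ∀ p, Measurable (H n p) := fun p =>
    measurable_expect fun v => continuous_abs.measurable.comp
      (((u p).continuous.measurable.comp (measurable_pi_apply v)).sub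
        ((measurable_comp_pullbackName _ v (θ p)).comp (h.measurable n)))
  have hHi : ∀ p, Integrable (H n p) (m n : Measure (S.V n → J)) := fun p =>
    integrable_of_abs_le (hHm p) (C := ‖u p‖ + ‖θ p‖) fun z =>
      abs_expect_le_const fun v => by
        rw [abs_abs]
        exact (abs_sub _ _).trans (add_le_add (abs_apply_le_norm _ _) (abs_apply_le_norm _ _))
  refine covNumber_le_covNumber_map (h.measurable n) (A := {z | ∑ p ∈ N, H n p z < δ / 8}) ?_ ?_
  · have h1 := mul_meas_ge_le_integral_of_nonneg (μ := (m n : Measure (S.V n → J)))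
      (f := fun z => ∑ p ∈ N, H n p z)
      (ae_of_all _ fun z => Finset.sum_nonneg fun p _ => expect_nonneg' fun v => abs_nonneg _)
      (integrable_finsetSum _ fun p _ => hHi p) (δ / 8)
    rw [integral_finsetSum _ fun p _ => hHi p] at h1
    have h2 := Finset.sum_le_sum hn
    rw [Finset.sum_const, nsmul_eq_mul] at h2
    have h3 : (N.card : ℝ) * (η + η) ≤ δ / 8 * (ε / 2) := by
      have : (c + 1) * (η + η) = δ / 8 * (ε / 2) := by rw [hη]; field_simp; ring
      rw [← this]
      gcongr
      linarith
    have h4 : {z | ∑ p ∈ N, H n p z < δ / 8}ᶜ = {z | δ / 8 ≤ ∑ p ∈ N, H n p z} := by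
      ext; simp
    rw [h4]
    exact le_of_mul_le_mul_left ((h1.trans h2).trans h3) (by positivity)
  · intro z hz z' hz' hzz
    simp only [Set.mem_ofPred_eq] at hz hz'
    set ρ := hammingAvg (ψ n z) (ψ n z') with hρ
    have hpt : ∀ p, 𝔼 v, |u p (z v) - u p (z' v)| ≤
        H n p z + H n p z' + (δ / (8 * (c + 1)) + C p * (F p).card * ρ) := by
      intro p
      have h1 : ∀ v, |u p (z v) - u p (z' v)| ≤
          |u p (z v) - θ p (pullbackName (S.σ n) v (ψ n z))| +
            |u p (z' v) - θ p (pullbackName (S.σ n) v (ψ n z'))| +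
            (δ / (8 * (c + 1)) + C p * ∑ g ∈ F p,
              dist (ψ n z (S.σ n g v)) (ψ n z' (S.σ n g v))) := by
        intro v
        have h2 := hF p (pullbackName (S.σ n) v (ψ n z)) (pullbackName (S.σ n) v (ψ n z'))
        have h3 := abs_sub_le (u p (z v)) (θ p (pullbackName (S.σ n) v (ψ n z))) (u p (z' v))
        have h4 := abs_sub_le (θ p (pullbackName (S.σ n) v (ψ n z)))
          (θ p (pullbackName (S.σ n) v (ψ n z'))) (u p (z' v))
        rw [abs_sub_comm (θ p (pullbackName (S.σ n) v (ψ n z'))) (u p (z' v))] at h4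
        simp only [pullbackName] at h2 h3 h4 ⊢
        linarith
      refine (expect_mono h1).trans (le_of_eq ?_)
      have h5 : 𝔼 v, ∑ g ∈ F p, dist (ψ n z (S.σ n g v)) (ψ n z' (S.σ n g v)) =
          (F p).card * ρ := by
        rw [Finset.expect_sum_comm]
        have : ∀ g ∈ F p, 𝔼 v, dist (ψ n z (S.σ n g v)) (ψ n z' (S.σ n g v)) = ρ := by
          intro g _
          rw [hρ, hammingAvg_eq_expect]
          exact expect_comp_perm (S.σ n g) fun v => dist (ψ n z v) (ψ n z' v)
        rw [Finset.sum_congr rfl this, Finset.sum_const, nsmul_eq_mul]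
      rw [Finset.expect_add_distrib, Finset.expect_add_distrib, Finset.expect_add_distrib,
        Fintype.expect_const, ← Finset.mul_expect, h5, mul_assoc]
    have h6 : hammingAvg z z' ≤ δ / 4 + ∑ p ∈ N, 𝔼 v, |u p (z v) - u p (z' v)| := by
      rw [hammingAvg_eq_expect, ← Finset.expect_sum_comm]
      refine (expect_mono fun v => hdist (z v) (z' v)).trans (le_of_eq ?_)
      rw [Finset.expect_add_distrib, Fintype.expect_const]
      rfl
    have h7 := Finset.sum_le_sum fun p (_ : p ∈ N) => hpt p
    rw [Finset.sum_add_distrib, Finset.sum_add_distrib, Finset.sum_add_distrib, Finset.sum_const,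
      nsmul_eq_mul, ← Finset.sum_mul] at h7
    have h8 : (N.card : ℝ) * (δ / (8 * (c + 1))) ≤ δ / 8 := by
      have : (c + 1) * (δ / (8 * (c + 1))) = δ / 8 := by field_simp
      rw [← this]
      gcongr
      linarith
    have h9 : B * ρ ≤ δ / 8 := by
      have : (B + 1) * (2 * (δ / (16 * (B + 1)))) = δ / 8 := by field_simp; norm_num
      rw [← this]
      exact mul_le_mul (by linarith) hzz.le
        (by rw [hρ, hammingAvg_eq_expect]; exact expect_nonneg' fun v => dist_nonneg) (by linarith)
    linarith

end Coding

/-! ### Rates of covering numbers and suprema of rates -/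

section Rate

variable {V K L J : Type*} [Fintype V] [MetricSpace K] [MeasurableSpace K] [MetricSpace L]
  [MeasurableSpace L] [MetricSpace J] [MeasurableSpace J]
  {m : ProbabilityMeasure (V → K)} {m' : ProbabilityMeasure (V → L)}
  {l : ProbabilityMeasure (V → J)} {ε δ ε' δ' ε'' δ'' : ℝ}

theorem covRate_le_covRate (h : covNumber m ε δ ≤ covNumber m' ε' δ') :
    covRate m ε δ ≤ covRate m' ε' δ' :=
  EReal.div_le_div_right_of_nonneg (by positivity)
    (ENNReal.log_le_log (ENat.toENNReal_le.2 h))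

theorem covRate_add_covRate : covRate m ε δ + covRate m' ε' δ' =
    ENNReal.log ((covNumber m ε δ * covNumber m' ε' δ' : ℕ∞) : ℝ≥0∞) /
      ((Fintype.card V : ℕ) : EReal) := by
  rw [ENat.toENNReal_mul, ENNReal.log_mul_add, EReal.add_div_of_nonneg_right (by positivity)]
  rfl

theorem covRate_le_add (h : covNumber l ε'' δ'' ≤ covNumber m ε δ * covNumber m' ε' δ') :
    covRate l ε'' δ'' ≤ covRate m ε δ + covRate m' ε' δ' := by
  rw [covRate_add_covRate]
  exact EReal.div_le_div_right_of_nonneg (by positivity)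
    (ENNReal.log_le_log (ENat.toENNReal_le.2 h))

theorem add_le_covRate (h : covNumber m ε δ * covNumber m' ε' δ' ≤ covNumber l ε'' δ'') :
    covRate m ε δ + covRate m' ε' δ' ≤ covRate l ε'' δ'' := by
  rw [covRate_add_covRate]
  exact EReal.div_le_div_right_of_nonneg (by positivity)
    (ENNReal.log_le_log (ENat.toENNReal_le.2 h))

theorem covRate_nonneg [CompactSpace K] [BorelSpace K] (h : ε ≤ 1) : 0 ≤ covRate m ε δ := by
  refine EReal.div_nonneg ?_ (by positivity)
  rw [← ENNReal.log_one]
  refine ENNReal.log_le_log ?_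
  exact_mod_cast one_le_covNumber (m := m) (δ := δ) h

end Rate

namespace SoficApproximation

variable {G : Type*} [Group G] {K : Type*} [MetricSpace K] [MeasurableSpace K]
  {L : Type*} [MetricSpace L] [MeasurableSpace L] {J : Type*} [MetricSpace J] [MeasurableSpace J]

/-- The supremum of the upper covering rates of sequences of laws of models along subsequences of
`S` which satisfy the condition `C`. Both model-measure sofic entropies are of this form. -/
noncomputable def upperRate (S : SoficApproximation G)
    (C : ∀ S' : SoficApproximation G, (∀ i, ProbabilityMeasure (S'.V i → K)) → Prop) : EReal :=
  ⨆ (n : ℕ → ℕ) (hn : StrictMono n)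
    (m : ∀ i, ProbabilityMeasure ((S.sub n hn).V i → K)) (_ : C (S.sub n hn) m)
    (ε : ℝ) (_ : 0 < ε) (δ : ℝ) (_ : 0 < δ), limsup (fun i => covRate (m i) ε δ) atTop

/-- The supremum of the lower covering rates of sequences of laws of models over `S` which satisfy
the condition `C`. -/
noncomputable def lowerRate (S : SoficApproximation G)
    (C : ∀ S' : SoficApproximation G, (∀ i, ProbabilityMeasure (S'.V i → K)) → Prop) : EReal :=
  ⨆ (m : ∀ n, ProbabilityMeasure (S.V n → K)) (_ : C S m)
    (ε : ℝ) (_ : 0 < ε) (δ : ℝ) (_ : 0 < δ), liminf (fun n => covRate (m n) ε δ) atTop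

variable {S : SoficApproximation G}
  {C : ∀ S' : SoficApproximation G, (∀ i, ProbabilityMeasure (S'.V i → J)) → Prop}
  {C₁ : ∀ S' : SoficApproximation G, (∀ i, ProbabilityMeasure (S'.V i → K)) → Prop}
  {C₂ : ∀ S' : SoficApproximation G, (∀ i, ProbabilityMeasure (S'.V i → L)) → Prop}

theorem limsup_le_upperRate {n : ℕ → ℕ} (hn : StrictMono n)
    {m : ∀ i, ProbabilityMeasure ((S.sub n hn).V i → J)} (h : C (S.sub n hn) m) {ε δ : ℝ}
    (hε : 0 < ε) (hδ : 0 < δ) :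
    limsup (fun i => covRate (m i) ε δ) atTop ≤ S.upperRate C :=
  le_iSup_of_le n <| le_iSup_of_le hn <| le_iSup_of_le m <| le_iSup_of_le h <|
    le_iSup_of_le ε <| le_iSup_of_le hε <| le_iSup_of_le δ <| le_iSup_of_le hδ le_rfl

variable [CompactSpace K] [BorelSpace K] [CompactSpace L] [BorelSpace L]

theorem upperRate_le_add [CompactSpace J] [BorelSpace J]
    (H : ∀ S' m, C S' m → ∃ m₁ m₂, C₁ S' m₁ ∧ C₂ S' m₂ ∧ ∀ ε δ : ℝ, 0 < ε → ε ≤ 1 → 0 < δ →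
      ∃ ε' δ' : ℝ, 0 < ε' ∧ ε' ≤ 1 ∧ 0 < δ' ∧ ∀ᶠ i in atTop,
        covRate (m i) ε δ ≤ covRate (m₁ i) ε' δ' + covRate (m₂ i) ε' δ') :
    S.upperRate C ≤ S.upperRate C₁ + S.upperRate C₂ := by
  refine iSup₂_le fun n hn => iSup₂_le fun m hm => iSup₂_le fun ε hε => iSup₂_le fun δ hδ => ?_
  obtain ⟨m₁, m₂, h₁, h₂, h⟩ := H _ m hm
  obtain ⟨ε', δ', hε', hε1, hδ', hev⟩ := h (min ε 1) δ (lt_min hε one_pos) (min_le_right _ _) hδ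
  have hnn₁ : 0 ≤ limsup (fun i => covRate (m₁ i) ε' δ') atTop :=
    le_limsup_of_frequently_le (Frequently.of_forall fun i => covRate_nonneg hε1)
  have hnn₂ : 0 ≤ limsup (fun i => covRate (m₂ i) ε' δ') atTop :=
    le_limsup_of_frequently_le (Frequently.of_forall fun i => covRate_nonneg hε1)
  calc limsup (fun i => covRate (m i) ε δ) atTop
      ≤ limsup ((fun i => covRate (m₁ i) ε' δ') + fun i => covRate (m₂ i) ε' δ') atTop := by
        refine limsup_le_limsup ?_
        filter_upwards [hev] with i hi
        exact (covRate_le_covRate (covNumber_anti (min_le_left _ _) le_rfl)).trans hi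
    _ ≤ limsup (fun i => covRate (m₁ i) ε' δ') atTop +
        limsup (fun i => covRate (m₂ i) ε' δ') atTop :=
        EReal.limsup_add_le (Or.inl (EReal.bot_lt_zero.trans_le hnn₁).ne')
          (Or.inr (EReal.bot_lt_zero.trans_le hnn₂).ne')
    _ ≤ _ := add_le_add (limsup_le_upperRate hn h₁ hε' hδ') (limsup_le_upperRate hn h₂ hε' hδ')

theorem add_le_upperRate
    (hsub : ∀ (n : ℕ → ℕ) (hn : StrictMono n) m, C₂ S m → C₂ (S.sub n hn) fun i => m (n i))
    (H : ∀ S' m₁ m₂, C₁ S' m₁ → C₂ S' m₂ → ∃ m, C S' m ∧ ∀ ε δ : ℝ, 0 < ε → ε ≤ 1 → 0 < δ →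
      ∃ ε' δ' : ℝ, 0 < ε' ∧ 0 < δ' ∧ ∀ᶠ i in atTop,
        covRate (m₁ i) ε δ + covRate (m₂ i) ε δ ≤ covRate (m i) ε' δ') :
    S.upperRate C₁ + S.lowerRate C₂ ≤ S.upperRate C := by
  refine EReal.add_le_of_forall_lt fun a ha b hb => ?_
  simp only [upperRate, lowerRate, lt_iSup_iff] at ha hb
  obtain ⟨n, hn, m₁, h₁, ε₁, hε₁, δ₁, hδ₁, ha⟩ := ha
  obtain ⟨m₂, h₂, ε₂, hε₂, δ₂, hδ₂, hb⟩ := hb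
  obtain ⟨m, hm, h⟩ := H _ m₁ _ h₁ (hsub n hn m₂ h₂)
  -- smaller parameters increase covering numbers, so common parameters can be taken
  set ε := min (min ε₁ ε₂) 1
  set δ := min δ₁ δ₂
  obtain ⟨ε', δ', hε', hδ', hev⟩ := h ε δ (lt_min (lt_min hε₁ hε₂) one_pos) (min_le_right _ _)
    (lt_min hδ₁ hδ₂)
  have ha' : a ≤ limsup (fun i => covRate (m₁ i) ε δ) atTop :=
    ha.le.trans (limsup_le_limsup (Eventually.of_forall fun i => covRate_le_covRate
      (covNumber_anti ((min_le_left _ _).trans (min_le_left _ _)) (min_le_left _ _))))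
  have hb' : b ≤ liminf (fun i => covRate (m₂ (n i)) ε δ) atTop := by
    refine hb.le.trans ?_
    calc liminf (fun i => covRate (m₂ i) ε₂ δ₂) atTop
        ≤ liminf (fun i => covRate (m₂ i) ε δ) atTop :=
          liminf_le_liminf (Eventually.of_forall fun i => covRate_le_covRate
            (covNumber_anti ((min_le_left _ _).trans (min_le_right _ _)) (min_le_right _ _)))
      _ ≤ liminf (fun i => covRate (m₂ i) ε δ) (map n atTop) :=
          liminf_le_liminf_of_le hn.tendsto_atTop
      _ = _ := rfl
  calc a + b ≤ limsup (fun i => covRate (m₁ i) ε δ) atTop +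
        liminf (fun i => covRate (m₂ (n i)) ε δ) atTop := add_le_add ha' hb'
    _ ≤ limsup ((fun i => covRate (m₁ i) ε δ) + fun i => covRate (m₂ (n i)) ε δ) atTop :=
        EReal.le_limsup_add
    _ ≤ limsup (fun i => covRate (m i) ε' δ') atTop := limsup_le_limsup hev
    _ ≤ _ := limsup_le_upperRate hn hm hε' hδ'

end SoficApproximation

/-! ### Subadditivity and additivity of model-measure sofic entropy -/

section DoublyQuenchedMap

variable {V K L K' L' : Type*} [MeasurableSpace K] [MeasurableSpace L] [MeasurableSpace K']
  [MeasurableSpace L']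

theorem map_prodLaw (m : ProbabilityMeasure (V → K)) (m' : ProbabilityMeasure (V → L))
    {e : K → K'} {e' : L → L'} (he : Measurable e) (he' : Measurable e') :
    (prodLaw m m').map (f := fun x v => Prod.map e e' (x v))
      (measurable_postcomp (he.prodMap he')).aemeasurable =
      prodLaw (m.map (f := fun x v => e (x v)) (measurable_postcomp he).aemeasurable)
        (m'.map (f := fun x v => e' (x v)) (measurable_postcomp he').aemeasurable) := by
  refine Subtype.ext ?_
  simp only [ProbabilityMeasure.val_eq_to_measure]
  rw [ProbabilityMeasure.toMeasure_map, toMeasure_prodLaw, toMeasure_prodLaw,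
    ProbabilityMeasure.toMeasure_map, ProbabilityMeasure.toMeasure_map,
    Measure.map_map (measurable_postcomp (he.prodMap he')) measurable_zipModels,
    Measure.map_prod_map _ _ (measurable_postcomp he) (measurable_postcomp he'),
    Measure.map_map measurable_zipModels
      ((measurable_postcomp he).prodMap (measurable_postcomp he'))]
  rfl

end DoublyQuenchedMap

namespace SoficApproximation

variable {G : Type*} [Group G] [Countable G] {S : SoficApproximation G}

theorem DoublyQuenchedConv.map {K L : Type*} [MetricSpace K] [CompactSpace K] [MeasurableSpace K]
    [BorelSpace K] [MetricSpace L] [CompactSpace L] [MeasurableSpace L]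
    [BorelSpace L] {m : ∀ n, ProbabilityMeasure (S.V n → K)} {P : ProbabilityMeasure (G → K)}
    (h : S.DoublyQuenchedConv m P) {e : K → L} (he : Continuous e) :
    S.DoublyQuenchedConv (fun n => (m n).map (f := fun x v => e (x v))
      (measurable_postcomp he.measurable).aemeasurable)
      (P.map (f := fun a g => e (a g)) (measurable_postcomp he.measurable).aemeasurable) := by
  have h1 := QuenchedConv.map h (he.prodMap he)
  unfold DoublyQuenchedConv
  rw [← map_prodLaw _ _ he.measurable he.measurable]
  simp only [← map_prodLaw _ _ he.measurable he.measurable]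
  exact h1

section Recoding

variable {X : Type*} [MeasurableSpace X] [StandardBorelSpace X] [MulAction G X]
  [MeasurableConstSMul G X] {μ : ProbabilityMeasure X} [SMulInvariantMeasure G X (μ : Measure X)]
  {J : Type*} [MetricSpace J] [CompactSpace J] [MeasurableSpace J] [BorelSpace J]
  {K : Type*} [MetricSpace K] [CompactSpace K] [MeasurableSpace K] [BorelSpace K]
  {m : ∀ n, ProbabilityMeasure (S.V n → J)}

/-- Laws of models for one process model of a system can be recoded as laws of models for any other
one, without decreasing covering numbers. -/
theorem QuenchedConv.exists_recoding (Q : ProcessModel G μ J) (R : ProcessModel G μ K)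
    (h : S.QuenchedConv m Q.law) : ∃ m' : ∀ n, ProbabilityMeasure (S.V n → K),
      S.QuenchedConv m' R.law ∧ ∀ ε δ : ℝ, 0 < ε → 0 < δ → ∃ δ' > 0, ∀ᶠ n in atTop,
        covNumber (m n) ε δ ≤ covNumber (m' n) (ε / 2) δ' := by
  obtain ⟨ψ, hψ⟩ := exists_isCoding Q R h.localMean
  exact ⟨_, hψ.quenchedConv h, fun ε δ hε hδ => hψ.exists_covNumber_le h.localMean hε hδ⟩

theorem DoublyQuenchedConv.exists_recoding (Q : ProcessModel G μ J) (R : ProcessModel G μ K)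
    (h : S.DoublyQuenchedConv m Q.law) : ∃ m' : ∀ n, ProbabilityMeasure (S.V n → K),
      S.DoublyQuenchedConv m' R.law ∧ ∀ ε δ : ℝ, 0 < ε → 0 < δ → ∃ δ' > 0, ∀ᶠ n in atTop,
        covNumber (m n) ε δ ≤ covNumber (m' n) (ε / 2) δ' := by
  have hq := h.quenchedConv
  obtain ⟨ψ, hψ⟩ := exists_isCoding Q R hq.localMean
  exact ⟨_, hψ.doublyQuenchedConv h, fun ε δ hε hδ => hψ.exists_covNumber_le hq.localMean hε hδ⟩

end Recoding

section Additivity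

variable {X Y : Type*}
  [MeasurableSpace X] [StandardBorelSpace X] [MulAction G X] [MeasurableConstSMul G X]
  [MeasurableSpace Y] [StandardBorelSpace Y] [MulAction G Y] [MeasurableConstSMul G Y]
  {μ : ProbabilityMeasure X} {ν : ProbabilityMeasure Y}
  {K L J : Type*}
  [MetricSpace K] [CompactSpace K] [MeasurableSpace K] [BorelSpace K]
  [MetricSpace L] [CompactSpace L] [MeasurableSpace L] [BorelSpace L]
  [MetricSpace J] [CompactSpace J] [MeasurableSpace J] [BorelSpace J]
  (M : ProcessModel G μ K) (N : ProcessModel G ν L)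

omit [Countable G] [CompactSpace J] [BorelSpace J] in
theorem exists_covRate_le_add {m : ∀ n, ProbabilityMeasure (S.V n → J)}
    {m' : ∀ n, ProbabilityMeasure (S.V n → K × L)}
    (h : ∀ ε δ : ℝ, 0 < ε → 0 < δ → ∃ δ' > 0, ∀ᶠ n in atTop,
        covNumber (m n) ε δ ≤ covNumber (m' n) (ε / 2) δ')
    (ε δ : ℝ) (hε : 0 < ε) (hε1 : ε ≤ 1) (hδ : 0 < δ) :
    ∃ ε' δ' : ℝ, 0 < ε' ∧ ε' ≤ 1 ∧ 0 < δ' ∧ ∀ᶠ i in atTop,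
      covRate (m i) ε δ ≤
        covRate ((m' i).map (f := fun x v => (x v).1)
          (measurable_postcomp measurable_fst).aemeasurable) ε' δ' +
        covRate ((m' i).map (f := fun x v => (x v).2)
          (measurable_postcomp measurable_snd).aemeasurable) ε' δ' := by
  obtain ⟨δ', hδ', hev⟩ := h ε δ hε hδ
  refine ⟨ε / 2 / 2, δ' / 2, by positivity, by linarith, by positivity, ?_⟩
  filter_upwards [hev] with i hi
  exact covRate_le_add (hi.trans (covNumber_le_mul _ (by linarith)))

omit [Countable G] [CompactSpace J] [BorelSpace J] in
theorem exists_add_le_covRate {m : ∀ n, ProbabilityMeasure (S.V n → K)}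
    {m' : ∀ n, ProbabilityMeasure (S.V n → L)} {l : ∀ n, ProbabilityMeasure (S.V n → J)}
    (h : ∀ ε δ : ℝ, 0 < ε → 0 < δ → ∃ δ' > 0, ∀ᶠ n in atTop,
        covNumber (prodLaw (m n) (m' n)) ε δ ≤ covNumber (l n) (ε / 2) δ')
    (ε δ : ℝ) (hε : 0 < ε) (hε1 : ε ≤ 1) (hδ : 0 < δ) :
    ∃ ε' δ' : ℝ, 0 < ε' ∧ 0 < δ' ∧ ∀ᶠ i in atTop,
      covRate (m i) ε δ + covRate (m' i) ε δ ≤ covRate (l i) ε' δ' := by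
  obtain ⟨δ', hδ', hev⟩ := h (ε ^ 2) (δ / 2) (by positivity) (by positivity)
  refine ⟨ε ^ 2 / 2, δ', by positivity, hδ', ?_⟩
  filter_upwards [hev] with i hi
  refine add_le_covRate (le_trans ?_ hi)
  refine le_trans ?_ (mul_le_covNumber_prodLaw (δ := δ / 2) (m i) (m' i) hε hε1)
  rw [mul_div_cancel₀ δ two_ne_zero]
  gcongr
  exact covNumber_anti le_rfl (by linarith)

theorem hq_le_add {l : ProbabilityMeasure (X × Y)} (hl : IsJoining G μ ν l)
    (Q : ProcessModel G l J) : S.hq Q.law ≤ S.hq M.law + S.hq N.law := by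
  have := hl.invariant
  refine upperRate_le_add (C := fun S' m => S'.QuenchedConv m Q.law)
    (C₁ := fun S' m => S'.QuenchedConv m M.law) (C₂ := fun S' m => S'.QuenchedConv m N.law)
    fun S' m hm => ?_
  obtain ⟨m', hm', h⟩ := hm.exists_recoding Q (M.pair N hl)
  refine ⟨_, _, ?_, ?_, exists_covRate_le_add h⟩
  · rw [← M.map_law_pair_fst N hl]
    exact hm'.map continuous_fst
  · rw [← M.map_law_pair_snd N hl]
    exact hm'.map continuous_snd

theorem hdq_le_add {l : ProbabilityMeasure (X × Y)} (hl : IsJoining G μ ν l)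
    (Q : ProcessModel G l J) : S.hdq Q.law ≤ S.hdq M.law + S.hdq N.law := by
  have := hl.invariant
  refine upperRate_le_add (C := fun S' m => S'.DoublyQuenchedConv m Q.law)
    (C₁ := fun S' m => S'.DoublyQuenchedConv m M.law)
    (C₂ := fun S' m => S'.DoublyQuenchedConv m N.law) fun S' m hm => ?_
  obtain ⟨m', hm', h⟩ := hm.exists_recoding Q (M.pair N hl)
  refine ⟨_, _, ?_, ?_, exists_covRate_le_add h⟩
  · rw [← M.map_law_pair_fst N hl]
    exact hm'.map continuous_fst
  · rw [← M.map_law_pair_snd N hl]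
    exact hm'.map continuous_snd

variable [SMulInvariantMeasure G X (μ : Measure X)] [SMulInvariantMeasure G Y (ν : Measure Y)]

theorem hdq_add_lowerHdq_le (Q : ProcessModel G (μ.prod ν) J) :
    S.hdq M.law + S.lowerHdq N.law ≤ S.hdq Q.law := by
  have hl := isJoining_prod (G := G) μ ν
  have := hl.invariant
  refine add_le_upperRate (C := fun S' m => S'.DoublyQuenchedConv m Q.law)
    (C₁ := fun S' m => S'.DoublyQuenchedConv m M.law)
    (C₂ := fun S' m => S'.DoublyQuenchedConv m N.law)
    (fun n hn m hm => QuenchedConv.sub hm hn) fun S' m₁ m₂ h₁ h₂ => ?_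
  have h12 := h₁.prodLaw h₂
  rw [← M.law_pair_prod N hl] at h12
  obtain ⟨m', hm', h⟩ := h12.exists_recoding (M.pair N hl) Q
  exact ⟨m', hm', exists_add_le_covRate h⟩

/-- For an ergodic product, local convergence of the product laws is enough for quenched
convergence, so it is not necessary to start from doubly-quenched convergence. -/
theorem hq_add_lowerHq_le (herg : IsErgodic G (μ.prod ν)) (Q : ProcessModel G (μ.prod ν) J) :
    S.hq M.law + S.lowerHq N.law ≤ S.hq Q.law := by
  have hl := isJoining_prod (G := G) μ ν
  have := hl.invariant
  have : ErgodicSMul G (X × Y) (μ.prod ν : Measure (X × Y)) := herg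
  refine add_le_upperRate (C := fun S' m => S'.QuenchedConv m Q.law)
    (C₁ := fun S' m => S'.QuenchedConv m M.law) (C₂ := fun S' m => S'.QuenchedConv m N.law)
    (fun n hn m hm => QuenchedConv.sub hm hn) fun S' m₁ m₂ h₁ h₂ => ?_
  have h12 : S'.QuenchedConv (fun n => prodLaw (m₁ n) (m₂ n)) (M.pair N hl).law := by
    refine QuenchedConv.of_ergodic (M.pair N hl).measurePreserving_shiftName
      (M.pair N hl).ae_eq_const_of_ergodic ?_
    rw [M.law_pair_prod N hl]
    exact localMean_prodLaw h₁.localMean h₂.localMean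
  obtain ⟨m', hm', h⟩ := h12.exists_recoding (M.pair N hl) Q
  exact ⟨m', hm', exists_add_le_covRate h⟩

end Additivity

end SoficApproximation

/-! ### Products with weakly mixing systems -/

theorem IsErgodic.prod_of_weaklyMixing {G : Type*} [Group G] [Countable G] {X Y : Type*}
    [MeasurableSpace X] [MulAction G X] [MeasurableConstSMul G X]
    [MeasurableSpace Y] [MulAction G Y] [MeasurableConstSMul G Y]
    {μ : ProbabilityMeasure X} {ν : ProbabilityMeasure Y} (hμ : IsErgodic G μ)
    (hν : IsErgodic G ν) (hw : IsWeaklyMixing G μ) : IsErgodic G (μ.prod ν) := by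
  have h1 : ErgodicSMul G X (μ : Measure X) := hμ
  have h2 : ErgodicSMul G Y (ν : Measure Y) := hν
  have h3 : ErgodicSMul G (X × X) ((μ : Measure X).prod μ) := by
    rw [← ProbabilityMeasure.toMeasure_prod]; exact hw
  unfold IsErgodic
  rw [ProbabilityMeasure.toMeasure_prod]
  exact ergodicSMul_prod_of_weaklyMixing _ _

theorem IsErgodic.prod_swap {G : Type*} [Group G] {X Y : Type*}
    [MeasurableSpace X] [MulAction G X] [MeasurableSpace Y] [MulAction G Y]
    {μ : ProbabilityMeasure X} {ν : ProbabilityMeasure Y} (h : IsErgodic G (ν.prod μ)) :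
    IsErgodic G (μ.prod ν) := by
  unfold IsErgodic at h ⊢
  rw [ProbabilityMeasure.toMeasure_prod] at h ⊢
  have hmp : MeasurePreserving (MeasurableEquiv.prodComm : Y × X ≃ᵐ X × Y)
      ((ν : Measure Y).prod (μ : Measure X)) ((μ : Measure X).prod ν) :=
    Measure.measurePreserving_swap
  refine
    { measure_preimage_smul := fun c s hs => ?_
      aeconst_of_forall_preimage_smul_ae_eq := fun {s} hs hinv => ?_ }
  · rw [← hmp.measure_preimage_equiv, ← hmp.measure_preimage_equiv s]
    exact h.measure_preimage_smul c (hs.preimage hmp.measurable)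
  · have h1 := h.aeconst_of_forall_preimage_smul_ae_eq (hs.preimage hmp.measurable) fun g =>
      hmp.quasiMeasurePreserving.preimage_ae_eq (hinv g)
    rw [eventuallyConst_set'] at h1 ⊢
    refine h1.imp (fun h2 => ?_) fun h2 => ?_
    · have := (hmp.symm _).quasiMeasurePreserving.preimage_ae_eq h2
      simpa [← Set.preimage_comp] using this
    · have := (hmp.symm _).quasiMeasurePreserving.preimage_ae_eq h2
      simpa [← Set.preimage_comp] using this

theorem IsErgodic.prod {G : Type*} [Group G] [Countable G] {X Y : Type*}
    [MeasurableSpace X] [MulAction G X] [MeasurableConstSMul G X]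
    [MeasurableSpace Y] [MulAction G Y] [MeasurableConstSMul G Y]
    {μ : ProbabilityMeasure X} {ν : ProbabilityMeasure Y} (hμ : IsErgodic G μ)
    (hν : IsErgodic G ν) (hw : IsWeaklyMixing G μ ∨ IsWeaklyMixing G ν) :
    IsErgodic G (μ.prod ν) :=
  hw.elim (fun h => hμ.prod_of_weaklyMixing hν h) fun h =>
    (hν.prod_of_weaklyMixing hμ h).prod_swap

theorem theoremC {G : Type*} [Group G] [Countable G] (S : SoficApproximation G)
    {X Y : Type*}
    [MeasurableSpace X] [StandardBorelSpace X] [MulAction G X] [MeasurableConstSMul G X]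
    [MeasurableSpace Y] [StandardBorelSpace Y] [MulAction G Y] [MeasurableConstSMul G Y]
    (μ : ProbabilityMeasure X) [SMulInvariantMeasure G X (μ : Measure X)]
    (ν : ProbabilityMeasure Y) [SMulInvariantMeasure G Y (ν : Measure Y)]
    -- compact metric state spaces for processes isomorphic to the systems
    {K L J : Type*}
    [MetricSpace K] [CompactSpace K] [MeasurableSpace K] [BorelSpace K]
    [MetricSpace L] [CompactSpace L] [MeasurableSpace L] [BorelSpace L]
    [MetricSpace J] [CompactSpace J] [MeasurableSpace J] [BorelSpace J]
    (M : ProcessModel G μ K) (N : ProcessModel G ν L) :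
    -- subadditivity for arbitrary joinings
    (∀ l : ProbabilityMeasure (X × Y), IsJoining G μ ν l → ∀ Q : ProcessModel G l J,
      S.hdq Q.law ≤ S.hdq M.law + S.hdq N.law ∧
      S.hq Q.law ≤ S.hq M.law + S.hq N.law) ∧
    -- Cartesian products
    (∀ Q : ProcessModel G (μ.prod ν) J,
      S.hdq Q.law ≤ S.hdq M.law + S.hdq N.law ∧
      S.hq Q.law ≤ S.hq M.law + S.hq N.law ∧
      (S.hdq N.law = S.lowerHdq N.law → S.hdq Q.law = S.hdq M.law + S.hdq N.law) ∧
      (IsErgodic G (μ.prod ν) → S.hq N.law = S.lowerHq N.law →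
        S.hq Q.law = S.hq M.law + S.hq N.law) ∧
      (IsErgodic G μ → IsErgodic G ν → (IsWeaklyMixing G μ ∨ IsWeaklyMixing G ν) →
        S.hq N.law = S.lowerHq N.law →
        S.hq Q.law = S.hq M.law + S.hq N.law)) ∧
    -- an ergodic system times a weakly mixing one is ergodic
    (IsErgodic G μ → IsErgodic G ν → (IsWeaklyMixing G μ ∨ IsWeaklyMixing G ν) →
      IsErgodic G (μ.prod ν)) := by
  have hl := isJoining_prod (G := G) μ ν
  have hadd : ∀ Q : ProcessModel G (μ.prod ν) J, IsErgodic G (μ.prod ν) →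
      S.hq N.law = S.lowerHq N.law → S.hq Q.law = S.hq M.law + S.hq N.law := by
    intro Q herg h
    refine le_antisymm (SoficApproximation.hq_le_add M N hl Q) ?_
    rw [h]
    exact SoficApproximation.hq_add_lowerHq_le M N herg Q
  refine ⟨fun l hl Q => ⟨SoficApproximation.hdq_le_add M N hl Q,
    SoficApproximation.hq_le_add M N hl Q⟩, fun Q => ⟨SoficApproximation.hdq_le_add M N hl Q,
    SoficApproximation.hq_le_add M N hl Q, fun h => ?_, hadd Q, fun hμ hν hw =>
    hadd Q (hμ.prod hν hw)⟩, fun hμ hν hw => hμ.prod hν hw⟩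
  refine le_antisymm (SoficApproximation.hdq_le_add M N hl Q) ?_
  rw [h]
  exact SoficApproximation.hdq_add_lowerHdq_le M N Q
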